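/- Let $M$ be a smooth, finite-dimensional, second countable, connected, Hausdorff manifold, let $m\ge 0$, and let $f:M\times\mathbb{R}^m\to TM$ be a smooth map with $f(x,u)\in T_xM$ for all $x\in M$, $u\in\mathbb{R}^m$. For a control system $\dot z=F(z,w)$ on a manifold $N$ with controls valued in $\mathbb{R}^m$, say that $z_1$ is reachable from $z_0$ if there are $T\ge 0$, a piecewise constant control $w:[0,T]\to\mathbb{R}^m$ (constant on each interval $[T_{i-1},T_i)$ of a finite partition $0=T_0<\dots<T_k=T$) and an absolutely continuous curve $z:[0,T]\to N$ with $z(0)=z_0$, $z(T)=z_1$ and $\dot z(t)=F(z(t),w(t))$ for almost every $t\in[0,T]$; the system is globally controllable if every point of $N$ is reachable from every point of $N$. Then the system $$\dot x=f(x,u)$$ on $M$ with control $u$ is globally controllable if and only if the affine system obtained by adding an integrator, $$\dot x=f(x,y),\qquad \dot y=v,$$ on $M\times\mathbb{R}^m$ with state $(x,y)$ and control $v$ valued in $\mathbb{R}^m$, is globally controllable. -/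

import Mathlib

open scoped Manifold ContDiff Topology

noncomputable section

namespace ControlSystem

/-- The control space `ℝ^m`. -/
abbrev ControlSpace (m : ℕ) : Type := EuclideanSpace ℝ (Fin m)

/-- `u` is piecewise constant on `[0, T]`: there is a finite partition
`0 = τ 0 < τ 1 < ⋯ < τ k = T` such that `u` is constant on each interval `[τ i, τ (i + 1))`.
Values of `u` outside `[0, T]` play no role. (This forces `0 ≤ T`.) -/
def IsPiecewiseConstant {U : Type*} (T : ℝ) (u : ℝ → U) : Prop :=
  ∃ (k : ℕ) (τ : ℕ → ℝ), τ 0 = 0 ∧ τ k = T ∧ (∀ i < k, τ i < τ (i + 1)) ∧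
    ∀ i < k, ∀ t ∈ Set.Ico (τ i) (τ (i + 1)), u t = u (τ i)

section Trajectories

variable {E : Type*} [NormedAddCommGroup E] [NormedSpace ℝ E]
  {H : Type*} [TopologicalSpace H] (I : ModelWithCorners ℝ E H)
  {N : Type*} [TopologicalSpace N] [ChartedSpace H N] {U : Type*}

/-- The curve `γ : [0, T] → N` is absolutely continuous: it is continuous, and on every
subinterval that it maps into a coordinate domain its coordinate expression is absolutely
continuous. Values of `γ` outside `[0, T]` play no role. -/
def IsAbsolutelyContinuousCurve (T : ℝ) (γ : ℝ → N) : Prop :=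
  ContinuousOn γ (Set.Icc 0 T) ∧
    ∀ (p : N) (a b : ℝ), 0 ≤ a → a ≤ b → b ≤ T →
      Set.MapsTo γ (Set.Icc a b) (extChartAt I p).source →
        AbsolutelyContinuousOnInterval (fun t => extChartAt I p (γ t)) a b

/-- `γ : [0, T] → N` is a trajectory of the control system `ẋ = F(x, u)` associated with the
control `u : [0, T] → U`: it is absolutely continuous and `γ'(t) = F(γ(t), u(t))` for almost
every `t ∈ [0, T]`. -/
def IsTrajectory (F : (x : N) → U → TangentSpace I x) (T : ℝ) (u : ℝ → U) (γ : ℝ → N) : Prop :=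
  IsAbsolutelyContinuousCurve I T γ ∧
    ∀ᵐ t ∂(MeasureTheory.volume.restrict (Set.Icc (0 : ℝ) T)),
      HasMFDerivAt 𝓘(ℝ, ℝ) I γ t ((1 : ℝ →L[ℝ] ℝ).smulRight (F (γ t) (u t)))

/-- The reachable set of `x₀`: the endpoints `γ(T)` of the trajectories `γ : [0, T] → N` with
`γ(0) = x₀` that are associated with a piecewise constant control. -/
def reachableSet (F : (x : N) → U → TangentSpace I x) (x₀ : N) : Set N :=
  {x₁ | ∃ (T : ℝ) (u : ℝ → U) (γ : ℝ → N), 0 ≤ T ∧ IsPiecewiseConstant T u ∧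
    IsTrajectory I F T u γ ∧ γ 0 = x₀ ∧ γ T = x₁}

/-- The system `ẋ = F(x, u)` is globally controllable: every reachable set is the whole state
space. -/
def IsGloballyControllable (F : (x : N) → U → TangentSpace I x) : Prop :=
  ∀ x : N, reachableSet I F x = Set.univ

/-- `F : N × ℝ^m → TN` is smooth. -/
def IsSmoothSystem [IsManifold I ∞ N] {m : ℕ}
    (F : (x : N) → ControlSpace m → TangentSpace I x) : Prop :=
  ContMDiff (I.prod (𝓡 m)) I.tangent ∞
    (fun q : N × ControlSpace m => (⟨q.1, F q.1 q.2⟩ : TangentBundle I N))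

/-- The extension of `ẋ = f(x, u)` by an integrator: the system `ẋ = f(x, y)`, `ẏ = v` on
`N × ℝ^m` with control `v`. The tangent space of `N × ℝ^m` at `(x, y)` is `T_x N × ℝ^m`. -/
def integratorExtension {m : ℕ} (f : (x : N) → ControlSpace m → TangentSpace I x)
    (q : N × ControlSpace m) (v : ControlSpace m) : TangentSpace (I.prod (𝓡 m)) q :=
  ((f q.1 q.2 : E), v)

end Trajectories

end ControlSystem

end

noncomputable section

open scoped Manifold ContDiff Topology NNReal ENNReal BoundedContinuousFunction
open MeasureTheory Set Filter

set_option linter.unusedSectionVars false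

namespace ControlSystem

/-! ### Superposition operators on L² -/

section Nemytskii

variable {α : Type*} [MeasurableSpace α] {μ : Measure α} [IsFiniteMeasure μ]
  {Q E : Type*} [NormedAddCommGroup Q] [NormedSpace ℝ Q]
  [NormedAddCommGroup E] [NormedSpace ℝ E]

/-! Both controllability properties are compared with an intermediate one: any two distinct points
of M are joined by a trajectory of ẋ = f(x, u) with a bounded measurable control u. Piecewise
constant controls are bounded, and the y-component of a trajectory of the extended system is a
continuous, hence bounded, control. The theorem therefore reduces to `exists_nodal_solution`:
bounded measurable controls can be replaced, without changing the endpoint, by piecewise constant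
ones (which gives ẋ = f(x, u)) or by continuous piecewise affine ones with prescribed end values
(which gives the extended system).

Approximating a control in L² moves the endpoint a little, and this error can be corrected if the
endpoint map is a submersion at the control. At fixed final time this may fail for every control:
for ẋ = 1 on the circle the endpoint does not depend on the control at all. So the speed of
traversal is made a control too, in the system `timed`, ẋ = exp(σ) f(x, u); this also normalises
every duration to 1.

The endpoint map must be differentiable for the L² topology, in which continuous and step functions
are dense. The field is switched off for large controls by `cutoff`, which does not affect the given
bounded controls. `contDiff_nemytskii` and a contraction argument then give C¹ flow boxes, and a
subdivision of the time interval gives a C¹ endpoint map near each trajectory (`exists_flowBox`,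
`IsSolution.exists_isFlowNear`).

The heart is `attainsRank_finrank`. Take a bounded control at which the rank r of the differential
of the endpoint map is maximal. Its rank persists when it is continued by any bounded control,
because the flow is locally invertible, so the rank is constantly r at the continuations. By a
constant rank theorem (`exists_dimH_image_le`) and the Lindelöf property of L², the set of points
reached has Hausdorff dimension at most r. Since every point is reached, r = dim M. Continuing such
a control to a given target makes every point a regular endpoint (`exists_regular_endpoint`).

Finally the control and finitely many directions spanning the tangent space are all approximated by
nodal functions on one grid. By `eventually_exists_apply_add_sum_smul_eq` some combination hits the
target exactly, and it is again nodal. On each cell the speed is constant, so returning to the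
original clock keeps constant controls constant and affine ones affine. -/

theorem memLp_comp_of_bounded {g : Q → E} (hg : Continuous g) {C : ℝ} (hC : ∀ z, ‖g z‖ ≤ C)
    (p : ℝ≥0∞) (z : Lp Q 2 μ) : MemLp (fun s => g (z s)) p μ :=
  MemLp.of_bound (hg.comp_aestronglyMeasurable (Lp.aestronglyMeasurable z)) C
    (Eventually.of_forall fun _ => hC _)

/-- The superposition operator `z ↦ g ∘ z` of a bounded continuous map, from `L²` to `Lᵖ`. -/
def nemytskii (μ : Measure α) [IsFiniteMeasure μ] (p : ℝ≥0∞) {g : Q → E} (hg : Continuous g) {C : ℝ}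
    (hC : ∀ z, ‖g z‖ ≤ C) (z : Lp Q 2 μ) : Lp E p μ :=
  (memLp_comp_of_bounded hg hC p z).toLp

theorem coeFn_nemytskii (p : ℝ≥0∞) {g : Q → E} (hg : Continuous g) {C : ℝ}
    (hC : ∀ z, ‖g z‖ ≤ C) (z : Lp Q 2 μ) : nemytskii μ p hg hC z =ᵐ[μ] fun s => g (z s) :=
  MemLp.coeFn_toLp _

theorem lipschitzWith_nemytskii {g : Q → E} (hg : Continuous g) {C : ℝ}
    (hC : ∀ z, ‖g z‖ ≤ C) {K : ℝ≥0} (hK : LipschitzWith K g) :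
    LipschitzWith K (nemytskii μ 2 hg hC) := by
  refine LipschitzWith.of_dist_le_mul fun z z' => ?_
  rw [dist_eq_norm, dist_eq_norm]
  refine Lp.norm_le_mul_norm_of_ae_le_mul ?_
  filter_upwards [Lp.coeFn_sub (nemytskii μ 2 hg hC z) (nemytskii μ 2 hg hC z'),
    Lp.coeFn_sub z z', coeFn_nemytskii 2 hg hC z, coeFn_nemytskii 2 hg hC z'] with s h1 h2 h3 h4
  rw [h1, h2, Pi.sub_apply, Pi.sub_apply, h3, h4, ← dist_eq_norm, ← dist_eq_norm]
  exact hK.dist_le_mul _ _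

/-- Hölder's inequality with exponents 2 and 2, applied to the product of the scalar function s ↦ ‖h
s‖ with itself. -/
theorem norm_le_of_ae_le_sq {C : ℝ} (r : Lp E 1 μ) (h : Lp Q 2 μ)
    (H : ∀ᵐ s ∂μ, ‖r s‖ ≤ C * (‖h s‖ * ‖h s‖)) (hC : 0 ≤ C) : ‖r‖ ≤ C * (‖h‖ * ‖h‖) := by
  set hn : Lp ℝ 2 μ := (Lp.memLp h).norm.toLp with hhn
  have e1 : ‖hn‖ = ‖h‖ := by
    rw [hhn, Lp.norm_toLp, Lp.norm_def, eLpNorm_norm]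
  have e2 : ‖(ContinuousLinearMap.mul ℝ ℝ).holder 1 hn hn‖ ≤ ‖h‖ * ‖h‖ := by
    refine (ContinuousLinearMap.norm_holder_apply_apply_le _ _ _).trans ?_
    rw [e1, ContinuousLinearMap.opNorm_mul, one_mul]
  refine le_trans (Lp.norm_le_mul_norm_of_ae_le_mul (c := C)
    (g := (ContinuousLinearMap.mul ℝ ℝ).holder 1 hn hn) ?_) (mul_le_mul_of_nonneg_left e2 hC)
  filter_upwards [H, (ContinuousLinearMap.mul ℝ ℝ).coeFn_holder (r := 1) hn hn,
    (Lp.memLp h).norm.coeFn_toLp] with s h1 h2 h3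
  rw [h2, h3]
  simpa [abs_of_nonneg] using h1

theorem norm_sub_sub_fderiv_le {g : Q → E} (hg : Differentiable ℝ g) {K : ℝ≥0}
    (hK : LipschitzWith K (fderiv ℝ g)) (x y : Q) :
    ‖g y - g x - fderiv ℝ g x (y - x)‖ ≤ K * (‖y - x‖ * ‖y - x‖) := by
  have := Convex.norm_image_sub_le_of_norm_fderiv_le' (𝕜 := ℝ) (f := g) (C := K * ‖y - x‖)
    (s := segment ℝ x y) (φ := fderiv ℝ g x) (fun z _ => hg z) (fun z hz => ?_)
    (convex_segment x y) (left_mem_segment ℝ x y) (right_mem_segment ℝ x y)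
  · simpa [mul_assoc] using this
  · rw [← dist_eq_norm]
    refine (hK.dist_le_mul z x).trans ?_
    gcongr
    rw [dist_eq_norm]
    obtain ⟨t, ht, rfl⟩ := (segment_eq_image' ℝ x y).subset hz
    rw [add_sub_cancel_left, norm_smul, Real.norm_of_nonneg ht.1]
    exact mul_le_of_le_one_left (norm_nonneg _) ht.2

/-- The Taylor remainder of `g` is pointwise quadratic, so its L¹ norm is controlled by the square
of the L² norm of the increment; this is why the target is L¹ and not L². The derivative at z is the
Hölder product with `fderiv ℝ g ∘ z`, which is Lipschitz in z as an element of L². -/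
theorem contDiff_nemytskii {g : Q → E} (hg : ContDiff ℝ 2 g) {C : ℝ} (hC : ∀ z, ‖g z‖ ≤ C)
    {C' : ℝ} (hC' : ∀ z, ‖fderiv ℝ g z‖ ≤ C') {K : ℝ≥0} (hK : LipschitzWith K (fderiv ℝ g)) :
    ContDiff ℝ 1 (nemytskii μ 1 hg.continuous hC) := by
  have hd : Continuous (fderiv ℝ g) := hg.continuous_fderiv (by norm_num)
  set B : (Q →L[ℝ] E) →L[ℝ] Q →L[ℝ] E := ContinuousLinearMap.id ℝ (Q →L[ℝ] E)
  refine contDiff_one_iff_hasFDerivAt.2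
    ⟨fun z => B.holderL μ 2 2 1 (nemytskii μ 2 hd hC' z),
      (B.holderL μ 2 2 1).continuous.comp (lipschitzWith_nemytskii hd hC' hK).continuous,
      fun z => ?_⟩
  rw [hasFDerivAt_iff_isLittleO_nhds_zero]
  have key : ∀ h : Lp Q 2 μ, ‖nemytskii μ 1 hg.continuous hC (z + h)
      - nemytskii μ 1 hg.continuous hC z - B.holderL μ 2 2 1 (nemytskii μ 2 hd hC' z) h‖
      ≤ K * (‖h‖ * ‖h‖) := by
    intro h
    refine norm_le_of_ae_le_sq _ _ ?_ K.2
    filter_upwards [Lp.coeFn_sub (nemytskii μ 1 hg.continuous hC (z + h)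
        - nemytskii μ 1 hg.continuous hC z) (B.holderL μ 2 2 1 (nemytskii μ 2 hd hC' z) h),
      Lp.coeFn_sub (nemytskii μ 1 hg.continuous hC (z + h)) (nemytskii μ 1 hg.continuous hC z),
      Lp.coeFn_add z h, coeFn_nemytskii 1 hg.continuous hC z,
      coeFn_nemytskii 1 hg.continuous hC (z + h), coeFn_nemytskii 2 hd hC' z,
      B.coeFn_holder (r := 1) (nemytskii μ 2 hd hC' z) h] with s h1 h2 h3 h4 h5 h6 h7
    rw [h1, Pi.sub_apply, h2, Pi.sub_apply, h4, h5, h3, ContinuousLinearMap.holderL_apply_apply,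
      h7, h6, Pi.add_apply]
    have := norm_sub_sub_fderiv_le (hg.differentiable (by norm_num)) hK (z s) (z s + h s)
    simpa [B] using this
  refine Asymptotics.IsLittleO.of_bound fun c hc => ?_
  have : Tendsto (fun h : Lp Q 2 μ => K * ‖h‖) (𝓝 0) (𝓝 0) := by
    have := ((continuous_norm (E := Lp Q 2 μ)).tendsto 0).const_mul (K : ℝ)
    simpa using this
  filter_upwards [this.eventually (gt_mem_nhds hc)] with h hh
  refine (key h).trans ?_
  rw [← mul_assoc]
  exact mul_le_mul_of_nonneg_right hh.le (norm_nonneg _)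

/-- Cauchy–Schwarz against the constant 1. The factor √μ is what makes the integral operator a
contraction on short windows. -/
theorem lipschitzWith_nemytskii_one {g : Q → E} (hg : Continuous g) {C : ℝ}
    (hC : ∀ z, ‖g z‖ ≤ C) {K : ℝ≥0} (hK : LipschitzWith K g) (z z' : Lp Q 2 μ) :
    ‖nemytskii μ 1 hg hC z - nemytskii μ 1 hg hC z'‖
      ≤ K * (‖z - z'‖ * √(μ.real univ)) := by
  set hn : Lp ℝ 2 μ := (Lp.memLp (z - z')).norm.toLp with hhn
  have e1 : ‖hn‖ = ‖z - z'‖ := by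
    rw [hhn, Lp.norm_toLp, Lp.norm_def (z - z'), eLpNorm_norm]
  have one : MemLp (fun _ : α => (1 : ℝ)) 2 μ := memLp_const 1
  have e3 : ‖one.toLp‖ = √(μ.real univ) := by
    rw [Lp.norm_toLp, eLpNorm_const' _ (by norm_num) (by norm_num)]
    simp [Real.sqrt_eq_rpow, Measure.real, ENNReal.toReal_rpow]
  have e2 : ‖(ContinuousLinearMap.mul ℝ ℝ).holder 1 hn one.toLp‖ ≤ ‖z - z'‖ * √(μ.real univ) := by
    refine (ContinuousLinearMap.norm_holder_apply_apply_le _ _ _).trans ?_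
    rw [e1, e3, ContinuousLinearMap.opNorm_mul, one_mul]
  refine le_trans (Lp.norm_le_mul_norm_of_ae_le_mul (c := K)
    (g := (ContinuousLinearMap.mul ℝ ℝ).holder 1 hn one.toLp) ?_)
    (mul_le_mul_of_nonneg_left e2 K.2)
  filter_upwards [(ContinuousLinearMap.mul ℝ ℝ).coeFn_holder (r := 1) hn one.toLp,
    (Lp.memLp (z - z')).norm.coeFn_toLp, one.coeFn_toLp,
    Lp.coeFn_sub (nemytskii μ 1 hg hC z) (nemytskii μ 1 hg hC z'),
    Lp.coeFn_sub z z', coeFn_nemytskii 1 hg hC z, coeFn_nemytskii 1 hg hC z']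
    with s h2 h3 h4 h5 h6 h7 h8
  rw [h2, h3, h4, h5, Pi.sub_apply, h7, h8, h6, Pi.sub_apply]
  have := hK.dist_le_mul (z s) (z' s)
  rw [dist_eq_norm, dist_eq_norm] at this
  simpa using this

end Nemytskii

/-! ### The integral equation on a short window -/

section IntegralEquation

variable {P E : Type*} [NormedAddCommGroup P] [NormedSpace ℝ P]
  [NormedAddCommGroup E] [NormedSpace ℝ E]

theorem norm_intervalIntegral_le_norm_L1 (μ : Measure ℝ) (c t : ℝ) (h : Lp E 1 μ) :
    ‖∫ s in c..t, h s ∂μ‖ ≤ ‖h‖ := by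
  refine intervalIntegral.norm_integral_le_integral_norm_uIoc.trans ?_
  rw [L1.norm_eq_integral_norm]
  exact setIntegral_le_integral (L1.integrable_coeFn h).norm
    (Eventually.of_forall fun _ => norm_nonneg _)

/-- The primitive of an integrable function with base point `c`, as a bounded continuous
function. -/
def primitive (μ : Measure ℝ) [NullSingletonClass μ] (c : ℝ) : Lp E 1 μ →L[ℝ] (ℝ →ᵇ E) :=
  LinearMap.mkContinuous
    { toFun := fun h => BoundedContinuousFunction.ofNormedAddCommGroup
        (fun t => ∫ s in c..t, h s ∂μ)
        (intervalIntegral.continuous_primitive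
          (fun _ _ => (L1.integrable_coeFn h).intervalIntegrable) c) ‖h‖ 
        (fun t => norm_intervalIntegral_le_norm_L1 μ c t h)
      map_add' := fun h k => by
        ext t
        simp only [BoundedContinuousFunction.coe_ofNormedAddCommGroup,
          BoundedContinuousFunction.coe_add, Pi.add_apply]
        rw [← intervalIntegral.integral_add (L1.integrable_coeFn h).intervalIntegrable
          (L1.integrable_coeFn k).intervalIntegrable]
        refine intervalIntegral.integral_congr_ae_restrict ?_
        exact ae_restrict_of_ae (Lp.coeFn_add h k)
      map_smul' := fun r h => by
        ext t
        simp only [BoundedContinuousFunction.coe_ofNormedAddCommGroup, RingHom.id_apply,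
          BoundedContinuousFunction.coe_smul]
        rw [← intervalIntegral.integral_smul]
        refine intervalIntegral.integral_congr_ae_restrict ?_
        exact ae_restrict_of_ae (Lp.coeFn_smul r h) } 1 (fun h => by
    rw [one_mul]
    exact BoundedContinuousFunction.norm_ofNormedAddCommGroup_le _ (norm_nonneg _)
      (fun t => norm_intervalIntegral_le_norm_L1 μ c t h))

theorem primitive_apply (μ : Measure ℝ) [NullSingletonClass μ] (c : ℝ) (h : Lp E 1 μ) (t : ℝ) :
    primitive μ c h t = ∫ s in c..t, h s ∂μ := rfl

theorem norm_primitive_apply_le (μ : Measure ℝ) [NullSingletonClass μ] (c : ℝ) (h : Lp E 1 μ) :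
    ‖primitive μ c h‖ ≤ ‖h‖ :=
  BoundedContinuousFunction.norm_ofNormedAddCommGroup_le _ (norm_nonneg _)
      (fun t => norm_intervalIntegral_le_norm_L1 μ c t h)

/-- Constant functions as a continuous linear map. -/
def constBCF : E →L[ℝ] (ℝ →ᵇ E) :=
  LinearMap.mkContinuous
    { toFun := fun x => BoundedContinuousFunction.const ℝ x
      map_add' := fun _ _ => rfl
      map_smul' := fun _ _ => rfl } 1 (fun x => by
    rw [one_mul]
    exact BoundedContinuousFunction.norm_const_le x)

@[simp] theorem constBCF_apply (x : E) (t : ℝ) : constBCF x t = x := rfl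

/-- The pair formed by a curve and a control, as an element of `L²` of the window `[a, b]`. -/
def pairL2 (a b : ℝ) : ((ℝ →ᵇ E) × Lp P 2 (volume : Measure ℝ)) →L[ℝ]
    Lp (E × P) 2 (volume.restrict (Icc a b)) :=
  ((ContinuousLinearMap.inl ℝ E P).compLpL 2 (volume.restrict (Icc a b))
    ∘L BoundedContinuousFunction.toLp 2 (volume.restrict (Icc a b)) ℝ
    ∘L ContinuousLinearMap.fst ℝ (ℝ →ᵇ E) (Lp P 2 (volume : Measure ℝ)))
  + ((ContinuousLinearMap.inr ℝ E P).compLpL 2 (volume.restrict (Icc a b))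
    ∘L LpToLpRestrictCLM ℝ P ℝ volume 2 (Icc a b)
    ∘L ContinuousLinearMap.snd ℝ (ℝ →ᵇ E) (Lp P 2 (volume : Measure ℝ)))

theorem coeFn_pairL2 (a b : ℝ) (q : (ℝ →ᵇ E) × Lp P 2 (volume : Measure ℝ)) :
    pairL2 a b q =ᵐ[volume.restrict (Icc a b)] fun s => (q.1 s, q.2 s) := by
  set μ := volume.restrict (Icc a b)
  filter_upwards [Lp.coeFn_add
      ((ContinuousLinearMap.inl ℝ E P).compLpL 2 μ (BoundedContinuousFunction.toLp 2 μ ℝ q.1))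
      ((ContinuousLinearMap.inr ℝ E P).compLpL 2 μ (LpToLpRestrictCLM ℝ P ℝ volume 2 (Icc a b) q.2)),
    (ContinuousLinearMap.inl ℝ E P).coeFn_compLpL (BoundedContinuousFunction.toLp 2 μ ℝ q.1),
    (ContinuousLinearMap.inr ℝ E P).coeFn_compLpL
      (LpToLpRestrictCLM ℝ P ℝ volume 2 (Icc a b) q.2),
    BoundedContinuousFunction.coeFn_toLp (p := 2) (μ := μ) (𝕜 := ℝ) q.1,
    LpToLpRestrictCLM_coeFn ℝ (Icc a b) q.2] with s h1 h2 h3 h4 h5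
  refine h1.trans ?_
  rw [Pi.add_apply, h2, h3, h4, h5]
  simp

theorem norm_pairL2_le {a b : ℝ} (hab : b - a ≤ 1)
    (q : (ℝ →ᵇ E) × Lp P 2 (volume : Measure ℝ)) : ‖pairL2 a b q‖ ≤ 2 * ‖q‖ := by
  set μ := volume.restrict (Icc a b)
  have h1 : ‖(ContinuousLinearMap.inl ℝ E P).compLpL 2 μ
      (BoundedContinuousFunction.toLp 2 μ ℝ q.1)‖ ≤ ‖q.1‖ := by
    refine (ContinuousLinearMap.norm_compLp_le _ _).trans ?_
    refine (mul_le_of_le_one_left (norm_nonneg _) (ContinuousLinearMap.norm_inl_le_one ℝ E P)).trans ?_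
    refine (BoundedContinuousFunction.Lp_norm_le q.1).trans (mul_le_of_le_one_left (norm_nonneg _) ?_)
    have : (measureUnivNNReal μ : ℝ) ≤ 1 := by
      rw [measureUnivNNReal]
      simp only [μ, Measure.restrict_apply MeasurableSet.univ, univ_inter, Real.volume_Icc]
      rw [ENNReal.coe_toNNReal_eq_toReal]
      exact ENNReal.toReal_le_of_le_ofReal zero_le_one (ENNReal.ofReal_le_ofReal hab)
    exact Real.rpow_le_one (NNReal.coe_nonneg _) this (by simp)
  have h2 : ‖(ContinuousLinearMap.inr ℝ E P).compLpL 2 μ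
      (LpToLpRestrictCLM ℝ P ℝ volume 2 (Icc a b) q.2)‖ ≤ ‖q.2‖ := by
    refine (ContinuousLinearMap.norm_compLp_le _ _).trans ?_
    refine (mul_le_of_le_one_left (norm_nonneg _) (ContinuousLinearMap.norm_inr_le_one ℝ E P)).trans ?_
    exact norm_Lp_toLp_restrict_le _ _
  calc ‖pairL2 a b q‖ ≤ ‖q.1‖ + ‖q.2‖ := (norm_add_le _ _).trans (add_le_add h1 h2)
    _ ≤ ‖q‖ + ‖q‖ := add_le_add (norm_fst_le q) (norm_snd_le q)
    _ = 2 * ‖q‖ := by ring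

/-- A perturbation `q ↦ (q.1 - N q, q.2)` of the identity by a `C¹` contraction has a `C¹`
inverse. -/
theorem exists_contDiff_inverse_shear {X Y : Type*} [NormedAddCommGroup X] [NormedSpace ℝ X]
    [NormedAddCommGroup Y] [NormedSpace ℝ Y] [CompleteSpace X] [CompleteSpace Y]
    {N : X × Y → X} (hN : ContDiff ℝ 1 N) (hL : LipschitzWith (1 / 2) N) :
    ∃ S : X × Y → X, ContDiff ℝ 1 S ∧ ∀ q z, z - N (z, q.2) = q.1 ↔ z = S q := by
  set A : X × Y → X × Y := fun q => (q.1 - N q, q.2) with hA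
  have hAC : ContDiff ℝ 1 A := (contDiff_fst.sub hN).prodMk contDiff_snd
  -- `A` differs from the identity by a map that is 1/2-Lipschitz, and 1/2 < 1, so it is a
  -- homeomorphism of the whole space.
  have hap : ApproximatesLinearOn A
      ((ContinuousLinearEquiv.refl ℝ (X × Y) : (X × Y) ≃L[ℝ] (X × Y)) : X × Y →L[ℝ] X × Y)
      univ (1 / 2) := by
    intro q _ q' _
    have e : A q - A q' - (ContinuousLinearEquiv.refl ℝ (X × Y) : X × Y →L[ℝ] X × Y) (q - q')
        = (-(N q - N q'), 0) := by
      refine Prod.ext ?_ ?_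
      · simp only [hA, ContinuousLinearEquiv.coe_coe, ContinuousLinearEquiv.refl_apply,
          Prod.fst_sub]
        abel
      · simp [hA]
    rw [e, Prod.norm_def]
    simp only [norm_neg, norm_zero]
    rw [max_eq_left (norm_nonneg _), ← dist_eq_norm, ← dist_eq_norm]
    exact hL.dist_le_mul _ _
  have hc : Subsingleton (X × Y) ∨ (1 / 2 : ℝ≥0) <
      ‖((ContinuousLinearEquiv.refl ℝ (X × Y)).symm : X × Y →L[ℝ] X × Y)‖₊⁻¹ := by
    rcases subsingleton_or_nontrivial (X × Y) with h | h
    · exact Or.inl h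
    · right
      have : ‖((ContinuousLinearEquiv.refl ℝ (X × Y)).symm : X × Y →L[ℝ] X × Y)‖₊ = 1 := by
        exact ContinuousLinearMap.nnnorm_id
      rw [this, inv_one]
      exact NNReal.half_lt_self one_ne_zero
  set e : X × Y ≃ₜ X × Y := hap.toHomeomorph A hc with he
  have hea : ∀ q, e q = A q := fun q => rfl
  set N' : X × Y → (X × Y →L[ℝ] X × Y) := fun q =>
    ContinuousLinearMap.inl ℝ X Y ∘L fderiv ℝ N q
  -- The derivative of `A` is `1 - N'`, which is invertible by the Neumann series.
  have hN' : ∀ q, ‖N' q‖ < 1 := by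
    intro q
    have h1 : ‖fderiv ℝ N q‖ ≤ (1 / 2 : ℝ≥0) := norm_fderiv_le_of_lipschitz ℝ hL
    have h2 : ‖N' q‖ ≤ 1 * (1 / 2 : ℝ≥0) :=
      (ContinuousLinearMap.opNorm_comp_le _ _).trans
        (mul_le_mul (ContinuousLinearMap.norm_inl_le_one ℝ X Y) h1 (norm_nonneg _) zero_le_one)
    refine h2.trans_lt ?_
    norm_num
  have hsymm : ContDiff ℝ 1 e.symm := by
    refine e.contDiff_symm (f₀' := fun q => ContinuousLinearEquiv.unitsEquiv ℝ (X × Y)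
      (Units.oneSub (N' q) (hN' q))) (fun q => ?_) hAC
    have hd : HasFDerivAt N (fderiv ℝ N q) q := (hN.differentiable one_ne_zero q).hasFDerivAt
    have : HasFDerivAt A ((ContinuousLinearMap.fst ℝ X Y - fderiv ℝ N q).prod
      (ContinuousLinearMap.snd ℝ X Y)) q := (hasFDerivAt_fst.sub hd).prodMk hasFDerivAt_snd
    have e1 : ((ContinuousLinearEquiv.unitsEquiv ℝ (X × Y) (Units.oneSub (N' q) (hN' q)) :
        (X × Y) ≃L[ℝ] X × Y) : X × Y →L[ℝ] X × Y) = 1 - N' q := rfl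
    have e2 : (1 : X × Y →L[ℝ] X × Y) - N' q = (ContinuousLinearMap.fst ℝ X Y - fderiv ℝ N q).prod
        (ContinuousLinearMap.snd ℝ X Y) := by
      refine ContinuousLinearMap.ext fun v => ?_
      refine Prod.ext ?_ ?_ <;> simp [N']
    rw [e1, e2]
    exact this
  refine ⟨fun q => (e.symm q).1, hsymm.fst, fun q z => ⟨fun h => ?_, fun h => ?_⟩⟩
  · have : e (z, q.2) = q := by
      rw [hea]; exact Prod.ext h rfl
    have h2 : e.symm q = (z, q.2) := by rw [← this, e.symm_apply_apply, this]
    exact (congrArg Prod.fst h2).symm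
  · have h1 : e (e.symm q) = q := e.apply_symm_apply q
    rw [hea] at h1
    have h2 : (e.symm q).2 = q.2 := (congrArg Prod.snd h1 :)
    have h3 : (e.symm q).1 - N (e.symm q) = q.1 := (congrArg Prod.fst h1 :)
    have h4 : e.symm q = (z, q.2) := Prod.ext h.symm h2
    rw [← h3, h4]

/-- On short windows, the integral equation `ξ(t) = x + ∫_c^t g(ξ, w)` has a unique solution,
which is a `C¹` function of the initial value and of the control in `L²`. -/
theorem exists_contDiff_solution_integralEquation [FiniteDimensional ℝ E] [FiniteDimensional ℝ P]
    {g : E × P → E} (hg : ContDiff ℝ 2 g) (hcs : HasCompactSupport g) :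
    ∃ δ > 0, ∀ a b c : ℝ, b - a ≤ δ →
      ∃ Φ : E × Lp P 2 (volume : Measure ℝ) → (ℝ →ᵇ E), ContDiff ℝ 1 Φ ∧
        ∀ (x : E) (w : Lp P 2 (volume : Measure ℝ)) (ξ : ℝ →ᵇ E),
          (∀ t, ξ t = x + ∫ s in c..t, g (ξ s, w s) ∂(volume.restrict (Icc a b)))
            ↔ ξ = Φ (x, w) := by
  obtain ⟨C, hC⟩ := hcs.exists_bound_of_continuous hg.continuous
  have hd1 : ContDiff ℝ 1 (fderiv ℝ g) := hg.fderiv_right (by norm_num)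
  obtain ⟨C', hC'⟩ := (hcs.fderiv ℝ).exists_bound_of_continuous hd1.continuous
  obtain ⟨K, hK⟩ := hg.lipschitzWith_of_hasCompactSupport hcs (by norm_num)
  obtain ⟨K', hK'⟩ := hd1.lipschitzWith_of_hasCompactSupport (hcs.fderiv ℝ) (by norm_num)
  have hKpos : (0 : ℝ) < K + 1 := by positivity
  -- Length at most 1 bounds `pairL2` by 2. The second bound gives √length ≤ 1 / (4 (K + 1)), so
  -- that the Lipschitz constant K · 2 · √length is at most 1/2.
  refine ⟨min 1 ((1 / (4 * (K + 1))) ^ 2), by positivity, fun a b c hab => ?_⟩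
  have hab1 := hab.trans (min_le_left _ _)
  have hab2 := hab.trans (min_le_right _ _)
  set μ := (volume : Measure ℝ).restrict (Icc a b) with hμ
  -- The integral equation reads ξ - N(ξ, w) = x. Integrating against the restricted measure keeps
  -- curves bounded on all of ℝ, so one Banach space serves for every window.
  set N : (ℝ →ᵇ E) × Lp P 2 (volume : Measure ℝ) → (ℝ →ᵇ E) := fun q =>
    primitive μ c (nemytskii μ 1 hg.continuous hC (pairL2 a b q)) with hN
  have hNapp : ∀ q t, N q t = ∫ s in c..t, g (q.1 s, q.2 s) ∂μ := by
    intro q t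
    rw [hN]
    simp only [primitive_apply]
    refine intervalIntegral.integral_congr_ae_restrict (ae_restrict_of_ae ?_)
    filter_upwards [coeFn_nemytskii 1 hg.continuous hC (pairL2 a b q), coeFn_pairL2 a b q]
      with s h1 h2
    rw [h1, h2]
  have hNC : ContDiff ℝ 1 N := (primitive μ c).contDiff.comp
    ((contDiff_nemytskii hg hC hC' hK').comp (pairL2 a b).contDiff)
  have hsq : √(μ.real univ) ≤ 1 / (4 * (K + 1)) := by
    rw [← Real.sqrt_sq (by positivity : (0 : ℝ) ≤ 1 / (4 * (K + 1)))]
    refine Real.sqrt_le_sqrt ?_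
    rw [hμ, measureReal_restrict_apply_univ, Measure.real, Real.volume_Icc]
    exact ENNReal.toReal_le_of_le_ofReal (by positivity) (ENNReal.ofReal_le_ofReal hab2)
  have hNL : LipschitzWith (1 / 2) N := by
    refine LipschitzWith.of_dist_le_mul fun q q' => ?_
    rw [dist_eq_norm, dist_eq_norm, hN]
    simp only
    rw [← map_sub]
    refine (norm_primitive_apply_le _ _ _).trans ?_
    refine (lipschitzWith_nemytskii_one hg.continuous hC hK _ _).trans ?_
    rw [← map_sub]
    calc (K : ℝ) * (‖pairL2 a b (q - q')‖ * √(μ.real univ))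
        ≤ K * ((2 * ‖q - q'‖) * (1 / (4 * (K + 1)))) := by
          gcongr
          exact norm_pairL2_le hab1 _
      _ = (K / (K + 1)) * (1 / 2 * ‖q - q'‖) := by field_simp; ring
      _ ≤ 1 * (1 / 2 * ‖q - q'‖) := by
          gcongr
          rw [div_le_one hKpos]
          linarith
      _ = _ := by simp
  obtain ⟨S, hSC, hS⟩ := exists_contDiff_inverse_shear hNC hNL
  refine ⟨fun y => S (constBCF y.1, y.2), hSC.comp
    (((constBCF (E := E)).contDiff.comp contDiff_fst).prodMk contDiff_snd), fun x w ξ => ?_⟩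
  rw [← hS (constBCF x, w) ξ, sub_eq_iff_eq_add, BoundedContinuousFunction.ext_iff]
  refine forall_congr' fun t => ?_
  rw [BoundedContinuousFunction.add_apply, constBCF_apply, hNapp]

end IntegralEquation

/-! ### Absolutely continuous curves -/

section AbsoluteContinuity

variable {X Y : Type*} [PseudoMetricSpace X] [PseudoMetricSpace Y]

theorem disjoint_uIoc_comp_monotone {φ : ℝ → ℝ} (hφ : Monotone φ) {x y x' y' : ℝ}
    (h : Disjoint (uIoc x y) (uIoc x' y')) : Disjoint (uIoc (φ x) (φ y)) (uIoc (φ x') (φ y')) := by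
  rw [uIoc, uIoc, Ioc_disjoint_Ioc] at h ⊢
  simp only [← hφ.map_max, ← hφ.map_min]
  exact hφ h

theorem _root_.AbsolutelyContinuousOnInterval.comp_monotone {f : ℝ → X} {a b a' b' : ℝ}
    (hf : AbsolutelyContinuousOnInterval f a b) {φ : ℝ → ℝ} (hφ : Monotone φ) {K : ℝ≥0}
    (hK : LipschitzWith K φ) (hm : MapsTo φ (uIcc a' b') (uIcc a b)) :
    AbsolutelyContinuousOnInterval (fun t => f (φ t)) a' b' := by
  rw [absolutelyContinuousOnInterval_iff] at hf ⊢
  intro ε hε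
  obtain ⟨δ, hδ, H⟩ := hf ε hε
  refine ⟨δ / (K + 1), by positivity, fun J hJ hJl => ?_⟩
  refine H (J.1, fun i => (φ (J.2 i).1, φ (J.2 i).2)) ⟨fun i hi => ?_, fun i hi j hj hij => ?_⟩ ?_
  · exact ⟨hm (hJ.1 i hi).1, hm (hJ.1 i hi).2⟩
  · exact disjoint_uIoc_comp_monotone hφ (hJ.2 hi hj hij)
  · calc ∑ i ∈ Finset.range J.1, dist (φ (J.2 i).1) (φ (J.2 i).2)
        ≤ ∑ i ∈ Finset.range J.1, (K + 1) * dist (J.2 i).1 (J.2 i).2 := by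
          refine Finset.sum_le_sum fun i _ => (hK.dist_le_mul _ _).trans ?_
          gcongr
          linarith
      _ = (K + 1) * ∑ i ∈ Finset.range J.1, dist (J.2 i).1 (J.2 i).2 := by
          rw [Finset.mul_sum]
      _ < (K + 1) * (δ / (K + 1)) := by gcongr
      _ = δ := by field_simp

theorem _root_.AbsolutelyContinuousOnInterval.of_dist_le {f : ℝ → X} {g : ℝ → ℝ → ℝ} {a b : ℝ}
    (hg : Tendsto (fun J : ℕ × (ℕ → ℝ × ℝ) => ∑ i ∈ Finset.range J.1, g (J.2 i).1 (J.2 i).2)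
      (AbsolutelyContinuousOnInterval.totalLengthFilter ⊓
        𝓟 (AbsolutelyContinuousOnInterval.disjWithin a b)) (𝓝 0))
    (h : ∀ x ∈ uIcc a b, ∀ y ∈ uIcc a b, dist (f x) (f y) ≤ g x y) :
    AbsolutelyContinuousOnInterval f a b := by
  refine squeeze_zero' (Eventually.of_forall fun J => Finset.sum_nonneg fun i _ => dist_nonneg)
    ?_ hg
  rw [eventually_inf_principal]
  refine Eventually.of_forall fun J hJ => Finset.sum_le_sum fun i hi => ?_
  exact h _ (hJ.1 i hi).1 _ (hJ.1 i hi).2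

theorem _root_.AbsolutelyContinuousOnInterval.congr {f g : ℝ → X} {a b : ℝ}
    (hf : AbsolutelyContinuousOnInterval f a b) (h : EqOn f g (uIcc a b)) :
    AbsolutelyContinuousOnInterval g a b :=
  .of_dist_le (g := fun x y => dist (f x) (f y)) hf fun x hx y hy => by rw [h hx, h hy]

/-- Clamping time at b from above and from below gives two curves that are absolutely continuous on
the whole interval, and the increments of `f` are at most the sum of theirs. -/
theorem _root_.AbsolutelyContinuousOnInterval.union {f : ℝ → X} {a b c : ℝ}
    (h1 : AbsolutelyContinuousOnInterval f a b) (h2 : AbsolutelyContinuousOnInterval f b c)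
    (hab : a ≤ b) (hbc : b ≤ c) : AbsolutelyContinuousOnInterval f a c := by
  have k1 : AbsolutelyContinuousOnInterval (fun t => f (min t b)) a c :=
    h1.comp_monotone (fun x y h => min_le_min_right b h) (LipschitzWith.id.min_const b) (by
      intro t ht
      rw [uIcc_of_le (hab.trans hbc)] at ht
      rw [uIcc_of_le hab]
      exact ⟨le_min ht.1 hab, min_le_right _ _⟩)
  have k2 : AbsolutelyContinuousOnInterval (fun t => f (max t b)) a c :=
    h2.comp_monotone (fun x y h => max_le_max_right b h) (LipschitzWith.id.max_const b) (by
      intro t ht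
      rw [uIcc_of_le (hab.trans hbc)] at ht
      rw [uIcc_of_le hbc]
      exact ⟨le_max_right _ _, max_le ht.2 hbc⟩)
  have k3 := Tendsto.add k1 k2
  simp only [← Finset.sum_add_distrib, add_zero] at k3
  refine .of_dist_le (g := fun x y => dist (f (min x b)) (f (min y b))
    + dist (f (max x b)) (f (max y b))) k3 fun x _ y _ => ?_
  rcases le_total x b with hx | hx <;> rcases le_total y b with hy | hy <;>
    simp only [min_eq_left, min_eq_right, max_eq_left, max_eq_right, hx, hy, dist_self, add_zero,
      zero_add, le_refl]
  · exact dist_triangle _ _ _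
  · rw [add_comm]
    exact dist_triangle _ _ _

theorem _root_.LipschitzOnWith.comp_absolutelyContinuousOnInterval {f : ℝ → X} {h : X → Y} {K : ℝ≥0}
    {a b : ℝ} {s : Set X} (hh : LipschitzOnWith K h s) (hf : AbsolutelyContinuousOnInterval f a b)
    (hs : MapsTo f (uIcc a b) s) : AbsolutelyContinuousOnInterval (fun t => h (f t)) a b := by
  have k := Tendsto.const_mul (K : ℝ) hf
  simp only [Finset.mul_sum, mul_zero] at k
  exact .of_dist_le (g := fun x y => K * dist (f x) (f y)) k fun x hx y hy => hh.dist_le_mul _ (hs hx) _ (hs hy)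

theorem _root_.AbsolutelyContinuousOnInterval.prodMk {f : ℝ → X} {g : ℝ → Y} {a b : ℝ}
    (hf : AbsolutelyContinuousOnInterval f a b) (hg : AbsolutelyContinuousOnInterval g a b) :
    AbsolutelyContinuousOnInterval (fun t => (f t, g t)) a b := by
  have k3 := Tendsto.add hf hg
  simp only [← Finset.sum_add_distrib, add_zero] at k3
  exact .of_dist_le (g := fun x y => dist (f x) (f y) + dist (g x) (g y)) k3 fun x _ y _ => max_le_add_of_nonneg dist_nonneg dist_nonneg

variable {F : Type*} [NormedAddCommGroup F] [NormedSpace ℝ F]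

theorem lipschitzOnWith_integral_of_bounded {v : ℝ → F} {a b C : ℝ}
    (hv : IntervalIntegrable v volume a b) (hab : a ≤ b) (hC : ∀ t ∈ Icc a b, ‖v t‖ ≤ C) :
    LipschitzOnWith C.toNNReal (fun t => ∫ s in a..t, v s) (Icc a b) := by
  refine LipschitzOnWith.of_dist_le_mul fun x hx y hy => ?_
  have ix : IntervalIntegrable v volume a x :=
    hv.mono_set (uIcc_subset_uIcc left_mem_uIcc (by rwa [uIcc_of_le hab]))
  have iy : IntervalIntegrable v volume a y :=
    hv.mono_set (uIcc_subset_uIcc left_mem_uIcc (by rwa [uIcc_of_le hab]))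
  rw [dist_eq_norm, intervalIntegral.integral_interval_sub_left ix iy, Real.dist_eq]
  refine intervalIntegral.norm_integral_le_of_norm_le_const fun s hs => (hC s ?_).trans
    (Real.le_coe_toNNReal C)
  have := uIoc_subset_uIcc hs
  exact (uIcc_subset_Icc hy hx) this

/-- The fundamental theorem of calculus for an absolutely continuous curve with bounded
derivative. -/
theorem _root_.AbsolutelyContinuousOnInterval.eq_add_integral [CompleteSpace F] {f v : ℝ → F}
    {a b C : ℝ} (hf : AbsolutelyContinuousOnInterval f a b) (hab : a ≤ b)
    (hv : IntervalIntegrable v volume a b) (hC : ∀ t ∈ Icc a b, ‖v t‖ ≤ C)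
    (hd : ∀ᵐ t ∂(volume.restrict (Icc a b)), HasDerivAt f (v t) t) :
    ∀ t ∈ Icc a b, f t = f a + ∫ s in a..t, v s := by
  have h1 : AbsolutelyContinuousOnInterval (fun t => ∫ s in a..t, v s) a b := by
    refine LipschitzOnWith.absolutelyContinuousOnInterval (K := C.toNNReal) ?_
    rw [uIcc_of_le hab]
    exact lipschitzOnWith_integral_of_bounded hv hab hC
  have hd' := (ae_restrict_iff' measurableSet_Icc).1 hd
  -- The difference of `f` and the primitive of `v` is absolutely continuous with derivative zero
  -- almost everywhere, hence constant.
  obtain ⟨c, hc⟩ := (hf.sub h1).const_of_ae_hasDerivAt_zero (by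
    filter_upwards [hd', hv.ae_hasDerivAt_integral] with t h2 h3 ht
    have := (h2 (by rwa [uIcc_of_le hab] at ht)).sub (h3 ht a left_mem_uIcc)
    rwa [sub_self] at this)
  intro t ht
  have e1 := hc t (by rwa [uIcc_of_le hab])
  have e2 := hc a left_mem_uIcc
  simp only [Pi.sub_apply, intervalIntegral.integral_same, sub_zero] at e1 e2
  rw [e2, ← e1]
  abel

end AbsoluteContinuity

/-! ### Curves on a manifold with almost everywhere prescribed velocity -/

section Solutions

variable {E : Type*} [NormedAddCommGroup E] [NormedSpace ℝ E]
  {H : Type*} [TopologicalSpace H] {I : ModelWithCorners ℝ E H}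
  {N : Type*} [TopologicalSpace N] [ChartedSpace H N]

variable (I) in
/-- The curve `γ` is absolutely continuous on `[a, b]` and has velocity `v` almost everywhere
there. -/
def HasVelocityOn (a b : ℝ) (γ : ℝ → N) (v : (t : ℝ) → TangentSpace I (γ t)) : Prop :=
  (ContinuousOn γ (Icc a b) ∧ ∀ (p : N) (c d : ℝ), a ≤ c → c ≤ d → d ≤ b →
      MapsTo γ (Icc c d) (extChartAt I p).source →
        AbsolutelyContinuousOnInterval (fun t => extChartAt I p (γ t)) c d) ∧
    ∀ᵐ t ∂(volume.restrict (Icc a b)),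
      HasMFDerivAt 𝓘(ℝ, ℝ) I γ t ((1 : ℝ →L[ℝ] ℝ).smulRight (v t))

theorem isTrajectory_iff_hasVelocityOn {U : Type*} {F : (x : N) → U → TangentSpace I x} {T : ℝ}
    {u : ℝ → U} {γ : ℝ → N} :
    IsTrajectory I F T u γ ↔ HasVelocityOn I 0 T γ (fun t => F (γ t) (u t)) := Iff.rfl

namespace HasVelocityOn

variable {a b c : ℝ} {γ γ' : ℝ → N} {v v' : ℝ → E}

theorem mono (h : HasVelocityOn I a b γ v) {a' b' : ℝ} (ha : a ≤ a') (hb : b' ≤ b) :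
    HasVelocityOn I a' b' γ v :=
  ⟨⟨h.1.1.mono (Icc_subset_Icc ha hb), fun p c d h1 h2 h3 => h.1.2 p c d (ha.trans h1) h2
    (h3.trans hb)⟩, ae_restrict_of_ae_restrict_of_subset (Icc_subset_Icc ha hb) h.2⟩

theorem congr_velocity (h : HasVelocityOn I a b γ v)
    (hv : ∀ᵐ t ∂(volume.restrict (Icc a b)), v t = v' t) : HasVelocityOn I a b γ v' := by
  refine ⟨h.1, ?_⟩
  filter_upwards [h.2, hv] with t h1 h2
  have : (v t : TangentSpace I (γ t)) = v' t := h2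
  rw [← this]
  exact h1

/-- The derivative is two-sided while the curves agree only on the closed interval, so the two
endpoints are discarded as a null set. -/
theorem congr_curve (h : HasVelocityOn I a b γ v) (hγ : EqOn γ γ' (Icc a b)) :
    HasVelocityOn I a b γ' v := by
  refine ⟨⟨h.1.1.congr hγ.symm, fun p c d h1 h2 h3 hm => ?_⟩, ?_⟩
  · have hs : Icc c d ⊆ Icc a b := Icc_subset_Icc h1 h3
    refine (h.1.2 p c d h1 h2 h3 (fun t ht => ?_)).congr fun t ht => ?_
    · rw [hγ (hs ht)]; exact hm ht
    · rw [uIcc_of_le h2] at ht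
      simp only [hγ (hs ht)]
  · have h1 := (ae_restrict_iff' measurableSet_Icc).1 h.2
    refine (ae_restrict_iff' measurableSet_Icc).2 ?_
    have ha : ∀ᵐ t : ℝ, t ≠ a := by simp [ae_iff, measure_singleton]
    have hb : ∀ᵐ t : ℝ, t ≠ b := by simp [ae_iff, measure_singleton]
    filter_upwards [h1, ha, hb] with t h1 h2 h3 ht
    have hn : Icc a b ∈ 𝓝 t := Icc_mem_nhds (lt_of_le_of_ne ht.1 h2.symm) (lt_of_le_of_ne ht.2 h3)
    have he : γ' =ᶠ[𝓝 t] γ := by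
      filter_upwards [hn] with s hs using (hγ hs).symm
    exact (h1 ht).congr_of_eventuallyEq he

theorem union (h1 : HasVelocityOn I a b γ v) (h2 : HasVelocityOn I b c γ v) (hab : a ≤ b)
    (hbc : b ≤ c) : HasVelocityOn I a c γ v := by
  have hu : Icc a b ∪ Icc b c = Icc a c := Icc_union_Icc_eq_Icc hab hbc
  refine ⟨⟨?_, fun p c' d h3 h4 h5 hm => ?_⟩, ?_⟩
  · rw [← hu]
    exact h1.1.1.union_of_isClosed h2.1.1 isClosed_Icc isClosed_Icc
  · rcases le_total d b with hd | hd
    · exact h1.1.2 p c' d h3 h4 hd hm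
    rcases le_total b c' with hc | hc
    · exact h2.1.2 p c' d hc h4 h5 hm
    · exact (h1.1.2 p c' b h3 hc le_rfl (hm.mono_left (Icc_subset_Icc_right hd))).union
        (h2.1.2 p b d le_rfl hd h5 (hm.mono_left (Icc_subset_Icc_left hc))) hc hd
  · rw [← hu]
    exact (ae_restrict_union_iff _ _ _).2 ⟨h1.2, h2.2⟩

theorem glue (h1 : HasVelocityOn I a b γ v) (h2 : HasVelocityOn I b c γ' v') (hab : a ≤ b)
    (hbc : b ≤ c) (hγ : γ b = γ' b) :
    HasVelocityOn I a c (fun t => if t ≤ b then γ t else γ' t)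
      (fun t => if t ≤ b then v t else v' t : ℝ → E) := by
  have hb : ∀ᵐ t : ℝ, t ≠ b := by simp [ae_iff, measure_singleton]
  have k1 : HasVelocityOn I a b (fun t => if t ≤ b then γ t else γ' t)
      (fun t => if t ≤ b then v t else v' t : ℝ → E) := by
    have h3 : HasVelocityOn I a b γ (fun t => if t ≤ b then v t else v' t : ℝ → E) :=
      h1.congr_velocity (by
        refine (ae_restrict_iff' measurableSet_Icc).2 (Eventually.of_forall fun t ht => ?_)
        simp [ht.2])
    exact h3.congr_curve fun t ht => by simp [ht.2]
  have k2 : HasVelocityOn I b c (fun t => if t ≤ b then γ t else γ' t)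
      (fun t => if t ≤ b then v t else v' t : ℝ → E) := by
    have h3 : HasVelocityOn I b c γ' (fun t => if t ≤ b then v t else v' t : ℝ → E) :=
      h2.congr_velocity (by
        refine (ae_restrict_iff' measurableSet_Icc).2 ?_
        filter_upwards [hb] with t ht ht'
        have : ¬ t ≤ b := not_le.2 (lt_of_le_of_ne ht'.1 ht.symm)
        simp [this])
    refine h3.congr_curve fun t ht => ?_
    rcases ht.1.eq_or_lt with rfl | h
    · simp [hγ]
    · simp [not_le.2 h]
  exact k1.union k2 hab hbc

/-- An increasing affine change of time is Lipschitz and pulls null sets back to null sets; the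
chain rule contributes the factor α. -/
theorem comp_affine (h : HasVelocityOn I a b γ v) {α β : ℝ} (hα : 0 < α) {a' b' : ℝ}
    (ha : a ≤ α * a' + β) (hb : α * b' + β ≤ b) :
    HasVelocityOn I a' b' (fun t => γ (α * t + β)) (fun t => α • v (α * t + β) : ℝ → E) := by
  have hmono : Monotone fun t : ℝ => α * t + β := fun x y hxy => by
    dsimp only
    gcongr
  have hmaps : ∀ c d, MapsTo (fun t : ℝ => α * t + β) (Icc c d) (Icc (α * c + β) (α * d + β)) :=
    fun c d t ht => ⟨hmono ht.1, hmono ht.2⟩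
  have hsub : Icc (α * a' + β) (α * b' + β) ⊆ Icc a b := Icc_subset_Icc ha hb
  have hLip : LipschitzWith α.toNNReal fun t : ℝ => α * t + β := by
    refine LipschitzWith.of_dist_le_mul fun x y => ?_
    rw [Real.dist_eq, Real.dist_eq, Real.coe_toNNReal _ hα.le, add_sub_add_right_eq_sub, ← mul_sub,
      abs_mul, abs_of_pos hα]
  refine ⟨⟨?_, fun p c d h3 h4 h5 hm => ?_⟩, ?_⟩
  · exact h.1.1.comp (by fun_prop) fun t ht => hsub (hmaps _ _ ht)
  · refine (h.1.2 p (α * c + β) (α * d + β) (ha.trans (hmono h3)) (hmono h4)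
      ((hmono h5).trans hb) ?_).comp_monotone hmono hLip ?_
    · intro s hs
      have : s = α * ((s - β) / α) + β := by field_simp; ring
      rw [this]
      refine hm ⟨?_, ?_⟩
      · rw [le_div_iff₀ hα]; linarith [hs.1]
      · rw [div_le_iff₀ hα]; linarith [hs.2]
    · rw [uIcc_of_le h4, uIcc_of_le (hmono h4)]
      exact hmaps c d
  · have hq : Measure.QuasiMeasurePreserving (fun t : ℝ => α * t + β) volume volume := by
      have e : (fun t : ℝ => α * t + β) = (fun t => t + β) ∘ fun t => α * t := rfl
      rw [e]
      refine (measurePreserving_add_right volume β).quasiMeasurePreserving.comp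
        ⟨measurable_const_mul α, ?_⟩
      rw [Real.map_volume_mul_left hα.ne']
      exact Measure.smul_absolutelyContinuous
    have h1 := hq.ae ((ae_restrict_iff' measurableSet_Icc).1 h.2)
    refine (ae_restrict_iff' measurableSet_Icc).2 ?_
    filter_upwards [h1] with t h1 ht
    have h2 := h1 (hsub (hmaps _ _ ht))
    have h3 : HasMFDerivAt 𝓘(ℝ, ℝ) 𝓘(ℝ, ℝ) (fun t : ℝ => α * t + β) t
        ((1 : ℝ →L[ℝ] ℝ).smulRight α) :=
      (((hasDerivAt_id t).const_mul α).add_const β).hasFDerivAt.hasMFDerivAt.congr_mfderiv (by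
        ext; simp; exact (one_mul α).symm)
    refine (h2.comp t h3).congr_mfderiv ?_
    ext
    change (((1 : ℝ) • α) • v (α * t + β) : E) = (1 : ℝ) • (α • v (α * t + β) : E)
    simp

end HasVelocityOn

end Solutions

section Windows

variable {F : Type*} [NormedAddCommGroup F] [NormedSpace ℝ F]

theorem integral_restrict_Icc {a b c t : ℝ} (hc : c ∈ Icc a b) (ht : t ∈ Icc a b) (h : ℝ → F) :
    ∫ s in c..t, h s ∂(volume.restrict (Icc a b)) = ∫ s in c..t, h s := by
  have h1 : ∀ {x y : ℝ}, x ∈ Icc a b → y ∈ Icc a b → Ioc x y ∩ Icc a b = Ioc x y :=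
    fun hx hy => inter_eq_left.2 fun s hs => ⟨hx.1.trans hs.1.le, hs.2.trans hy.2⟩
  rw [intervalIntegral, intervalIntegral, Measure.restrict_restrict measurableSet_Ioc,
    Measure.restrict_restrict measurableSet_Ioc, h1 hc ht, h1 ht hc]

end Windows

/-! ### Coordinate form of a control system -/

section Charts

variable {E : Type*} [NormedAddCommGroup E] [NormedSpace ℝ E]
  {P : Type*} [NormedAddCommGroup P] [NormedSpace ℝ P]
  {M : Type*} [TopologicalSpace M] [ChartedSpace E M]

/-- The control system `g : M × P → TM` is smooth. -/
def IsSmoothControlled [IsManifold 𝓘(ℝ, E) ∞ M] (g : (x : M) → P → TangentSpace 𝓘(ℝ, E) x) :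
    Prop :=
  ContMDiff (𝓘(ℝ, E).prod 𝓘(ℝ, P)) 𝓘(ℝ, E).tangent ∞
    (fun q : M × P => (⟨q.1, g q.1 q.2⟩ : TangentBundle 𝓘(ℝ, E) M))

/-- The coordinate representation of a control system in the chart at `p`. -/
def localRep (g : (x : M) → P → TangentSpace 𝓘(ℝ, E) x) (p : M) (q : E × P) : E :=
  mfderiv 𝓘(ℝ, E) 𝓘(ℝ, E) (extChartAt 𝓘(ℝ, E) p) ((extChartAt 𝓘(ℝ, E) p).symm q.1)
    (g ((extChartAt 𝓘(ℝ, E) p).symm q.1) q.2)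

theorem localRep_extChartAt (g : (x : M) → P → TangentSpace 𝓘(ℝ, E) x) (p : M) {y : M}
    (hy : y ∈ (extChartAt 𝓘(ℝ, E) p).source) (w : P) :
    localRep g p (extChartAt 𝓘(ℝ, E) p y, w)
      = mfderiv 𝓘(ℝ, E) 𝓘(ℝ, E) (extChartAt 𝓘(ℝ, E) p) y (g y w) := by
  -- The tangent space depends on the point, so `left_inv` cannot be rewritten in place; the point
  -- is generalised first.
  have key : ∀ y', y' = y → (mfderiv 𝓘(ℝ, E) 𝓘(ℝ, E) (extChartAt 𝓘(ℝ, E) p) y' (g y' w) : E)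
      = mfderiv 𝓘(ℝ, E) 𝓘(ℝ, E) (extChartAt 𝓘(ℝ, E) p) y (g y w) := by
    rintro _ rfl
    rfl
  exact key _ ((extChartAt 𝓘(ℝ, E) p).left_inv hy)

/-- `γ` solves `γ' = g(γ, w)` on `[a, b]`. -/
def IsSolution (g : (x : M) → P → TangentSpace 𝓘(ℝ, E) x) (w : ℝ → P) (a b : ℝ) (γ : ℝ → M) :
    Prop :=
  HasVelocityOn 𝓘(ℝ, E) a b γ (fun t => g (γ t) (w t))

theorem IsSolution.congr_control {g : (x : M) → P → TangentSpace 𝓘(ℝ, E) x} {w w' : ℝ → P}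
    {a b : ℝ} {γ : ℝ → M} (h : IsSolution g w a b γ)
    (hw : ∀ᵐ t ∂(volume.restrict (Icc a b)), w t = w' t) : IsSolution g w' a b γ :=
  HasVelocityOn.congr_velocity h (by filter_upwards [hw] with t ht; rw [ht])

variable [IsManifold 𝓘(ℝ, E) ∞ M]

/-- Over the chart domain, the differential of the chart at p is the trivialization of the tangent
bundle at p, so `localRep` is the fibre component of a smooth map into the bundle. -/
theorem contDiffOn_localRep {g : (x : M) → P → TangentSpace 𝓘(ℝ, E) x} (hg : IsSmoothControlled g)
    (p : M) : ContDiffOn ℝ ∞ (localRep g p) ((extChartAt 𝓘(ℝ, E) p).target ×ˢ univ) := by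
  have : IsManifold 𝓘(ℝ, E) 1 M := IsManifold.of_le (n := ∞) (by norm_num)
  have htgt : (extChartAt 𝓘(ℝ, E) p).target ∈ 𝓝ˢ (extChartAt 𝓘(ℝ, E) p).target :=
    (isOpen_extChartAt_target p).mem_nhdsSet_self
  rintro ⟨z, w⟩ ⟨hz, -⟩
  refine ContDiffAt.contDiffWithinAt ?_
  rw [← contMDiffAt_iff_contDiffAt]
  set e := trivializationAt E (TangentSpace 𝓘(ℝ, E)) p with he
  have hsymm : ContMDiffAt 𝓘(ℝ, E × P) (𝓘(ℝ, E).prod 𝓘(ℝ, P)) ∞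
      (fun q : E × P => ((extChartAt 𝓘(ℝ, E) p).symm q.1, q.2)) (z, w) := by
    have h1 : ContMDiffAt 𝓘(ℝ, E) 𝓘(ℝ, E) ∞ (extChartAt 𝓘(ℝ, E) p).symm z :=
      (contMDiffOn_extChartAt_symm p).contMDiffAt ((isOpen_extChartAt_target p).mem_nhds hz)
    have h2 : ContMDiffAt 𝓘(ℝ, E × P) 𝓘(ℝ, E) ∞ (Prod.fst : E × P → E) (z, w) :=
      contMDiffAt_iff_contDiffAt.2 contDiffAt_fst
    have h3 : ContMDiffAt 𝓘(ℝ, E × P) 𝓘(ℝ, P) ∞ (Prod.snd : E × P → P) (z, w) :=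
      contMDiffAt_iff_contDiffAt.2 contDiffAt_snd
    exact (ContMDiffAt.comp (z, w) (g := (extChartAt 𝓘(ℝ, E) p).symm) h1 h2).prodMk h3
  have hcomp := ContMDiffAt.comp (z, w) (hg.contMDiffAt
    (x := ((extChartAt 𝓘(ℝ, E) p).symm z, w))) hsymm
  have hbase : ∀ y ∈ (extChartAt 𝓘(ℝ, E) p).target,
      (extChartAt 𝓘(ℝ, E) p).symm y ∈ e.baseSet := by
    intro y hy
    rw [he, TangentBundle.trivializationAt_baseSet, ← extChartAt_source 𝓘(ℝ, E)]
    exact (extChartAt 𝓘(ℝ, E) p).map_target hy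
  have hmem : (⟨(extChartAt 𝓘(ℝ, E) p).symm z, g _ w⟩ : TangentBundle 𝓘(ℝ, E) M) ∈ e.source :=
    e.mem_source.2 (hbase z hz)
  have h2 := ((e.contMDiffAt_iff (IB := 𝓘(ℝ, E)) (IM := 𝓘(ℝ, E × P)) (n := ∞) (x₀ := (z, w))
    (f := fun q : E × P => (⟨(extChartAt 𝓘(ℝ, E) p).symm q.1, g _ q.2⟩ : TangentBundle 𝓘(ℝ, E) M))
    hmem).1 hcomp).2
  refine h2.congr_of_eventuallyEq ?_
  have hnh : (extChartAt 𝓘(ℝ, E) p).target ×ˢ (univ : Set P) ∈ 𝓝 (z, w) :=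
    prod_mem_nhds ((isOpen_extChartAt_target p).mem_nhds hz) univ_mem
  filter_upwards [hnh] with q hq
  have hb := hbase q.1 hq.1
  have h3 : (extChartAt 𝓘(ℝ, E) p).symm q.1 ∈ (chartAt E p).source := by
    rw [← extChartAt_source 𝓘(ℝ, E)]
    exact (extChartAt 𝓘(ℝ, E) p).map_target hq.1
  have k1 := DFunLike.congr_fun
    (TangentBundle.continuousLinearMapAt_trivializationAt (I := 𝓘(ℝ, E)) h3).symm
    (g ((extChartAt 𝓘(ℝ, E) p).symm q.1) q.2)
  exact k1.trans (congrFun ((Bundle.Trivialization.continuousLinearMapAt_apply ℝ e _).trans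
    (Bundle.Trivialization.coe_linearMapAt_of_mem e hb)) _)

/-- A compactly supported smooth extension of the coordinate representation of a control system. -/
theorem exists_compactlySupported_localRep [FiniteDimensional ℝ E] [FiniteDimensional ℝ P]
    {g : (x : M) → P → TangentSpace 𝓘(ℝ, E) x}
    (hg : IsSmoothControlled g) {R : ℝ} (hR : ∀ x w, R ≤ ‖w‖ → g x w = 0) (p : M) :
    ∃ ρ > 0, Metric.closedBall (extChartAt 𝓘(ℝ, E) p p) ρ ⊆ (extChartAt 𝓘(ℝ, E) p).target ∧
      ∃ h : E × P → E, ContDiff ℝ 2 h ∧ HasCompactSupport h ∧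
        ∀ z ∈ Metric.closedBall (extChartAt 𝓘(ℝ, E) p p) ρ, ∀ w, h (z, w) = localRep g p (z, w) := by
  obtain ⟨r, hr, hrs⟩ := Metric.isOpen_iff.1 (isOpen_extChartAt_target (I := 𝓘(ℝ, E)) p) _
    (mem_extChartAt_target (I := 𝓘(ℝ, E)) p)
  set z0 := extChartAt 𝓘(ℝ, E) p p with hz0
  -- The bump cuts off in the state variable only; compactness of the support in the control
  -- variable comes from `hR`.
  let B : ContDiffBump z0 := ⟨r / 4, r / 2, by positivity, by linarith⟩
  have hsub : Metric.closedBall z0 (r / 2) ⊆ (extChartAt 𝓘(ℝ, E) p).target :=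
    (Metric.closedBall_subset_ball (by linarith)).trans hrs
  refine ⟨r / 4, by positivity, (Metric.closedBall_subset_closedBall (by linarith)).trans hsub,
    fun q => B q.1 • localRep g p q, ?_, ?_, fun z hz w => ?_⟩
  · rw [contDiff_iff_contDiffAt]
    rintro ⟨z, w⟩
    by_cases hz : z ∈ tsupport B
    · have hz' : z ∈ (extChartAt 𝓘(ℝ, E) p).target := by
        rw [B.tsupport_eq] at hz
        exact hsub hz
      refine (B.contDiff.comp contDiff_fst).contDiffAt.smul ?_
      exact ((contDiffOn_localRep hg p).contDiffAt (prod_mem_nhds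
        ((isOpen_extChartAt_target p).mem_nhds hz') univ_mem)).of_le (mod_cast le_top)
    · have h0 : (fun q : E × P => B q.1 • localRep g p q) =ᶠ[𝓝 (z, w)] fun _ => 0 := by
        have : (tsupport B)ᶜ ×ˢ (univ : Set P) ∈ 𝓝 (z, w) :=
          prod_mem_nhds ((isClosed_tsupport _).isOpen_compl.mem_nhds hz) univ_mem
        filter_upwards [this] with q hq
        rw [image_eq_zero_of_notMem_tsupport hq.1, zero_smul]
      exact contDiffAt_const.congr_of_eventuallyEq h0
  · refine HasCompactSupport.intro (K := Metric.closedBall z0 (r / 2) ×ˢ Metric.closedBall 0 R)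
      ((isCompact_closedBall _ _).prod (isCompact_closedBall _ _)) fun q hq => ?_
    rw [mem_prod, not_and_or] at hq
    rcases hq with hq | hq
    · have : q.1 ∉ tsupport B := by
        rw [B.tsupport_eq]
        exact hq
      rw [image_eq_zero_of_notMem_tsupport this, zero_smul]
    · rw [Metric.mem_closedBall, dist_zero_right, not_le] at hq
      have : localRep g p q = 0 := by
        rw [localRep, hR _ _ hq.le]
        exact map_zero _
      rw [this, smul_zero]
  · simp only
    rw [B.one_of_mem_closedBall hz, one_smul]

section

variable [FiniteDimensional ℝ E] {g : (x : M) → P → TangentSpace 𝓘(ℝ, E) x} {p : M}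
  {a b c : ℝ} {h : E × P → E} {w : ℝ → P}

/-- The integrand is bounded, so ξ is Lipschitz on the window, and coordinate changes are Lipschitz
on its compact image: this gives absolute continuity in every chart. Lebesgue differentiation gives
the velocity in the chart at p, and the differential of the inverse chart carries it to `g`. -/
theorem isSolution_of_integralEquation {S : Set E} (hS : S ⊆ (extChartAt 𝓘(ℝ, E) p).target)
    (hh : ∀ z ∈ S, ∀ w, h (z, w) = localRep g p (z, w)) {C : ℝ} (hC : ∀ q, ‖h q‖ ≤ C)
    (hcont : Continuous h) (hw : AEStronglyMeasurable w volume) (hc : c ∈ Icc a b)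
    {ξ : ℝ →ᵇ E} {x : E}
    (hξ : ∀ t, ξ t = x + ∫ s in c..t, h (ξ s, w s) ∂(volume.restrict (Icc a b)))
    (hξS : ∀ t ∈ Icc a b, ξ t ∈ S) :
    IsSolution g w a b (fun t => (extChartAt 𝓘(ℝ, E) p).symm (ξ t)) := by
  have : IsManifold 𝓘(ℝ, E) 1 M := IsManifold.of_le (n := ∞) (by norm_num)
  have : CompleteSpace E := FiniteDimensional.complete ℝ E
  set ψ := extChartAt 𝓘(ℝ, E) p with hψ
  have hm : AEStronglyMeasurable (fun s => h (ξ s, w s)) volume :=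
    hcont.comp_aestronglyMeasurable (ξ.continuous.aestronglyMeasurable.prodMk hw)
  have hi : ∀ u v, IntervalIntegrable (fun s => h (ξ s, w s)) volume u v := fun u v =>
    (intervalIntegrable_const (c := C)).mono_fun hm.restrict (Eventually.of_forall fun s =>
      (hC _).trans (Real.le_norm_self _))
  have hξ' : ∀ t ∈ Icc a b, ξ t = x + ∫ s in c..t, h (ξ s, w s) := fun t ht => by
    rw [hξ t, integral_restrict_Icc hc ht]
  have hLip : LipschitzOnWith C.toNNReal ξ (Icc a b) := by
    refine LipschitzOnWith.of_dist_le_mul fun s hs t ht => ?_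
    rw [hξ' s hs, hξ' t ht, dist_add_left, dist_eq_norm,
      intervalIntegral.integral_interval_sub_left (hi _ _) (hi _ _), Real.dist_eq]
    exact intervalIntegral.norm_integral_le_of_norm_le_const fun s hs => (hC _).trans
      (Real.le_coe_toNNReal C)
  refine ⟨⟨?_, fun p' c' d' h1 h2 h3 hmaps => ?_⟩, ?_⟩
  · exact (continuousOn_extChartAt_symm p).comp ξ.continuous.continuousOn fun t ht => hS (hξS t ht)
  · have hsub : Icc c' d' ⊆ Icc a b := Icc_subset_Icc h1 h3
    have hAC : AbsolutelyContinuousOnInterval ξ c' d' := by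
      refine LipschitzOnWith.absolutelyContinuousOnInterval (K := C.toNNReal) ?_
      rw [uIcc_of_le h2]
      exact hLip.mono hsub
    have hK : IsCompact (ξ '' Icc c' d') := isCompact_Icc.image ξ.continuous
    have hloc : LocallyLipschitzOn (ξ '' Icc c' d') (extChartAt 𝓘(ℝ, E) p' ∘ ψ.symm) := by
      rintro _ ⟨t, ht, rfl⟩
      have k1 : ContMDiffAt 𝓘(ℝ, E) 𝓘(ℝ, E) 1 ψ.symm (ξ t) :=
        (contMDiffOn_extChartAt_symm p).contMDiffAt
          ((isOpen_extChartAt_target p).mem_nhds (hS (hξS t (hsub ht))))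
      have k2 : ContMDiffAt 𝓘(ℝ, E) 𝓘(ℝ, E) 1 (extChartAt 𝓘(ℝ, E) p') (ψ.symm (ξ t)) :=
        contMDiffAt_extChartAt' (by
          rw [← extChartAt_source 𝓘(ℝ, E)]
          exact hmaps ht)
      obtain ⟨K, s, hs, hK⟩ := (contMDiffAt_iff_contDiffAt.1
        (k2.comp (ξ t) k1)).exists_lipschitzOnWith
      exact ⟨K, s, mem_nhdsWithin_of_mem_nhds hs, hK⟩
    obtain ⟨K, hK⟩ := hloc.exists_lipschitzOnWith_of_compact hK
    refine hK.comp_absolutelyContinuousOnInterval hAC ?_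
    rw [uIcc_of_le h2]
    exact mapsTo_image _ _
  · have ha : ∀ᵐ t : ℝ, t ≠ a := by simp [ae_iff, measure_singleton]
    have hb : ∀ᵐ t : ℝ, t ≠ b := by simp [ae_iff, measure_singleton]
    refine (ae_restrict_iff' measurableSet_Icc).2 ?_
    filter_upwards [(hi a b).ae_hasDerivAt_integral, ha, hb] with t k1 k2 k3 ht
    have hn : Icc a b ∈ 𝓝 t := Icc_mem_nhds (lt_of_le_of_ne ht.1 k2.symm) (lt_of_le_of_ne ht.2 k3)
    have k4 : HasDerivAt ξ (h (ξ t, w t)) t := by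
      refine ((k1 (Icc_subset_uIcc ht) c (Icc_subset_uIcc hc)).const_add x).congr_of_eventuallyEq ?_
      filter_upwards [hn] with s hs using hξ' s hs
    have htt := hS (hξS t ht)
    have k5 : HasMFDerivAt 𝓘(ℝ, E) 𝓘(ℝ, E) ψ.symm (ξ t)
        (mfderivWithin 𝓘(ℝ, E) 𝓘(ℝ, E) ψ.symm (range 𝓘(ℝ, E)) (ξ t)) := by
      have := (mdifferentiableWithinAt_extChartAt_symm (I := 𝓘(ℝ, E)) htt).hasMFDerivWithinAt
      rw [modelWithCornersSelf_coe, range_id, hasMFDerivWithinAt_univ] at this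
      rw [modelWithCornersSelf_coe, range_id]
      exact this
    have k6 := k5.comp t k4.hasFDerivAt.hasMFDerivAt
    refine k6.congr_mfderiv ?_
    have k7 := mfderivWithin_extChartAt_symm_comp_mfderiv_extChartAt (I := 𝓘(ℝ, E)) htt
    have k8 := DFunLike.congr_fun k7 (g (ψ.symm (ξ t)) (w t))
    ext
    change mfderivWithin 𝓘(ℝ, E) 𝓘(ℝ, E) ψ.symm (range 𝓘(ℝ, E)) (ξ t) ((1 : ℝ) • h (ξ t, w t))
      = (1 : ℝ) • g (ψ.symm (ξ t)) (w t)
    rw [one_smul, one_smul, hh _ (hξS t ht)]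
    exact k8

/-- In the chart the curve is absolutely continuous with bounded derivative, so the fundamental
theorem of calculus applies on the window. -/
theorem integralEquation_of_isSolution {S : Set E}
    (hh : ∀ z ∈ S, ∀ w, h (z, w) = localRep g p (z, w)) {C : ℝ} (hC : ∀ q, ‖h q‖ ≤ C)
    (hcont : Continuous h) (hw : AEStronglyMeasurable w volume) (hab : a ≤ b) (hc : c ∈ Icc a b)
    {γ : ℝ → M} (hγ : IsSolution g w a b γ)
    (hsrc : ∀ t ∈ Icc a b, γ t ∈ (extChartAt 𝓘(ℝ, E) p).source)
    (hγS : ∀ t ∈ Icc a b, extChartAt 𝓘(ℝ, E) p (γ t) ∈ S) :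
    ∃ ξ : ℝ →ᵇ E, (∀ t ∈ Icc a b, ξ t = extChartAt 𝓘(ℝ, E) p (γ t)) ∧
      ∀ t, ξ t = extChartAt 𝓘(ℝ, E) p (γ c)
        + ∫ s in c..t, h (ξ s, w s) ∂(volume.restrict (Icc a b)) := by
  have : IsManifold 𝓘(ℝ, E) 1 M := IsManifold.of_le (n := ∞) (by norm_num)
  have : CompleteSpace E := FiniteDimensional.complete ℝ E
  set ψ := extChartAt 𝓘(ℝ, E) p with hψ
  set μ := (volume : Measure ℝ).restrict (Icc a b) with hμ
  have hψγ : ContinuousOn (fun t => ψ (γ t)) (Icc a b) :=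
    (continuousOn_extChartAt p).comp hγ.1.1 hsrc
  have hm : AEStronglyMeasurable (fun s => h (ψ (γ s), w s)) μ :=
    hcont.comp_aestronglyMeasurable
      ((hψγ.aestronglyMeasurable measurableSet_Icc).prodMk hw.restrict)
  have hL : MemLp (fun s => h (ψ (γ s), w s)) 1 μ :=
    MemLp.of_bound hm C (Eventually.of_forall fun _ => hC _)
  have hint : IntervalIntegrable (fun s => h (ψ (γ s), w s)) volume a b := by
    rw [intervalIntegrable_iff_integrableOn_Icc_of_le hab]
    exact memLp_one_iff_integrable.1 hL
  have hd : ∀ᵐ t ∂μ, HasDerivAt (fun t => ψ (γ t)) (h (ψ (γ t), w t)) t := by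
    have h2 := (ae_restrict_iff' measurableSet_Icc).1 hγ.2
    refine (ae_restrict_iff' measurableSet_Icc).2 ?_
    filter_upwards [h2] with t k1 ht
    have k3 : MDifferentiableAt 𝓘(ℝ, E) 𝓘(ℝ, E) ψ (γ t) :=
      mdifferentiableAt_extChartAt (by
        rw [← extChartAt_source 𝓘(ℝ, E)]
        exact hsrc t ht)
    let A : E →L[ℝ] E := mfderiv 𝓘(ℝ, E) 𝓘(ℝ, E) ψ (γ t)
    let u : E := g (γ t) (w t)
    have k5 : HasFDerivAt (fun t => ψ (γ t)) (A ∘L (1 : ℝ →L[ℝ] ℝ).smulRight u) t :=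
      hasMFDerivAt_iff_hasFDerivAt.1 (k3.hasMFDerivAt.comp t (k1 ht))
    refine k5.hasDerivAt.congr_deriv ?_
    rw [hh _ (hγS t ht), localRep_extChartAt g p (hsrc t ht)]
    change A ((1 : ℝ) • u) = A u
    rw [one_smul]
  have hftc := (hγ.1.2 p a b le_rfl hab le_rfl hsrc).eq_add_integral hab hint
    (fun t _ => hC _) hd
  have hsubi : ∀ t ∈ Icc a b, IntervalIntegrable (fun s => h (ψ (γ s), w s)) volume a t :=
    fun t ht => hint.mono_set (uIcc_subset_uIcc left_mem_uIcc (Icc_subset_uIcc ht))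
  have hftc' : ∀ t ∈ Icc a b, ψ (γ t) = ψ (γ c) + ∫ s in c..t, h (ψ (γ s), w s) := by
    intro t ht
    rw [hftc t ht, hftc c hc,
      ← intervalIntegral.integral_interval_sub_left (hsubi t ht) (hsubi c hc)]
    abel
  -- Extends the coordinate curve to ℝ by its constant end values, since μ vanishes outside the
  -- window.
  set ξ : ℝ →ᵇ E := constBCF (ψ (γ c)) + primitive μ c hL.toLp with hξ
  have hξt : ∀ t, ξ t = ψ (γ c) + ∫ s in c..t, h (ψ (γ s), w s) ∂μ := by
    intro t
    rw [hξ, BoundedContinuousFunction.add_apply, constBCF_apply, primitive_apply]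
    congr 1
    exact intervalIntegral.integral_congr_ae_restrict (ae_restrict_of_ae hL.coeFn_toLp)
  have hξγ : ∀ t ∈ Icc a b, ξ t = ψ (γ t) := fun t ht => by
    rw [hξt, hftc' t ht, integral_restrict_Icc hc ht]
  refine ⟨ξ, hξγ, fun t => ?_⟩
  rw [hξt]
  congr 1
  refine intervalIntegral.integral_congr_ae_restrict (ae_restrict_of_ae ?_)
  refine (ae_restrict_iff' measurableSet_Icc).2 (Eventually.of_forall fun s hs => ?_)
  simp only [hξγ s hs]

end

end Charts

/-- The space of square integrable controls on the real line. -/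
abbrev ControlL2 (P : Type*) [NormedAddCommGroup P] : Type _ := Lp P 2 (volume : Measure ℝ)

/-! ### C¹ dependence of solutions on initial point and control -/

section FlowBox

variable {E : Type*} [NormedAddCommGroup E] [NormedSpace ℝ E] [FiniteDimensional ℝ E]
  {P : Type*} [NormedAddCommGroup P] [NormedSpace ℝ P] [FiniteDimensional ℝ P]
  {M : Type*} [TopologicalSpace M] [ChartedSpace E M] [IsManifold 𝓘(ℝ, E) ∞ M]
  {g : (x : M) → P → TangentSpace 𝓘(ℝ, E) x} {R : ℝ}

/-- Existence, uniqueness and `C¹` dependence for short times. -/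
theorem exists_flowBox (hg : IsSmoothControlled g) (hR : ∀ x w, R ≤ ‖w‖ → g x w = 0) (p : M) :
    ∃ U : Set M, IsOpen U ∧ p ∈ U ∧ ∃ δ > 0, ∀ a b : ℝ, a ≤ b → b - a ≤ δ →
      ∃ F G : M × ControlL2 P → M,
        (∀ x ∈ U, ∀ w : ControlL2 P, ContMDiffAt (𝓘(ℝ, E).prod 𝓘(ℝ, ControlL2 P)) 𝓘(ℝ, E) 1 F (x, w)) ∧
        (∀ x ∈ U, ∀ w : ControlL2 P, ContMDiffAt (𝓘(ℝ, E).prod 𝓘(ℝ, ControlL2 P)) 𝓘(ℝ, E) 1 G (x, w)) ∧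
        (∀ x ∈ U, ∀ w : ControlL2 P, (∃ γ, IsSolution g w a b γ ∧ γ a = x ∧ γ b = F (x, w)) ∧
          G (F (x, w), w) = x) ∧
        ∀ (w : ControlL2 P) γ, IsSolution g w a b γ → (∀ t ∈ Icc a b, γ t ∈ U) →
          F (γ a, w) = γ b := by
  have : CompleteSpace E := FiniteDimensional.complete ℝ E
  obtain ⟨ρ, hρ, hball, h, hh, hcs, hloc⟩ := exists_compactlySupported_localRep hg hR p
  obtain ⟨C, hC⟩ := hcs.exists_bound_of_continuous hh.continuous
  have hC0 : 0 ≤ C := (norm_nonneg _).trans (hC 0)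
  obtain ⟨δ₁, hδ₁, hint⟩ := exists_contDiff_solution_integralEquation hh hcs
  set ψ := extChartAt 𝓘(ℝ, E) p with hψ
  have hbU : Metric.ball (ψ p) (ρ / 2) ⊆ Metric.closedBall (ψ p) ρ :=
    Metric.ball_subset_closedBall.trans (Metric.closedBall_subset_closedBall (by linarith))
  -- The speed is at most C, so within time ρ / (2 (C + 1)) a curve starting in the ball of radius
  -- ρ/2 stays in the ball of radius ρ, where `h` is the true coordinate field.
  refine ⟨ψ.source ∩ ψ ⁻¹' Metric.ball (ψ p) (ρ / 2),
    (continuousOn_extChartAt p).isOpen_inter_preimage (isOpen_extChartAt_source p) Metric.isOpen_ball,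
    ⟨mem_extChartAt_source p, Metric.mem_ball_self (by positivity)⟩,
    min δ₁ (ρ / (2 * (C + 1))), by positivity, fun a b hab hδ => ?_⟩
  have haI : a ∈ Icc a b := left_mem_Icc.2 hab
  have hbI : b ∈ Icc a b := right_mem_Icc.2 hab
  -- `Φa` prescribes the value at time a and yields the forward map F; `Φb` prescribes it at time b
  -- and yields the backward map G.
  obtain ⟨Φa, hΦa, ha⟩ := hint a b a (hδ.trans (min_le_left _ _))
  obtain ⟨Φb, hΦb, hb⟩ := hint a b b (hδ.trans (min_le_left _ _))
  have hstay : ∀ {c : ℝ} {x : E} {w : ℝ → P} {ξ : ℝ →ᵇ E}, c ∈ Icc a b →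
      x ∈ Metric.ball (ψ p) (ρ / 2) →
      (∀ t, ξ t = x + ∫ s in c..t, h (ξ s, w s) ∂(volume.restrict (Icc a b))) →
      ∀ t ∈ Icc a b, ξ t ∈ Metric.closedBall (ψ p) ρ := by
    intro c x w ξ hc hx hξ t ht
    have k1 : ‖∫ s in c..t, h (ξ s, w s)‖ ≤ C * |t - c| :=
      intervalIntegral.norm_integral_le_of_norm_le_const fun s _ => hC _
    have k2 : |t - c| ≤ ρ / (2 * (C + 1)) := by
      refine le_trans ?_ (hδ.trans (min_le_right _ _))
      rw [abs_le]
      constructor <;> linarith [ht.1, ht.2, hc.1, hc.2]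
    have k3 : C * |t - c| ≤ ρ / 2 := by
      calc C * |t - c| ≤ (C + 1) * (ρ / (2 * (C + 1))) := by gcongr; linarith
        _ = ρ / 2 := by field_simp
    rw [Metric.mem_closedBall, hξ t, integral_restrict_Icc hc ht, dist_eq_norm, add_sub_right_comm]
    rw [Metric.mem_ball, dist_eq_norm] at hx
    refine (norm_add_le _ _).trans ?_
    linarith
  have smooth : ∀ (Φ : E × ControlL2 P → ℝ →ᵇ E) (c d : ℝ), ContDiff ℝ 1 Φ → c ∈ Icc a b →
      d ∈ Icc a b →
      (∀ (x : E) (w : ControlL2 P) (ξ : ℝ →ᵇ E),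
        (∀ t, ξ t = x + ∫ s in c..t, h (ξ s, w s) ∂(volume.restrict (Icc a b))) ↔ ξ = Φ (x, w)) →
      ∀ x ∈ ψ.source ∩ ψ ⁻¹' Metric.ball (ψ p) (ρ / 2), ∀ w,
        ContMDiffAt (𝓘(ℝ, E).prod 𝓘(ℝ, ControlL2 P)) 𝓘(ℝ, E) 1
          (fun q : M × ControlL2 P => ψ.symm (Φ (ψ q.1, q.2) d)) (x, w) := by
    intro Φ c d hΦ hc hd hcd x hx w
    have k1 : ContMDiffAt (𝓘(ℝ, E).prod 𝓘(ℝ, ControlL2 P)) 𝓘(ℝ, E × ControlL2 P) 1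
        (fun q : M × ControlL2 P => (ψ q.1, q.2)) (x, w) := by
      refine ContMDiffAt.prodMk_space ?_ contMDiffAt_snd
      have k0 : ContMDiffAt 𝓘(ℝ, E) 𝓘(ℝ, E) 1 ψ x := contMDiffAt_extChartAt' (by
        rw [← extChartAt_source 𝓘(ℝ, E)]; exact hx.1)
      exact ContMDiffAt.comp (x, w) (g := ψ) k0 contMDiffAt_fst
    have k2 : ContDiff ℝ 1 fun y : E × ControlL2 P => Φ y d :=
      (BoundedContinuousFunction.evalCLM ℝ d : (ℝ →ᵇ E) →L[ℝ] E).contDiff.comp hΦ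
    have k3 : Φ (ψ x, w) d ∈ ψ.target :=
      hball (hstay hc hx.2 ((hcd _ _ _).2 rfl) d hd)
    have k4 : ContMDiffAt 𝓘(ℝ, E) 𝓘(ℝ, E) 1 ψ.symm (Φ (ψ x, w) d) :=
      (contMDiffOn_extChartAt_symm p).contMDiffAt ((isOpen_extChartAt_target p).mem_nhds k3)
    have k5 := ContMDiffAt.comp (x, w) (g := fun y : E × ControlL2 P => Φ y d)
      k2.contMDiff.contMDiffAt k1
    exact ContMDiffAt.comp (x, w) (g := ψ.symm) k4 k5
  refine ⟨fun q => ψ.symm (Φa (ψ q.1, q.2) b), fun q => ψ.symm (Φb (ψ q.1, q.2) a),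
    smooth Φa a b hΦa haI hbI ha, smooth Φb b a hΦb hbI haI hb, fun x hx w => ?_,
    fun w γ hγ hγU => ?_⟩
  · have hξ := (ha (ψ x) w _).2 rfl
    have hξS := hstay haI hx.2 hξ
    have hξa : Φa (ψ x, w) a = ψ x := by rw [hξ a]; simp
    refine ⟨⟨fun t => ψ.symm (Φa (ψ x, w) t), isSolution_of_integralEquation hball hloc hC
      hh.continuous (Lp.aestronglyMeasurable w) haI hξ hξS, ?_, rfl⟩, ?_⟩
    · simp only [hξa]
      exact ψ.left_inv hx.1
    · simp only
      rw [ψ.right_inv (hball (hξS b hbI))]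
      -- The forward solution also satisfies the integral equation based at b, so uniqueness there
      -- shows that G undoes F.
      have : Φa (ψ x, w) = Φb (Φa (ψ x, w) b, w) := by
        refine (hb _ _ _).1 fun t => ?_
        have hii : ∀ u v, IntervalIntegrable (fun s => h (Φa (ψ x, w) s, w s))
            (volume.restrict (Icc a b)) u v := fun u v =>
          (intervalIntegrable_const (c := C)).mono_fun
            (hh.continuous.comp_aestronglyMeasurable
              ((Φa (ψ x, w)).continuous.aestronglyMeasurable.prodMk
                (Lp.aestronglyMeasurable w).restrict)).restrict
            (Eventually.of_forall fun s => (hC _).trans (Real.le_norm_self _))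
        rw [hξ t, hξ b, ← intervalIntegral.integral_add_adjacent_intervals (hii a b) (hii b t),
          add_assoc]
      rw [← this, hξa]
      exact ψ.left_inv hx.1
  · obtain ⟨ξ, h1, h2⟩ := integralEquation_of_isSolution (h := h) hloc hC hh.continuous
      (Lp.aestronglyMeasurable w) hab haI hγ (fun t ht => (hγU t ht).1)
      (fun t ht => hbU (hγU t ht).2)
    have h3 := (ha _ _ _).1 h2
    simp only
    rw [← h3, h1 b hbI]
    exact ψ.left_inv (hγU b hbI).1

theorem IsSolution.mono {w : ℝ → P} {a b a' b' : ℝ} {γ : ℝ → M} (h : IsSolution g w a b γ)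
    (ha : a ≤ a') (hb : b' ≤ b) : IsSolution g w a' b' γ :=
  HasVelocityOn.mono h ha hb

theorem IsSolution.glue {w : ℝ → P} {a b c : ℝ} {γ γ' : ℝ → M} (h : IsSolution g w a b γ)
    (h' : IsSolution g w b c γ') (hab : a ≤ b) (hbc : b ≤ c) (hb : γ b = γ' b) :
    IsSolution g w a c (fun t => if t ≤ b then γ t else γ' t) := by
  have := HasVelocityOn.glue h h' hab hbc hb
  refine HasVelocityOn.congr_velocity this (Eventually.of_forall fun t => ?_)
  by_cases ht : t ≤ b
  · have e : (if t ≤ b then γ t else γ' t) = γ t := if_pos ht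
    exact (if_pos (α := E) ht).trans (congrArg (fun y => (g y (w t) : E)) e.symm)
  · have e : (if t ≤ b then γ t else γ' t) = γ' t := if_neg ht
    exact (if_neg (α := E) ht).trans (congrArg (fun y => (g y (w t) : E)) e.symm)

/-- Solutions are uniquely determined by their initial value and their control. -/
theorem IsSolution.eqOn [T2Space M] (hg : IsSmoothControlled g)
    (hR : ∀ x w, R ≤ ‖w‖ → g x w = 0) {w : ControlL2 P} {a b : ℝ} {γ γ' : ℝ → M}
    (h : IsSolution g w a b γ) (h' : IsSolution g w a b γ') (ha : γ a = γ' a) :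
    EqOn γ γ' (Icc a b) := by
  rcases lt_or_ge b a with hba | hab
  · rw [Icc_eq_empty (not_le.2 hba)]
    exact eqOn_empty _ _
  have hcl : IsClosed ({t | γ t = γ' t} ∩ Icc a b) := by
    have h1 : ContinuousOn (fun t => (γ t, γ' t)) (Icc a b) := h.1.1.prodMk h'.1.1
    have h2 := h1.preimage_isClosed_of_isClosed isClosed_Icc isClosed_diagonal
    rw [inter_comm]
    exact h2
  -- Continuity induction: the set of agreement is closed because M is Hausdorff, and a flow box at
  -- a common point extends agreement to the right.
  refine fun t ht => hcl.Icc_subset_of_forall_mem_nhdsWithin (a := a) (b := b) ha ?_ ht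
  rintro t ⟨het, ht⟩
  obtain ⟨U, hUo, hpU, δ, hδ, H⟩ := exists_flowBox hg hR (γ t)
  have htI : t ∈ Icc a b := Ico_subset_Icc_self ht
  have n1 : ∀ᶠ s in 𝓝[Icc a b] t, γ s ∈ U := (h.1.1 t htI).eventually (hUo.mem_nhds hpU)
  have n2 : ∀ᶠ s in 𝓝[Icc a b] t, γ' s ∈ U := by
    refine (h'.1.1 t htI).eventually (hUo.mem_nhds ?_)
    have het' : γ t = γ' t := het
    rw [← het']
    exact hpU
  obtain ⟨ε, hε, hs⟩ := Metric.mem_nhdsWithin_iff.1 (n1.and n2)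
  set η := min (min (ε / 2) δ) (b - t) with hη
  have hηpos : 0 < η := lt_min (lt_min (by positivity) hδ) (sub_pos.2 ht.2)
  have hηb : t + η ≤ b := by linarith [min_le_right (min (ε / 2) δ) (b - t)]
  have hηδ : η ≤ δ := (min_le_left _ _).trans (min_le_right _ _)
  have hηε : η ≤ ε / 2 := (min_le_left _ _).trans (min_le_left _ _)
  have hIoc : Ioc t (t + η) ∈ 𝓝[>] t := Ioc_mem_nhdsGT (by linarith)
  filter_upwards [hIoc] with s hsI
  have hUs : ∀ r ∈ Icc t s, γ r ∈ U ∧ γ' r ∈ U := fun r hr => hs ⟨by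
    rw [Metric.mem_ball, Real.dist_eq, abs_of_nonneg (by linarith [hr.1])]
    linarith [hr.2, hsI.2], ⟨by linarith [hr.1, ht.1], by linarith [hr.2, hsI.2]⟩⟩
  obtain ⟨F, G, -, -, -, hF⟩ := H t s hsI.1.le (by linarith [hsI.2])
  have e1 := hF w γ (h.mono ht.1 (by linarith [hsI.2])) fun r hr => (hUs r hr).1
  have e2 := hF w γ' (h'.mono ht.1 (by linarith [hsI.2])) fun r hr => (hUs r hr).2
  have het' : γ t = γ' t := het
  change γ s = γ' s
  rw [← e1, ← e2, het']

/-- `F` is a `C¹` endpoint map of the solutions on `[a, b]` near the solution `γ` with control `w`,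
and `G` inverts it. -/
def IsFlowNear (g : (x : M) → P → TangentSpace 𝓘(ℝ, E) x) (a b : ℝ) (w : ControlL2 P) (x y : M)
    (F G : M × ControlL2 P → M) : Prop :=
  ContMDiffAt (𝓘(ℝ, E).prod 𝓘(ℝ, ControlL2 P)) 𝓘(ℝ, E) 1 F (x, w) ∧
  ContMDiffAt (𝓘(ℝ, E).prod 𝓘(ℝ, ControlL2 P)) 𝓘(ℝ, E) 1 G (y, w) ∧ F (x, w) = y ∧
  ∀ᶠ q in 𝓝 (x, w), (∃ γ, IsSolution g q.2 a b γ ∧ γ a = q.1 ∧ γ b = F q) ∧ G (F q, q.2) = q.1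

/-- The forward maps compose in order and the inverses in reverse order, the control being carried
along unchanged. The identity G'(z, w) = y places the base point of the composed inverse where G is
C¹. -/
theorem IsFlowNear.trans {a b c : ℝ} (hab : a ≤ b) (hbc : b ≤ c) {w : ControlL2 P} {x y z : M}
    {F G F' G' : M × ControlL2 P → M} (h : IsFlowNear g a b w x y F G)
    (h' : IsFlowNear g b c w y z F' G') :
    IsFlowNear g a c w x z (fun q => F' (F q, q.2)) (fun q => G (G' q, q.2)) := by
  obtain ⟨hF, hG, hFx, hev⟩ := h
  obtain ⟨hF', hG', hFx', hev'⟩ := h'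
  have hyw : G' (z, w) = y := by
    have := hev'.self_of_nhds.2
    simpa [hFx'] using this
  refine ⟨?_, ?_, ?_, ?_⟩
  · refine ContMDiffAt.comp (x, w) (g := F') (f := fun q : M × ControlL2 P => (F q, q.2)) ?_
      (hF.prodMk contMDiffAt_snd)
    simpa only [hFx] using hF'
  · refine ContMDiffAt.comp (z, w) (g := G) (f := fun q : M × ControlL2 P => (G' q, q.2)) ?_
      (hG'.prodMk contMDiffAt_snd)
    simpa only [hyw] using hG
  · simp only [hFx, hFx']
  · have hcont : Tendsto (fun q : M × ControlL2 P => (F q, q.2)) (𝓝 (x, w)) (𝓝 (y, w)) := by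
      have := (hF.continuousAt.prodMk (continuousAt_snd (X := M) (p := (x, w)))).tendsto
      simpa only [hFx] using this
    filter_upwards [hev, hcont.eventually hev'] with q h1 h2
    obtain ⟨⟨γ, k1, k2, k3⟩, k4⟩ := h1
    obtain ⟨⟨γ', l1, l2, l3⟩, l4⟩ := h2
    refine ⟨⟨fun t => if t ≤ b then γ t else γ' t, k1.glue l1 hab hbc (by rw [k3, l2]), ?_, ?_⟩, ?_⟩
    · simp [hab, k2]
    · rcases hbc.eq_or_lt with rfl | hlt
      · simp only [le_refl, if_true]
        rw [k3, ← l3, l2]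
      · simp [not_le.2 hlt, l3]
    · simp only [l4, k4]

/-- Along a given solution, the endpoint is locally a `C¹` function of the initial point and the
control, and the flow is locally invertible. -/
theorem IsSolution.exists_isFlowNear (hg : IsSmoothControlled g)
    (hR : ∀ x w, R ≤ ‖w‖ → g x w = 0) {w : ControlL2 P} {a b : ℝ} (hab : a ≤ b) {γ : ℝ → M}
    (h : IsSolution g w a b γ) : ∃ F G, IsFlowNear g a b w (γ a) (γ b) F G := by
  choose U hUo hpU δ hδ H using fun p : M => exists_flowBox hg hR p
  have hcont : Continuous fun t : Icc a b => γ t := continuousOn_iff_continuous_domRestrict.1 h.1.1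
  -- Each piece of the subdivision stays inside one flow box and is short enough for it; balls of
  -- radius δ/2 in time give pieces of length at most δ.
  obtain ⟨t, ht0, htm, ⟨m, hm⟩, ht⟩ := exists_monotone_Icc_subset_open_cover_Icc hab
    (c := fun s : Icc a b => (fun t : Icc a b => γ t) ⁻¹' U (γ s) ∩ Metric.ball s (δ (γ s) / 2))
    (fun s => ((hUo _).preimage hcont).inter Metric.isOpen_ball)
    (fun s _ => mem_iUnion.2 ⟨s, hpU _, Metric.mem_ball_self (half_pos (hδ _))⟩)
  have key : ∀ n, ∃ F G, IsFlowNear g a (t n) w (γ a) (γ (t n)) F G := by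
    intro n
    induction n with
    | zero =>
      rw [ht0]
      obtain ⟨F, G, hF, hG, hex, hun⟩ := H (γ a) a a le_rfl (by simpa using (hδ _).le)
      have e := hun w γ (h.mono le_rfl hab) (fun s hs => by
        rw [Icc_self, mem_singleton_iff] at hs
        rw [hs]; exact hpU _)
      refine ⟨F, G, hF _ (hpU _) _, hG _ (hpU _) _, e, ?_⟩
      have : U (γ a) ×ˢ (univ : Set (ControlL2 P)) ∈ 𝓝 (γ a, w) :=
        prod_mem_nhds ((hUo _).mem_nhds (hpU _)) univ_mem
      filter_upwards [this] with q hq using hex q.1 hq.1 q.2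
    | succ n ih =>
      obtain ⟨F, G, hFG⟩ := ih
      obtain ⟨s, hs⟩ := ht n
      have hle : (t n : ℝ) ≤ t (n + 1) := htm (Nat.le_succ n)
      have hlen : (t (n + 1) : ℝ) - t n ≤ δ (γ s) := by
        have l1 := (hs (left_mem_Icc.2 (htm (Nat.le_succ n)))).2
        have l2 := (hs (right_mem_Icc.2 (htm (Nat.le_succ n)))).2
        rw [Metric.mem_ball, Subtype.dist_eq, Real.dist_eq, abs_lt] at l1 l2
        linarith [l1.1, l2.2]
      have hin : ∀ r ∈ Icc (t n : ℝ) (t (n + 1)), γ r ∈ U (γ s) := fun r hr =>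
        (hs (show (⟨r, (t n).2.1.trans hr.1, hr.2.trans (t (n + 1)).2.2⟩ : Icc a b) ∈ _ from
          ⟨hr.1, hr.2⟩)).1
      obtain ⟨F', G', hF', hG', hex, hun⟩ := H (γ s) (t n) (t (n + 1)) hle hlen
      have e := hun w γ (h.mono (t n).2.1 (t (n + 1)).2.2) hin
      have hl := hin _ (left_mem_Icc.2 hle)
      have hFG' : IsFlowNear g (t n) (t (n + 1)) w (γ (t n)) (γ (t (n + 1))) F' G' := by
        refine ⟨hF' _ hl _, hG' _ (hin _ (right_mem_Icc.2 hle)) _, e, ?_⟩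
        have : U (γ s) ×ˢ (univ : Set (ControlL2 P)) ∈ 𝓝 (γ (t n), w) :=
          prod_mem_nhds ((hUo _).mem_nhds hl) univ_mem
        filter_upwards [this] with q hq using hex q.1 hq.1 q.2
      exact ⟨_, _, hFG.trans (t n).2.1 hle hFG'⟩
  have := key m
  rwa [hm m le_rfl] at this

end FlowBox

/-! ### A constant rank theorem relative to a convex set -/

section Rank

variable {V W E : Type*} [NormedAddCommGroup V] [NormedSpace ℝ V] [FiniteDimensional ℝ V]
  [NormedAddCommGroup W] [NormedSpace ℝ W] [CompleteSpace W]
  [NormedAddCommGroup E] [NormedSpace ℝ E] [FiniteDimensional ℝ E]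

theorem exists_leftInverse_of_injective (A : V →L[ℝ] E) (hA : Function.Injective A) :
    ∃ π : E →L[ℝ] V, π ∘L A = ContinuousLinearMap.id ℝ V := by
  obtain ⟨π, hπ⟩ := (A : V →ₗ[ℝ] E).exists_leftInverse_of_injective (LinearMap.ker_eq_bot.2 hA)
  refine ⟨LinearMap.toContinuousLinearMap π, ?_⟩
  ext v
  exact DFunLike.congr_fun hπ v

/-- `π` maps the range of `D` onto V, and the dimensions force this restriction to be bijective. -/
theorem eq_zero_of_mem_range_of_finrank_le {D : W →L[ℝ] E} {π : E →L[ℝ] V}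
    (hr : Module.finrank ℝ (LinearMap.range (D : W →ₗ[ℝ] E)) ≤ Module.finrank ℝ V)
    (hs : Function.Surjective fun x => π (D x)) {u : W} (hu : π (D u) = 0) : D u = 0 := by
  set f : LinearMap.range (D : W →ₗ[ℝ] E) →ₗ[ℝ] V :=
    (π : E →ₗ[ℝ] V).domRestrict (LinearMap.range (D : W →ₗ[ℝ] E)) with hf
  have hsurj : Function.Surjective f := fun v => by
    obtain ⟨x, hx⟩ := hs v
    exact ⟨⟨D x, ⟨x, rfl⟩⟩, hx⟩
  have hfr : Module.finrank ℝ (LinearMap.range (D : W →ₗ[ℝ] E)) = Module.finrank ℝ V :=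
    le_antisymm hr (LinearMap.finrank_le_finrank_of_surjective hsurj)
  have hinj : Function.Injective f :=
    (LinearMap.injective_iff_surjective_of_finrank_eq_finrank hfr).2 hsurj
  have h1 : f ⟨D u, ⟨u, rfl⟩⟩ = f 0 := by rw [map_zero]; exact hu
  exact congrArg Subtype.val (hinj h1)

/-- If the rank of a `C¹` map is at most `r` along a convex set, and `r` is attained on an
`r`-dimensional space of directions, then locally the image of the convex set has dimension at
most `r`. -/
theorem exists_dimH_image_le {F : W → E} {w₀ : W} {C : Set W} (hC : Convex ℝ C) (hw₀ : w₀ ∈ C)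
    (hF : ContDiffAt ℝ 1 F w₀) (L : V →L[ℝ] W)
    (hL : Function.Injective (fderiv ℝ F w₀ ∘L L))
    (hrank : ∀ᶠ q : W × V in 𝓝 (w₀, 0), q.1 ∈ C →
      Module.finrank ℝ (LinearMap.range (fderiv ℝ F (q.1 + L q.2) : W →ₗ[ℝ] E))
        ≤ Module.finrank ℝ V) :
    ∃ O ∈ 𝓝 w₀, dimH (F '' (O ∩ C)) ≤ Module.finrank ℝ V := by
  have : CompleteSpace V := FiniteDimensional.complete ℝ V
  have : CompleteSpace E := FiniteDimensional.complete ℝ E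
  obtain ⟨π, hπ⟩ := exists_leftInverse_of_injective _ hL
  set y₀ := π (F w₀) with hy₀
  set B : W →L[ℝ] V := π ∘L fderiv ℝ F w₀ with hB
  -- Since π ∘ dF ∘ L = id, the differential of Θ at (w₀, 0) is (h, v) ↦ (h, B h + v), which is
  -- invertible.
  set Θ : W × V → W × V := fun q => (q.1, π (F (q.1 + L q.2))) with hΘ
  have hadd : ContDiffAt ℝ 1 (fun q : W × V => q.1 + L q.2) (w₀, 0) :=
    (contDiff_fst.add (L.contDiff.comp contDiff_snd)).contDiffAt
  have hF' : ContDiffAt ℝ 1 F ((w₀, (0 : V)).1 + L (w₀, (0 : V)).2) := by simpa using hF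
  have hΘC : ContDiffAt ℝ 1 Θ (w₀, 0) :=
    contDiffAt_fst.prodMk (π.contDiff.contDiffAt.comp _ (hF'.comp (w₀, (0 : V)) hadd))
  let e : (W × V) ≃L[ℝ] W × V := ContinuousLinearEquiv.equivOfInverse
    ((ContinuousLinearMap.fst ℝ W V).prod (B ∘L ContinuousLinearMap.fst ℝ W V
      + ContinuousLinearMap.snd ℝ W V))
    ((ContinuousLinearMap.fst ℝ W V).prod (ContinuousLinearMap.snd ℝ W V
      - B ∘L ContinuousLinearMap.fst ℝ W V))
    (fun q => by simp) (fun q => by simp)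
  have hΘd : HasFDerivAt Θ (e : W × V →L[ℝ] W × V) (w₀, 0) := by
    have h1 : HasFDerivAt F (fderiv ℝ F w₀) ((w₀, (0 : V)).1 + L (w₀, (0 : V)).2) := by
      simpa using (hF.differentiableAt one_ne_zero).hasFDerivAt
    have h2 : HasFDerivAt (fun q : W × V => q.1 + L q.2)
        (ContinuousLinearMap.fst ℝ W V + L ∘L ContinuousLinearMap.snd ℝ W V) (w₀, 0) :=
      hasFDerivAt_fst.add (L.hasFDerivAt.comp _ hasFDerivAt_snd)
    have h3 : HasFDerivAt Θ _ (w₀, 0) :=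
      hasFDerivAt_fst.prodMk (π.hasFDerivAt.comp (w₀, (0 : V)) (h1.comp (w₀, (0 : V)) h2))
    refine h3.congr_fderiv ?_
    refine ContinuousLinearMap.ext fun q => ?_
    have h4 := DFunLike.congr_fun hπ q.2
    simp only [ContinuousLinearMap.comp_apply, ContinuousLinearMap.id_apply] at h4
    refine Prod.ext rfl ?_
    simp [e, B, h4]
  have hst := hΘC.hasStrictFDerivAt' hΘd one_ne_zero
  set J : W × V → W × V := hst.localInverse Θ e (w₀, 0) with hJ
  have hΘ₀ : Θ (w₀, 0) = (w₀, y₀) := by simp [hΘ, hy₀]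
  have hJC : ContDiffAt ℝ 1 J (w₀, y₀) := by
    rw [← hΘ₀]
    exact hΘC.to_localInverse hΘd one_ne_zero
  have hJ₀ : J (w₀, y₀) = (w₀, 0) := by
    rw [← hΘ₀]
    exact hst.localInverse_apply_image
  have hright : ∀ᶠ q in 𝓝 (w₀, y₀), Θ (J q) = q := by
    rw [← hΘ₀]
    exact hst.eventually_right_inverse
  have hleft : ∀ᶠ q in 𝓝 (w₀, (0 : V)), J (Θ q) = q := hst.eventually_left_inverse
  -- m(b, y) is the point of b + range L near w₀ at which π ∘ F takes the value y.
  set m : W × V → W := fun q => (J q).1 + L (J q).2 with hm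
  have hmC : ContDiffAt ℝ 1 m (w₀, y₀) := hJC.fst.add (L.contDiff.contDiffAt.comp _ hJC.snd)
  have hm₀ : m (w₀, y₀) = w₀ := by simp [hm, hJ₀]
  have hJ1 : ∀ᶠ q in 𝓝 (w₀, y₀), (J q).1 = q.1 := by
    filter_upwards [hright] with q hq using (congrArg Prod.fst hq :)
  have hπF : ∀ᶠ q in 𝓝 (w₀, y₀), π (F (m q)) = q.2 := by
    filter_upwards [hright] with q hq using (congrArg Prod.snd hq :)
  have hmT : Tendsto m (𝓝 (w₀, y₀)) (𝓝 w₀) := by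
    have := hmC.continuousAt.tendsto
    rwa [hm₀] at this
  have hJT : Tendsto J (𝓝 (w₀, y₀)) (𝓝 (w₀, 0)) := by
    have := hJC.continuousAt.tendsto
    rwa [hJ₀] at this
  have hdm : ∀ᶠ q in 𝓝 (w₀, y₀), DifferentiableAt ℝ m q := by
    filter_upwards [hmC.eventually (by simp)] with q hq using hq.differentiableAt one_ne_zero
  have hdF : ∀ᶠ q in 𝓝 (w₀, y₀), DifferentiableAt ℝ F (m q) := by
    filter_upwards [hmT.eventually (hF.eventually (by simp))] with q hq
      using hq.differentiableAt one_ne_zero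
  have hsurj : ∀ᶠ q in 𝓝 (w₀, y₀), Function.Surjective fun x => π (fderiv ℝ F (m q) x) := by
    have hc : ContinuousAt (fun w => π ∘L fderiv ℝ F w ∘L L) w₀ := by
      have h1 : ContinuousAt (fderiv ℝ F) w₀ :=
        (hF.fderiv_right (m := 0) (by simp)).continuousAt
      exact continuousAt_const.clm_comp (h1.clm_comp continuousAt_const)
    have h2 : ∀ᶠ w in 𝓝 w₀, IsUnit (π ∘L fderiv ℝ F w ∘L L) := by
      refine hc.eventually (Units.isOpen.mem_nhds ?_)
      change IsUnit (π ∘L fderiv ℝ F w₀ ∘L L)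
      rw [hπ]
      exact isUnit_one
    filter_upwards [hmT.eventually h2] with q hq v
    obtain ⟨u, hu⟩ := hq
    refine ⟨L (((u⁻¹ : (V →L[ℝ] V)ˣ) : V →L[ℝ] V) v), ?_⟩
    have h3 : (u : V →L[ℝ] V) (((u⁻¹ : (V →L[ℝ] V)ˣ) : V →L[ℝ] V) v) = v :=
      DFunLike.congr_fun (Units.mul_inv u) v
    rw [hu] at h3
    exact h3
  have hrk : ∀ᶠ q in 𝓝 (w₀, y₀), q.1 ∈ C →
      Module.finrank ℝ (LinearMap.range (fderiv ℝ F (m q) : W →ₗ[ℝ] E)) ≤ Module.finrank ℝ V := by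
    filter_upwards [hJT.eventually hrank, hJ1] with q h1 h2 h3
    exact h1 (by rwa [h2])
  have hslice : ∀ᶠ y in 𝓝 y₀, ContDiffAt ℝ 1 (fun y => F (m (w₀, y))) y := by
    have h1 : ContDiffAt ℝ 1 (fun y : V => m (w₀, y)) y₀ :=
      hmC.comp y₀ (contDiff_const.prodMk contDiff_id).contDiffAt
    have h2 : ContDiffAt ℝ 1 F (m (w₀, y₀)) := by rwa [hm₀]
    exact (h2.comp y₀ h1).eventually (by simp)
  have hall := hdm.and (hdF.and (hπF.eventually_nhds.and (hsurj.and hrk)))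
  obtain ⟨ε, hε, hball⟩ := Metric.eventually_nhds_iff_ball.1 hall
  obtain ⟨ε', hε', hball'⟩ := Metric.eventually_nhds_iff_ball.1 hslice
  set s := Metric.ball y₀ (min ε ε') with hs
  -- Move b along the segment from w₀, which stays in C by convexity. There π(F(m(b, y))) = y is
  -- constant, so the derivative of F(m(b, y)) lies in range dF and is killed by π; by the rank
  -- bound it is zero.
  have hconst : ∀ b ∈ Metric.ball w₀ ε ∩ C, ∀ y ∈ s, F (m (b, y)) = F (m (w₀, y)) := by
    rintro b ⟨hb, hbC⟩ y hy
    have hy' : dist y y₀ < ε := lt_of_lt_of_le hy (min_le_left _ _)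
    set β : ℝ → W := fun t => w₀ + t • (b - w₀) with hβ
    have hβm : ∀ t ∈ Icc (0 : ℝ) 1, (β t, y) ∈ Metric.ball (w₀, y₀) ε ∧ β t ∈ C := by
      intro t ht
      refine ⟨?_, ?_⟩
      · rw [Metric.mem_ball, Prod.dist_eq, max_lt_iff]
        refine ⟨?_, hy'⟩
        rw [hβ, dist_self_add_left, norm_smul, Real.norm_of_nonneg ht.1]
        rw [Metric.mem_ball, dist_eq_norm] at hb
        exact (mul_le_of_le_one_left (norm_nonneg _) ht.2).trans_lt hb
      · exact hC.add_smul_sub_mem hw₀ hbC ht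
    have hβd : ∀ t, HasDerivAt (fun t => (β t, y)) (b - w₀, (0 : V)) t := fun t => by
      have h1 : HasDerivAt β (b - w₀) t :=
        (((hasDerivAt_id t).smul_const (b - w₀)).const_add w₀).congr_deriv (by simp)
      exact h1.prodMk (hasDerivAt_const t y)
    have hder : ∀ t ∈ Icc (0 : ℝ) 1, HasDerivAt (fun t => F (m (β t, y))) 0 t := by
      intro t ht
      obtain ⟨k1, k2, k3, k4, k5⟩ := hball _ (hβm t ht).1
      have k6 := k2.hasFDerivAt.comp _ k1.hasFDerivAt
      have k7 : π (fderiv ℝ F (m (β t, y)) (fderiv ℝ m (β t, y) (b - w₀, 0))) = 0 := by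
        have l1 : HasFDerivAt (fun q => π (F (m q))) _ (β t, y) := π.hasFDerivAt.comp _ k6
        have l2 : HasFDerivAt (fun q => π (F (m q))) (ContinuousLinearMap.snd ℝ W V) (β t, y) :=
          hasFDerivAt_snd.congr_of_eventuallyEq k3
        have l3 := DFunLike.congr_fun (l1.unique l2) (b - w₀, (0 : V))
        exact l3
      have k8 := eq_zero_of_mem_range_of_finrank_le (k5 (hβm t ht).2) k4 k7
      have k9 := k6.comp_hasDerivAt t (hβd t)
      exact k9.congr_deriv k8
    have h0 := constant_of_has_deriv_right_zero (f := fun t => F (m (β t, y))) (a := 0) (b := 1)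
      (fun t ht => (hder t ht).continuousAt.continuousWithinAt)
      (fun t ht => (hder t (Ico_subset_Icc_self ht)).hasDerivWithinAt) 1 (by simp)
    simpa [hβ] using h0
  -- Every b near w₀ is the point with V-coordinate 0 of its own slice, so on C the value F(b)
  -- depends only on π(F(b)) and F factors through a C¹ map on an open subset of V.
  have hO : ∀ᶠ b in 𝓝 w₀, π (F b) ∈ s ∧ m (b, π (F b)) = b := by
    have h1 : ContinuousAt (fun b => π (F b)) w₀ := π.continuous.continuousAt.comp hF.continuousAt
    have h2 : Tendsto (fun b : W => (b, (0 : V))) (𝓝 w₀) (𝓝 (w₀, 0)) :=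
      (continuous_id.prodMk continuous_const).tendsto _
    filter_upwards [h1.eventually (Metric.ball_mem_nhds y₀ (lt_min hε hε')), h2.eventually hleft]
      with b h3 h4
    refine ⟨h3, ?_⟩
    have h5 : J (b, π (F b)) = (b, 0) := by simpa [hΘ] using h4
    simp [hm, h5]
  refine ⟨_, inter_mem (Metric.ball_mem_nhds w₀ hε) hO, ?_⟩
  refine le_trans (dimH_mono (t := (fun y => F (m (w₀, y))) '' s) ?_) ?_
  · rintro _ ⟨b, ⟨⟨hb1, hb2⟩, hbC⟩, rfl⟩
    refine ⟨π (F b), hb2.1, ?_⟩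
    simp only
    rw [← hconst b ⟨hb1, hbC⟩ _ hb2.1, hb2.2]
  · have hcd : ContDiffOn ℝ 1 (fun y => F (m (w₀, y))) s := fun y hy =>
      (hball' y (show dist y y₀ < ε' from lt_of_lt_of_le hy (min_le_right _ _))).contDiffWithinAt
    refine (hcd.dimH_image_le (convex_ball _ _) Subset.rfl).trans ?_
    refine (dimH_mono (subset_univ _)).trans ?_
    rw [Real.dimH_univ_eq_finrank]

end Rank

/-! ### Essentially bounded controls inside L² -/

section EssentialBounds

variable {P : Type*} [NormedAddCommGroup P] [NormedSpace ℝ P]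

/-- The control `w` is essentially bounded by `ρ`. -/
def EssBoundedBy (ρ : ℝ) (w : ControlL2 P) : Prop := ∀ᵐ t, ‖w t‖ ≤ ρ

namespace EssBoundedBy

variable {ρ ρ' : ℝ} {w w' : ControlL2 P}

theorem mono (h : EssBoundedBy ρ w) (hρ : ρ ≤ ρ') : EssBoundedBy ρ' w := by
  filter_upwards [h] with t ht using ht.trans hρ

theorem add (h : EssBoundedBy ρ w) (h' : EssBoundedBy ρ' w') :
    EssBoundedBy (ρ + ρ') (w + w') := by
  filter_upwards [h, h', Lp.coeFn_add w w'] with t h1 h2 h3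
  rw [h3]
  exact (norm_add_le _ _).trans (add_le_add h1 h2)

theorem smul (h : EssBoundedBy ρ w) (c : ℝ) : EssBoundedBy (|c| * ρ) (c • w) := by
  filter_upwards [h, Lp.coeFn_smul c w] with t h1 h2
  rw [h2, Pi.smul_apply, norm_smul, Real.norm_eq_abs]
  gcongr

theorem zero : EssBoundedBy 0 (0 : ControlL2 P) := by
  filter_upwards [Lp.coeFn_zero P 2 (volume : Measure ℝ)] with t ht
  rw [ht]
  simp

theorem sum {ι : Type*} (s : Finset ι) {c : ι → ℝ} {l : ι → ControlL2 P}
    (h : ∀ i ∈ s, EssBoundedBy (c i) (l i)) :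
    EssBoundedBy (∑ i ∈ s, c i) (∑ i ∈ s, l i) := by
  classical
  induction s using Finset.induction_on with
  | empty => simpa using zero
  | insert i s hi ih =>
    rw [Finset.sum_insert hi, Finset.sum_insert hi]
    exact (h i (by simp)).add (ih fun j hj => h j (by simp [hj]))

end EssBoundedBy

theorem convex_essBoundedBy (ρ : ℝ) : Convex ℝ {w : ControlL2 P | EssBoundedBy ρ w} := by
  intro w hw w' hw' a b ha hb hab
  have := (hw.smul a).add (hw'.smul b)
  rwa [abs_of_nonneg ha, abs_of_nonneg hb, ← add_mul, hab, one_mul] at this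

variable (P) in
/-- The essentially bounded controls. -/
def boundedControls : Submodule ℝ (ControlL2 P) where
  carrier := {w | ∃ ρ, EssBoundedBy ρ w}
  add_mem' := fun ⟨_, h⟩ ⟨_, h'⟩ => ⟨_, h.add h'⟩
  zero_mem' := ⟨0, EssBoundedBy.zero⟩
  smul_mem' := fun c _ ⟨_, h⟩ => ⟨_, h.smul c⟩

theorem dense_boundedControls : Dense (boundedControls P : Set (ControlL2 P)) := by
  refine (Lp.simpleFunc.dense (E := P) (μ := (volume : Measure ℝ)) (p := 2) (by simp)).mono ?_
  intro w hw
  let s : Lp.simpleFunc P 2 (volume : Measure ℝ) := ⟨w, hw⟩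
  obtain ⟨C, hC⟩ := (Lp.simpleFunc.toSimpleFunc s).exists_forall_norm_le
  refine ⟨C, ?_⟩
  filter_upwards [Lp.simpleFunc.toSimpleFunc_eq_toFun s] with t ht
  have : (w : ℝ → P) t = Lp.simpleFunc.toSimpleFunc s t := ht.symm
  rw [this]
  exact hC t

/-- The superposition of finitely many controls. -/
def superpose {ι : Type*} [Fintype ι] (l : ι → ControlL2 P) : (ι → ℝ) →L[ℝ] ControlL2 P :=
  ∑ j, (ContinuousLinearMap.proj j : (ι → ℝ) →L[ℝ] ℝ).smulRight (l j)

theorem superpose_apply {ι : Type*} [Fintype ι] (l : ι → ControlL2 P) (v : ι → ℝ) :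
    superpose l v = ∑ j, v j • l j := by
  simp [superpose]

theorem essBoundedBy_superpose {ι : Type*} [Fintype ι] {l : ι → ControlL2 P} {c : ι → ℝ}
    (h : ∀ j, EssBoundedBy (c j) (l j)) (v : ι → ℝ) :
    EssBoundedBy (∑ j, |v j| * c j) (superpose l v) := by
  rw [superpose_apply]
  exact EssBoundedBy.sum _ fun j _ => (h j).smul (v j)

/-- L² neighbourhoods contain unbounded controls. Small combinations of finitely many bounded
directions are small in L∞, so they do not activate a cutoff that leaves some margin. -/
theorem eventually_essBoundedBy_superpose {ι : Type*} [Fintype ι] {l : ι → ControlL2 P}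
    (h : ∀ j, l j ∈ boundedControls P) {ε : ℝ} (hε : 0 < ε) :
    ∀ᶠ v in 𝓝 (0 : ι → ℝ), EssBoundedBy ε (superpose l v) := by
  choose c hc using h
  have hcont : Continuous fun v : ι → ℝ => ∑ j, |v j| * c j := by fun_prop
  have h0 : (fun v : ι → ℝ => ∑ j, |v j| * c j) 0 < ε := by simpa using hε
  filter_upwards [hcont.continuousAt.eventually (gt_mem_nhds h0)] with v hv
  exact (essBoundedBy_superpose hc v).mono hv.le

/-- The rank of a continuous linear map of finite rank is attained on bounded controls. -/
theorem exists_bounded_linearIndependent {E : Type*} [NormedAddCommGroup E] [NormedSpace ℝ E]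
    [FiniteDimensional ℝ E] (D : ControlL2 P →L[ℝ] E) :
    ∃ l : Fin (Module.finrank ℝ (LinearMap.range (D : ControlL2 P →ₗ[ℝ] E))) → ControlL2 P,
      (∀ j, l j ∈ boundedControls P) ∧ Function.Injective (D ∘L superpose l) := by
  set D' : ControlL2 P →ₗ[ℝ] E := D.toLinearMap with hD'
  set S := (boundedControls P).map D' with hS
  -- The image of the dense subspace of bounded controls is finite-dimensional, hence closed, hence
  -- the whole range.
  have hrange : ∀ y ∈ LinearMap.range D', y ∈ S := by
    rintro _ ⟨w, rfl⟩
    have hcl : IsClosed (S : Set E) := S.closed_of_finiteDimensional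
    have := (dense_boundedControls (P := P)).closure_eq ▸ mem_univ w
    refine closure_minimal (s := D '' boundedControls P) (t := S) ?_ hcl
      (image_closure_subset_closure_image D.continuous (mem_image_of_mem D this))
    rintro _ ⟨v, hv, rfl⟩
    exact ⟨v, hv, rfl⟩
  let b := Module.finBasis ℝ (LinearMap.range D')
  choose l hl hlb using fun j => hrange (b j) (b j).2
  refine ⟨l, hl, (injective_iff_map_eq_zero _).2 fun v hv => ?_⟩
  have h1 : ∑ j, v j • b j = 0 := by
    refine Subtype.ext ?_
    rw [ContinuousLinearMap.comp_apply, superpose_apply, map_sum] at hv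
    simp only [map_smul] at hv
    rw [Submodule.coe_sum, Submodule.coe_zero, ← hv]
    refine Finset.sum_congr rfl fun j _ => ?_
    rw [Submodule.coe_smul, ← hlb]
    rfl
  exact funext fun j => Fintype.linearIndependent_iff.1 b.linearIndependent v h1 j

end EssentialBounds

/-! ### Restricting controls to a set of times -/

section Restriction

variable {P : Type*} [NormedAddCommGroup P] [NormedSpace ℝ P]

variable (P) in
/-- The control that agrees with `w` on `s` and vanishes elsewhere. -/
def restrictControl {s : Set ℝ} (hs : MeasurableSet s) : ControlL2 P →L[ℝ] ControlL2 P :=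
  LinearMap.mkContinuous
    { toFun := fun w => ((Lp.memLp w).indicator hs).toLp (s.indicator w)
      map_add' := fun w w' => by
        rw [← MemLp.toLp_add]
        refine MemLp.toLp_congr _ _ ?_
        filter_upwards [Lp.coeFn_add w w'] with t ht
        rw [← indicator_add']
        by_cases h : t ∈ s
        · rw [indicator_of_mem h, indicator_of_mem h, ht]
        · rw [indicator_of_notMem h, indicator_of_notMem h]
      map_smul' := fun c w => by
        rw [RingHom.id_apply, ← MemLp.toLp_const_smul]
        refine MemLp.toLp_congr _ _ ?_
        filter_upwards [Lp.coeFn_smul c w] with t ht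
        rw [Pi.smul_apply]
        by_cases h : t ∈ s
        · rw [indicator_of_mem h, indicator_of_mem h, ht, Pi.smul_apply]
        · rw [indicator_of_notMem h, indicator_of_notMem h, smul_zero] } 1 fun w => by
    rw [one_mul]
    simp only [LinearMap.coe_mk, AddHom.coe_mk]
    rw [Lp.norm_toLp, Lp.norm_def]
    exact ENNReal.toReal_mono (Lp.eLpNorm_ne_top w) (eLpNorm_indicator_le _)

theorem restrictControl_ae {s : Set ℝ} (hs : MeasurableSet s) (w : ControlL2 P) :
    restrictControl P hs w =ᵐ[volume] s.indicator w :=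
  ((Lp.memLp w).indicator hs).coeFn_toLp

theorem EssBoundedBy.restrictControl {ρ : ℝ} (hρ : 0 ≤ ρ) {w : ControlL2 P} (h : EssBoundedBy ρ w)
    {s : Set ℝ} (hs : MeasurableSet s) : EssBoundedBy ρ (restrictControl P hs w) := by
  filter_upwards [h, restrictControl_ae hs w] with t h1 h2
  rw [h2]
  by_cases ht : t ∈ s <;> simp [ht, h1, hρ]

theorem superpose_restrictControl {ι : Type*} [Fintype ι] (l : ι → ControlL2 P) {s : Set ℝ}
    (hs : MeasurableSet s) :
    superpose (fun j => restrictControl P hs (l j)) = restrictControl P hs ∘L superpose l := by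
  refine ContinuousLinearMap.ext fun v => ?_
  simp [superpose_apply, map_sum]

theorem EssBoundedBy.nonneg {ρ : ℝ} {w : ControlL2 P} (h : EssBoundedBy ρ w) : 0 ≤ ρ := by
  obtain ⟨t, ht⟩ := h.exists
  exact (norm_nonneg _).trans ht

/-- Needed to extract a countable subcover in the dimension count of `attainsRank_finrank`. -/
theorem secondCountableTopology_controlL2 [FiniteDimensional ℝ P] :
    SecondCountableTopology (ControlL2 P) := by
  have : ProperSpace P := FiniteDimensional.proper_real P
  have : Fact ((2 : ℝ≥0∞) ≠ ⊤) := ⟨by simp⟩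
  infer_instance

end Restriction

/-! ### Switching the system off for large controls -/

section Cutoff

variable {E : Type*} [NormedAddCommGroup E] [NormedSpace ℝ E]
  {P : Type*} [NormedAddCommGroup P] [NormedSpace ℝ P] [FiniteDimensional ℝ P]
  {M : Type*} [TopologicalSpace M] [ChartedSpace E M]

variable (P) in
/-- A smooth function on `P` that is `1` on the ball of radius `|R| + 1` and has bounded support. -/
def plateau (R : ℝ) : ContDiffBump (0 : P) :=
  ⟨|R| + 1, |R| + 2, by positivity, by linarith⟩

/-- The control system `g`, switched off for large controls. -/
def cutoff (g : (x : M) → P → TangentSpace 𝓘(ℝ, E) x) (R : ℝ) (x : M) (w : P) :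
    TangentSpace 𝓘(ℝ, E) x :=
  (plateau P R w • (g x w : E) : E)

variable {g : (x : M) → P → TangentSpace 𝓘(ℝ, E) x} {R ρ : ℝ}

theorem cutoff_of_le {x : M} {w : P} (hw : ‖w‖ ≤ R) : cutoff g R x w = g x w := by
  have : plateau P R w = 1 := by
    refine (plateau P R).one_of_mem_closedBall ?_
    rw [Metric.mem_closedBall, dist_zero_right]
    exact hw.trans ((le_abs_self R).trans (by simp [plateau]))
  rw [cutoff, this]
  exact one_smul ℝ (g x w : E)

theorem cutoff_of_ge (x : M) (w : P) (hw : |R| + 2 ≤ ‖w‖) : cutoff g R x w = 0 := by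
  have : plateau P R w = 0 := by
    refine (plateau P R).zero_of_le_dist ?_
    rw [dist_zero_right]
    exact hw
  rw [cutoff, this]
  exact zero_smul ℝ (g x w : E)

/-- Allows passage between `g` and any of its cutoffs whenever the control is bounded; the L²
calculus is only available for the cutoffs. -/
theorem isSolution_cutoff_iff {w : ℝ → P} {a b : ℝ} {γ : ℝ → M}
    (hw : ∀ᵐ t ∂(volume.restrict (Icc a b)), ‖w t‖ ≤ R) :
    IsSolution (cutoff g R) w a b γ ↔ IsSolution g w a b γ := by
  refine ⟨fun h => HasVelocityOn.congr_velocity h ?_, fun h => HasVelocityOn.congr_velocity h ?_⟩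
  · filter_upwards [hw] with t ht using cutoff_of_le ht
  · filter_upwards [hw] with t ht using (cutoff_of_le ht).symm

variable [IsManifold 𝓘(ℝ, E) ∞ M]

/-- The trivializations are linear on fibres, so they commute with the scalar factor. -/
theorem IsSmoothControlled.smul (hg : IsSmoothControlled g) {ψ : P → ℝ} (hψ : ContDiff ℝ ∞ ψ) :
    IsSmoothControlled (fun x w => (ψ w • (g x w : E) : E) :
      (x : M) → P → TangentSpace 𝓘(ℝ, E) x) := by
  intro q
  have h := (Bundle.contMDiffAt_totalSpace (n := ∞)).1 (hg q)
  refine (Bundle.contMDiffAt_totalSpace (n := ∞)).2 ⟨h.1, ?_⟩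
  have h2 : ContMDiffAt (𝓘(ℝ, E).prod 𝓘(ℝ, P)) 𝓘(ℝ, ℝ) ∞ (fun q : M × P => ψ q.2) q :=
    ContMDiffAt.comp q (g := ψ) hψ.contDiffAt.contMDiffAt contMDiffAt_snd
  refine (h2.smul h.2).congr_of_eventuallyEq ?_
  have hs : (trivializationAt E (TangentSpace 𝓘(ℝ, E)) q.1).baseSet ×ˢ (univ : Set P) ∈ 𝓝 q :=
    prod_mem_nhds ((trivializationAt E (TangentSpace 𝓘(ℝ, E)) q.1).open_baseSet.mem_nhds
      (FiberBundle.mem_baseSet_trivializationAt' q.1)) univ_mem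
  filter_upwards [hs] with z hz
  set e := trivializationAt E (TangentSpace 𝓘(ℝ, E)) q.1 with he
  have k1 := congrFun (e.coe_linearMapAt_of_mem (R := ℝ) hz.1)
  have k2 := (e.linearMapAt ℝ z.1).map_smul (ψ z.2) (g z.1 z.2)
  rw [k1, k1] at k2
  exact k2

theorem IsSmoothControlled.comp {P' : Type*} [NormedAddCommGroup P'] [NormedSpace ℝ P']
    (hg : IsSmoothControlled g) {ψ : P' → P} (hψ : ContDiff ℝ ∞ ψ) :
    IsSmoothControlled (fun x w => g x (ψ w)) := by
  have h1 : ContMDiff (𝓘(ℝ, E).prod 𝓘(ℝ, P')) (𝓘(ℝ, E).prod 𝓘(ℝ, P)) ∞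
      (fun q : M × P' => (q.1, ψ q.2)) :=
    contMDiff_fst.prodMk (ContMDiff.comp (g := ψ) hψ.contMDiff contMDiff_snd)
  exact ContMDiff.comp hg h1

theorem IsSmoothControlled.cutoff (hg : IsSmoothControlled g) (R : ℝ) :
    IsSmoothControlled (cutoff g R) :=
  hg.smul (plateau P R).contDiff

end Cutoff

/-! ### The endpoint map and its maximal rank -/

section Endpoint

variable {E : Type*} [NormedAddCommGroup E] [NormedSpace ℝ E] [FiniteDimensional ℝ E]
  {P : Type*} [NormedAddCommGroup P] [NormedSpace ℝ P] [FiniteDimensional ℝ P]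
  {M : Type*} [TopologicalSpace M] [ChartedSpace E M] [IsManifold 𝓘(ℝ, E) ∞ M]
  {g : (x : M) → P → TangentSpace 𝓘(ℝ, E) x} {R T : ℝ} {x₀ p : M} {w : ControlL2 P}
  {φ : ControlL2 P → E}

/-- `φ` is the coordinate expression, in the chart at `p`, of the endpoint map of the solutions on
`[0, T]` that start at `x₀`, for controls near `w`; and it is `C¹`. -/
def IsEndpointChart (g : (x : M) → P → TangentSpace 𝓘(ℝ, E) x) (T : ℝ) (x₀ p : M)
    (w : ControlL2 P) (φ : ControlL2 P → E) : Prop :=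
  ContDiffAt ℝ 1 φ w ∧ ∀ᶠ w' : ControlL2 P in 𝓝 w, ∃ γ, IsSolution g w' 0 T γ ∧ γ 0 = x₀ ∧
    γ T ∈ (extChartAt 𝓘(ℝ, E) p).source ∧ extChartAt 𝓘(ℝ, E) p (γ T) = φ w'

theorem IsEndpointChart.eventually (h : IsEndpointChart g T x₀ p w φ) :
    ∀ᶠ w' in 𝓝 w, IsEndpointChart g T x₀ p w' φ :=
  (h.1.eventually (by simp)).and h.2.eventually_nhds

theorem IsSolution.exists_isEndpointChart (hg : IsSmoothControlled g)
    (hR : ∀ x w, R ≤ ‖w‖ → g x w = 0) (hT : 0 ≤ T) {γ : ℝ → M} (h : IsSolution g w 0 T γ)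
    (hp : γ T ∈ (extChartAt 𝓘(ℝ, E) p).source) : ∃ φ, IsEndpointChart g T (γ 0) p w φ := by
  obtain ⟨F, G, hF, -, hFx, hev⟩ := h.exists_isFlowNear hg hR hT
  have k1 : ContMDiffAt 𝓘(ℝ, ControlL2 P) 𝓘(ℝ, E) 1 (fun w' => F (γ 0, w')) w :=
    ContMDiffAt.comp w (g := F) hF (contMDiffAt_const.prodMk contMDiffAt_id)
  have k2 : ContMDiffAt 𝓘(ℝ, E) 𝓘(ℝ, E) 1 (extChartAt 𝓘(ℝ, E) p) (F (γ 0, w)) := by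
    rw [hFx]
    have : IsManifold 𝓘(ℝ, E) 1 M := IsManifold.of_le (n := ∞) (by norm_num)
    exact contMDiffAt_extChartAt' (by rwa [← extChartAt_source 𝓘(ℝ, E)])
  refine ⟨fun w' => extChartAt 𝓘(ℝ, E) p (F (γ 0, w')),
    contMDiffAt_iff_contDiffAt.1 (k2.comp w k1), ?_⟩
  have k3 : Tendsto (fun w' : ControlL2 P => (γ 0, w')) (𝓝 w) (𝓝 (γ 0, w)) :=
    (continuous_const.prodMk continuous_id).tendsto _
  have k4 : ∀ᶠ w' in 𝓝 w, F (γ 0, w') ∈ (extChartAt 𝓘(ℝ, E) p).source :=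
    k1.continuousAt.eventually ((isOpen_extChartAt_source p).mem_nhds (by
      simp only [hFx]
      exact hp))
  filter_upwards [k3.eventually hev, k4] with w' h1 h2
  obtain ⟨⟨γ', l1, l2, l3⟩, -⟩ := h1
  exact ⟨γ', l1, l2, by rwa [l3], by rw [l3]⟩

variable [T2Space M]

/-- By uniqueness, the solution whose existence is part of the chart is the only one. -/
theorem IsEndpointChart.eq (hg : IsSmoothControlled g) (hR : ∀ x w, R ≤ ‖w‖ → g x w = 0)
    (hT : 0 ≤ T) (h : IsEndpointChart g T x₀ p w φ) {γ : ℝ → M} (hγ : IsSolution g w 0 T γ)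
    (h0 : γ 0 = x₀) :
    γ T ∈ (extChartAt 𝓘(ℝ, E) p).source ∧ extChartAt 𝓘(ℝ, E) p (γ T) = φ w := by
  obtain ⟨γ', h1, h2, h3, h4⟩ := h.2.self_of_nhds
  have := hγ.eqOn hg hR h1 (h0.trans h2.symm) (right_mem_Icc.2 hT)
  rw [this]
  exact ⟨h3, h4⟩

/-- Directions along which the endpoint at time `T₁` varies independently still do so at a later
time, when the control is kept unchanged after `T₁`. -/
theorem injective_fderiv_superpose_restrictControl (hg : IsSmoothControlled g) {T₁ : ℝ}
    (h0 : 0 ≤ T₁) (hT : T₁ ≤ T) {R₁ ρ₁ ρ : ℝ} {w₁ : ControlL2 P} (hw₁ : EssBoundedBy ρ₁ w₁)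
    (hR₁ : ρ₁ + 1 ≤ R₁) (hw : EssBoundedBy ρ w) (hR : ρ + 1 ≤ R)
    (heq : ∀ᵐ t, t ≤ T₁ → w t = w₁ t) {φ₁ : ControlL2 P → E} {p₁ : M}
    (h₁ : IsEndpointChart (cutoff g R₁) T₁ x₀ p₁ w₁ φ₁)
    (h : IsEndpointChart (cutoff g R) T x₀ p w φ) {ι : Type*} [Fintype ι] {l : ι → ControlL2 P}
    (hl : ∀ j, l j ∈ boundedControls P)
    (hinj : Function.Injective (fderiv ℝ φ₁ w₁ ∘L superpose l)) :
    Function.Injective (fderiv ℝ φ w ∘L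
      superpose (fun j => restrictControl P (measurableSet_Iic (a := T₁)) (l j))) := by
  have : IsManifold 𝓘(ℝ, E) 1 M := IsManifold.of_le (n := ∞) (by norm_num)
  rw [superpose_restrictControl]
  set L := superpose l with hL
  set L' := restrictControl P (measurableSet_Iic (a := T₁)) ∘L L with hL'
  have hgR := hg.cutoff R
  have hgR₁ := hg.cutoff R₁
  have hz := cutoff_of_ge (g := g) (R := R)
  have hz₁ := cutoff_of_ge (g := g) (R := R₁)
  have hT0 : 0 ≤ T := h0.trans hT
  have hL'v : ∀ v, ∀ᵐ t, t ≤ T₁ → (w + L' v) t = (w₁ + L v) t := fun v => by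
    filter_upwards [heq, Lp.coeFn_add w (L' v), Lp.coeFn_add w₁ (L v),
      restrictControl_ae (measurableSet_Iic (a := T₁)) (L v)] with t k1 k2 k3 k4 ht
    have k4' : (L' v) t = L v t := by
      rw [hL']
      exact k4.trans (indicator_of_mem (mem_Iic.2 ht) _)
    rw [k2, k3, Pi.add_apply, Pi.add_apply, k1 ht, k4']
  have hL'w : ∀ v, ∀ᵐ t, T₁ < t → (w + L' v) t = w t := fun v => by
    filter_upwards [Lp.coeFn_add w (L' v),
      restrictControl_ae (measurableSet_Iic (a := T₁)) (L v)] with t k2 k4 ht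
    have k4' : (L' v) t = 0 := by
      rw [hL']
      exact k4.trans (indicator_of_notMem (by simpa using ht) _)
    rw [k2, Pi.add_apply, k4', add_zero]
  -- Perturbations bounded by 1 stay within the margins of both cutoffs, so up to time T₁ the two
  -- cut-off systems have the same solutions.
  have key : ∀ v, EssBoundedBy 1 (L v) → ∀ γ, IsSolution (cutoff g R) (w + L' v : ControlL2 P) 0 T γ →
      γ 0 = x₀ → IsEndpointChart (cutoff g R₁) T₁ x₀ p₁ (w₁ + L v) φ₁ →
      (γ T₁ ∈ (extChartAt 𝓘(ℝ, E) p₁).source ∧ extChartAt 𝓘(ℝ, E) p₁ (γ T₁) = φ₁ (w₁ + L v)) := by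
    intro v hv γ hγ hγ0 hch
    refine hch.eq hgR₁ hz₁ h0 ?_ hγ0
    have b1 : ∀ᵐ t, ‖(w + L' v : ControlL2 P) t‖ ≤ R :=
      (hw.add (hv.restrictControl zero_le_one measurableSet_Iic)).mono hR
    have b2 : ∀ᵐ t, ‖(w₁ + L v : ControlL2 P) t‖ ≤ R₁ := (hw₁.add hv).mono hR₁
    have k1 := (isSolution_cutoff_iff (ae_restrict_of_ae b1)).1 hγ
    refine (isSolution_cutoff_iff (ae_restrict_of_ae b2)).2 ((k1.mono le_rfl hT).congr_control ?_)
    refine (ae_restrict_iff' measurableSet_Icc).2 ?_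
    filter_upwards [hL'v v] with t ht ht' using ht ht'.2
  obtain ⟨γ, hγ, hγ0, hγp, hγφ⟩ := h.2.self_of_nhds
  obtain ⟨F, G, -, hG, hFx, hev⟩ := (hγ.mono h0 le_rfl).exists_isFlowNear hgR hz hT
  have hGx : G (γ T, w) = γ T₁ := by
    have := hev.self_of_nhds.2
    rwa [hFx] at this
  have hL0 : L 0 = 0 := map_zero L
  have hL'0 : L' 0 = 0 := map_zero L'
  obtain ⟨hγ₁p, hγ₁φ⟩ := key 0 (by rw [hL0]; exact EssBoundedBy.zero.mono zero_le_one) γ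
    (by rwa [hL'0, add_zero]) hγ0 (by rwa [hL0, add_zero])
  rw [hL0, add_zero] at hγ₁φ
  have hc₁ : ContinuousAt (fun v => w₁ + L v) 0 := by fun_prop
  have hc : ContinuousAt (fun v => w + L' v) 0 := by fun_prop
  have hc₁' : Tendsto (fun v => w₁ + L v) (𝓝 0) (𝓝 w₁) := by
    simpa [ContinuousAt, hL0] using hc₁
  have hc' : Tendsto (fun v => w + L' v) (𝓝 0) (𝓝 w) := by
    simpa [ContinuousAt, hL'0] using hc
  set η : (ι → ℝ) → M := fun v => (extChartAt 𝓘(ℝ, E) p₁).symm (φ₁ (w₁ + L v)) with hη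
  have hηT : Tendsto η (𝓝 0) (𝓝 (γ T₁)) := by
    have k1 : Tendsto (fun v => φ₁ (w₁ + L v)) (𝓝 0) (𝓝 (extChartAt 𝓘(ℝ, E) p₁ (γ T₁))) := by
      rw [hγ₁φ]
      exact h₁.1.continuousAt.tendsto.comp hc₁'
    have k2 := (continuousAt_extChartAt_symm' (I := 𝓘(ℝ, E)) hγ₁p).tendsto.comp k1
    rwa [(extChartAt 𝓘(ℝ, E) p₁).left_inv hγ₁p] at k2
  -- κ runs the fixed control w backwards from time T to time T₁. The perturbation vanishes after
  -- T₁, so κ sends the perturbed endpoint at T to the perturbed endpoint at T₁.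
  set κ : E → E := fun z => extChartAt 𝓘(ℝ, E) p₁ (G ((extChartAt 𝓘(ℝ, E) p).symm z, w)) with hκ
  have hrel : ∀ᶠ v in 𝓝 (0 : ι → ℝ), κ (φ (w + L' v)) = φ₁ (w₁ + L v) := by
    have e1 : Tendsto (fun v => (η v, w)) (𝓝 0) (𝓝 (γ T₁, w)) := hηT.prodMk_nhds tendsto_const_nhds
    filter_upwards [hc'.eventually h.2, hc₁'.eventually h₁.eventually,
      eventually_essBoundedBy_superpose hl one_pos, e1.eventually hev] with v k1 k2 k3 k4
    obtain ⟨γ', l1, l2, l3, l4⟩ := k1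
    obtain ⟨m1, m2⟩ := key v k3 γ' l1 l2 k2
    have m3 : γ' T₁ = η v := by
      rw [hη]
      simp only
      rw [← m2, (extChartAt 𝓘(ℝ, E) p₁).left_inv m1]
    obtain ⟨⟨γ'', n1, n2, n3⟩, n4⟩ := k4
    have n5 : IsSolution (cutoff g R) w T₁ T γ' := by
      refine (l1.mono h0 le_rfl).congr_control ((ae_restrict_iff' measurableSet_Icc).2 ?_)
      have ha : ∀ᵐ t : ℝ, t ≠ T₁ := by simp [ae_iff, measure_singleton]
      filter_upwards [hL'w v, ha] with t q1 q2 q3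
      exact q1 (lt_of_le_of_ne q3.1 q2.symm)
    have n6 : γ' T = γ'' T := n5.eqOn hgR hz n1 (m3.trans n2.symm) (right_mem_Icc.2 hT)
    have n7 : F (η v, w) = γ' T := by rw [n6, n3]
    simp only [hκ]
    rw [← l4, (extChartAt 𝓘(ℝ, E) p).left_inv l3, ← n7, n4, ← m3, m2]
  have hsymm : (extChartAt 𝓘(ℝ, E) p).symm (φ w) = γ T := by
    rw [← hγφ, (extChartAt 𝓘(ℝ, E) p).left_inv hγp]
  have hκd : DifferentiableAt ℝ κ (φ w) := by
    have k1 : ContMDiffAt 𝓘(ℝ, E) 𝓘(ℝ, E) 1 (extChartAt 𝓘(ℝ, E) p).symm (φ w) := by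
      refine (contMDiffOn_extChartAt_symm p).contMDiffAt ((isOpen_extChartAt_target p).mem_nhds ?_)
      rw [← hγφ]
      exact (extChartAt 𝓘(ℝ, E) p).map_source hγp
    have k2 : ContMDiffAt 𝓘(ℝ, E) 𝓘(ℝ, E) 1
        (fun z => G ((extChartAt 𝓘(ℝ, E) p).symm z, w)) (φ w) := by
      refine ContMDiffAt.comp (φ w) (g := G) ?_ (k1.prodMk
        (contMDiffAt_const : ContMDiffAt 𝓘(ℝ, E) 𝓘(ℝ, ControlL2 P) 1 (fun _ => w) (φ w)))
      rw [hsymm]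
      exact hG
    have k3 : ContMDiffAt 𝓘(ℝ, E) 𝓘(ℝ, E) 1 (extChartAt 𝓘(ℝ, E) p₁)
        (G ((extChartAt 𝓘(ℝ, E) p).symm (φ w), w)) := by
      rw [hsymm, hGx]
      exact contMDiffAt_extChartAt' (by rwa [← extChartAt_source 𝓘(ℝ, E)])
    exact (contMDiffAt_iff_contDiffAt.1 (k3.comp (φ w) k2)).differentiableAt one_ne_zero
  have d1 : HasFDerivAt (fun v => φ (w + L' v)) (fderiv ℝ φ w ∘L L') 0 := by
    have := (h.1.differentiableAt one_ne_zero).hasFDerivAt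
    rw [show w = w + L' 0 by rw [hL'0, add_zero]] at this
    have k := this.comp (0 : ι → ℝ) (L'.hasFDerivAt.const_add w)
    rwa [show w + L' 0 = w by rw [hL'0, add_zero]] at k
  have d2 : HasFDerivAt (fun v => φ₁ (w₁ + L v)) (fderiv ℝ φ₁ w₁ ∘L L) 0 := by
    have := (h₁.1.differentiableAt one_ne_zero).hasFDerivAt
    rw [show w₁ = w₁ + L 0 by rw [hL0, add_zero]] at this
    have k := this.comp (0 : ι → ℝ) (L.hasFDerivAt.const_add w₁)
    rwa [show w₁ + L 0 = w₁ by rw [hL0, add_zero]] at k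
  have d3 : HasFDerivAt (fun v => κ (φ (w + L' v))) (fderiv ℝ κ (φ w) ∘L (fderiv ℝ φ w ∘L L')) 0 := by
    have := hκd.hasFDerivAt
    rw [show w = w + L' 0 by rw [hL'0, add_zero]] at this
    have k := this.comp (0 : ι → ℝ) d1
    rwa [show w + L' 0 = w by rw [hL'0, add_zero]] at k
  -- Differentiating gives dκ ∘ dφ ∘ L' = dφ₁ ∘ L, and injectivity of the right side passes to dφ ∘
  -- L'.
  have d4 := (d3.congr_of_eventuallyEq (EventuallyEq.symm hrel)).unique d2
  rw [← d4] at hinj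
  exact fun v v' hv => hinj (congrArg (fderiv ℝ κ (φ w)) hv)

theorem exists_concat_control {w₁ w : ControlL2 P} {ρ₁ ρ : ℝ} (h₁ : EssBoundedBy ρ₁ w₁)
    (h : EssBoundedBy ρ w) (T₁ : ℝ) :
    ∃ w' : ControlL2 P, EssBoundedBy (max ρ₁ ρ) w' ∧ (∀ᵐ t, t ≤ T₁ → w' t = w₁ t) ∧
      ∀ᵐ t, T₁ < t → w' t = w (t - T₁) := by
  have hmp : MeasurePreserving (fun t : ℝ => t - T₁) volume volume :=
    measurePreserving_sub_right volume T₁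
  let ws := Lp.compMeasurePreserving (fun t : ℝ => t - T₁) hmp w
  have hws := Lp.coeFn_compMeasurePreserving w hmp
  let w' := restrictControl P (measurableSet_Iic (a := T₁)) w₁
    + restrictControl P (measurableSet_Ioi (a := T₁)) ws
  have hw' : ∀ᵐ t, w' t = if t ≤ T₁ then w₁ t else w (t - T₁) := by
    filter_upwards [hws, Lp.coeFn_add (restrictControl P (measurableSet_Iic (a := T₁)) w₁)
      (restrictControl P (measurableSet_Ioi (a := T₁)) ws),
      restrictControl_ae (measurableSet_Iic (a := T₁)) w₁,
      restrictControl_ae (measurableSet_Ioi (a := T₁)) ws] with t k1 k2 k3 k4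
    rw [k2, Pi.add_apply, k3, k4]
    by_cases ht : t ≤ T₁
    · simp [ht]
    · rw [indicator_of_notMem (by simpa using ht), indicator_of_mem (by simpa using ht), if_neg ht,
        zero_add]
      exact k1
  refine ⟨w', ?_, ?_, ?_⟩
  · filter_upwards [hw', h₁, hmp.quasiMeasurePreserving.ae h] with t k1 k2 k3
    rw [k1]
    split_ifs
    · exact k2.trans (le_max_left _ _)
    · exact k3.trans (le_max_right _ _)
  · filter_upwards [hw'] with t k1 ht
    rw [k1, if_pos ht]
  · filter_upwards [hw'] with t k1 ht
    rw [k1, if_neg (not_le.2 ht)]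

theorem IsSolution.exists_concat {w₁ w : ControlL2 P} {ρ₁ ρ T₁ : ℝ} {γ₁ γ : ℝ → M}
    (h₁ : IsSolution g w₁ 0 T₁ γ₁) (h : IsSolution g w 0 T γ) (hT₁ : 0 ≤ T₁) (hT : 0 < T)
    (hγ : γ₁ T₁ = γ 0) (b₁ : EssBoundedBy ρ₁ w₁) (b : EssBoundedBy ρ w) :
    ∃ w' : ControlL2 P, EssBoundedBy (max ρ₁ ρ) w' ∧ (∀ᵐ t, t ≤ T₁ → w' t = w₁ t) ∧
      ∃ γ', IsSolution g w' 0 (T₁ + T) γ' ∧ γ' 0 = γ₁ 0 ∧ γ' (T₁ + T) = γ T := by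
  obtain ⟨w', hb, hw₁, hw⟩ := exists_concat_control b₁ b T₁
  have k1 : IsSolution g (fun t => w (1 * t + -T₁)) T₁ (T₁ + T) (fun t => γ (1 * t + -T₁)) := by
    have := HasVelocityOn.comp_affine h (α := 1) (β := -T₁) one_pos (a' := T₁) (b' := T₁ + T)
      (by linarith) (by linarith)
    exact HasVelocityOn.congr_velocity this (Eventually.of_forall fun t => one_smul ℝ (_ : E))
  have k2 : IsSolution g w' T₁ (T₁ + T) (fun t => γ (1 * t + -T₁)) := by
    refine k1.congr_control ((ae_restrict_iff' measurableSet_Icc).2 ?_)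
    have ha : ∀ᵐ t : ℝ, t ≠ T₁ := by simp [ae_iff, measure_singleton]
    filter_upwards [hw, ha] with t q1 q2 q3
    rw [q1 (lt_of_le_of_ne q3.1 q2.symm), one_mul, ← sub_eq_add_neg]
  have k3 : IsSolution g w' 0 T₁ γ₁ := by
    refine h₁.congr_control ((ae_restrict_iff' measurableSet_Icc).2 ?_)
    filter_upwards [hw₁] with t q1 q3 using (q1 q3.2).symm
  refine ⟨w', hb, hw₁, _, k3.glue k2 hT₁ (by linarith) (by simp [hγ]), by simp [hT₁], ?_⟩
  simp [hT]

variable (g x₀) in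
/-- `r` is the rank of the differential of an endpoint map of trajectories of `g` from `x₀` at an
essentially bounded control. -/
def AttainsRank (r : ℕ) : Prop :=
  ∃ (T R ρ : ℝ) (w : ControlL2 P) (p : M) (φ : ControlL2 P → E), 0 < T ∧ ρ + 1 ≤ R ∧
    EssBoundedBy ρ w ∧ IsEndpointChart (cutoff g R) T x₀ p w φ ∧
    Module.finrank ℝ (LinearMap.range (fderiv ℝ φ w : ControlL2 P →ₗ[ℝ] E)) = r

/-- The zero control on a short flow box attains some rank; together with `AttainsRank.le` this
makes a maximal rank available. -/
theorem exists_attainsRank (hg : IsSmoothControlled g) (x₀ : M) : ∃ r, AttainsRank g x₀ r := by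
  obtain ⟨U, -, hxU, δ, hδ, H⟩ := exists_flowBox (hg.cutoff 1) cutoff_of_ge x₀
  obtain ⟨F, G, -, -, hex, -⟩ := H 0 δ hδ.le (by simp)
  obtain ⟨⟨γ, k1, k2, -⟩, -⟩ := hex x₀ hxU 0
  obtain ⟨φ, hφ⟩ := k1.exists_isEndpointChart (hg.cutoff 1) cutoff_of_ge hδ.le (p := γ δ)
    (mem_extChartAt_source _)
  rw [k2] at hφ
  exact ⟨_, δ, 1, 0, 0, γ δ, φ, hδ, by norm_num, EssBoundedBy.zero, hφ, rfl⟩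

theorem AttainsRank.le {r : ℕ} (h : AttainsRank g x₀ r) : r ≤ Module.finrank ℝ E := by
  obtain ⟨T, R, ρ, w, p, φ, -, -, -, -, rfl⟩ := h
  exact Submodule.finrank_le _

/-- If every point is reached from every other one with an essentially bounded control, then there
is an essentially bounded control at which the endpoint map is a submersion. -/
theorem attainsRank_finrank (hg : IsSmoothControlled g)
    (hreach : ∀ x q : M, q ≠ x → ∃ w ∈ boundedControls P, ∃ γ,
      IsSolution g w 0 1 γ ∧ γ 0 = x ∧ γ 1 = q) (x₀ : M) :
    AttainsRank g x₀ (Module.finrank ℝ E) := by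
  classical
  have := secondCountableTopology_controlL2 (P := P)
  obtain ⟨r₀, hr₀⟩ := exists_attainsRank hg x₀
  obtain ⟨r, hr, hmax⟩ : ∃ r, AttainsRank g x₀ r ∧ ∀ r', AttainsRank g x₀ r' → r' ≤ r :=
    ⟨_, Nat.findGreatest_spec (P := AttainsRank g x₀) hr₀.le hr₀,
      fun r' h => Nat.le_findGreatest h.le h⟩
  refine (le_antisymm hr.le ?_ : r = Module.finrank ℝ E) ▸ hr
  obtain ⟨T₁, R₁, ρ₁, w₁, p₁, φ₁, hT₁, hρ₁, hw₁, hφ₁, hr₁⟩ := hr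
  obtain ⟨l, hl, hinj⟩ : ∃ l : Fin r → ControlL2 P, (∀ j, l j ∈ boundedControls P) ∧
      Function.Injective (fderiv ℝ φ₁ w₁ ∘L superpose l) := by
    rw [← hr₁]
    exact exists_bounded_linearIndependent (fderiv ℝ φ₁ w₁)
  set L' := superpose (fun j => restrictControl P (measurableSet_Iic (a := T₁)) (l j)) with hL'
  have hl' : ∀ j, restrictControl P (measurableSet_Iic (a := T₁)) (l j) ∈ boundedControls P :=
    fun j => by
      obtain ⟨c, hc⟩ := hl j
      exact ⟨c, hc.restrictControl hc.nonneg _⟩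
  obtain ⟨γ₁, hγ₁, hγ₁0, -, -⟩ := hφ₁.2.self_of_nhds
  set x₁ := γ₁ T₁ with hx₁
  have hγ₁g : IsSolution g w₁ 0 T₁ γ₁ := (isSolution_cutoff_iff (ae_restrict_of_ae
    (hw₁.mono (by linarith) : EssBoundedBy R₁ w₁))).1 hγ₁
  -- The continuations of w₁ with bound N. This L∞-type constraint does not give a neighbourhood in
  -- L², which is why the rank theorem is stated relative to a convex set.
  set C : ℕ → Set (ControlL2 P) := fun N =>
    {w | EssBoundedBy N w ∧ ∀ᵐ t, t ≤ T₁ → w t = w₁ t} with hC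
  have hCconv : ∀ N, Convex ℝ (C N) := fun N => by
    refine (convex_essBoundedBy (N : ℝ)).inter ?_
    intro w hw w' hw' a b ha hb hab
    filter_upwards [hw, hw', Lp.coeFn_add (a • w) (b • w'), Lp.coeFn_smul a w, Lp.coeFn_smul b w']
      with t k1 k2 k3 k4 k5 ht
    rw [k3, Pi.add_apply, k4, k5, Pi.smul_apply, Pi.smul_apply, k1 ht, k2 ht, ← add_smul, hab,
      one_smul]
  set ends : ℕ → ControlL2 P → E → Prop := fun N w z => ∃ γ,
    IsSolution (cutoff g (N + 2)) w 0 (T₁ + 1) γ ∧ γ 0 = x₀ ∧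
      γ (T₁ + 1) ∈ (extChartAt 𝓘(ℝ, E) x₀).source ∧ extChartAt 𝓘(ℝ, E) x₀ (γ (T₁ + 1)) = z
    with hends
  have hloc : ∀ N, ∀ w ∈ {w | w ∈ C N ∧ ∃ z, ends N w z}, ∃ O ∈ 𝓝 w, ∃ φ : ControlL2 P → E,
      dimH (φ '' (O ∩ C N)) ≤ r ∧ ∀ w' ∈ O, ∀ z, ends N w' z → z = φ w' := by
    rintro N w ⟨hwC, z, γ, hγ, hγ0, hγp, -⟩
    obtain ⟨φ, hφ⟩ := hγ.exists_isEndpointChart (hg.cutoff _) cutoff_of_ge (by linarith) hγp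
    rw [hγ0] at hφ
    have hinj' := injective_fderiv_superpose_restrictControl hg hT₁.le (by linarith) hw₁ hρ₁ hwC.1
      (by linarith) hwC.2 hφ₁ hφ hl hinj
    have hrank : ∀ᶠ q : ControlL2 P × (Fin r → ℝ) in 𝓝 (w, 0), q.1 ∈ C N →
        Module.finrank ℝ (LinearMap.range (fderiv ℝ φ (q.1 + L' q.2) : ControlL2 P →ₗ[ℝ] E))
          ≤ Module.finrank ℝ (Fin r → ℝ) := by
      have c1 : ContinuousAt (fun q : ControlL2 P × (Fin r → ℝ) => q.1 + L' q.2) (w, 0) := by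
        fun_prop
      have c2 : Tendsto (fun q : ControlL2 P × (Fin r → ℝ) => q.1 + L' q.2) (𝓝 (w, 0)) (𝓝 w) := by
        simpa [ContinuousAt] using c1
      have c3 : Tendsto (fun q : ControlL2 P × (Fin r → ℝ) => q.2) (𝓝 (w, 0)) (𝓝 0) :=
        continuousAt_snd
      filter_upwards [c2.eventually hφ.eventually,
        c3.eventually (eventually_essBoundedBy_superpose hl' one_pos)] with q h1 h2 h3
      -- Maximality of r bounds the rank. The cutoff level N + 2 leaves 1 for the perturbation and 1
      -- for the margin in `AttainsRank`.
      rw [Module.finrank_fin_fun]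
      exact hmax _ ⟨T₁ + 1, N + 2, N + 1, _, x₀, φ, by linarith, by linarith, h3.1.add h2, h1, rfl⟩
    obtain ⟨O, hO, hdim⟩ := exists_dimH_image_le (hCconv N) hwC hφ.1 L' hinj' hrank
    rw [Module.finrank_fin_fun] at hdim
    refine ⟨O ∩ {w' | IsEndpointChart (cutoff g (N + 2)) (T₁ + 1) x₀ x₀ w' φ},
      inter_mem hO hφ.eventually, φ, (dimH_mono (image_mono (by gcongr; exact inter_subset_left))).trans
        hdim, ?_⟩
    rintro w' ⟨-, hw'⟩ z ⟨γ', m1, m2, -, rfl⟩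
    exact (hw'.eq (hg.cutoff _) cutoff_of_ge (by linarith) m1 m2).2
  set S : ℕ → Set E := fun N => {z | ∃ w ∈ C N, ends N w z} with hS
  -- Lindelöf: countably many of the local images cover S N, and Hausdorff dimension is stable under
  -- countable unions.
  have hSdim : ∀ N, dimH (S N) ≤ r := fun N => by
    choose! O hO φ hφ hends' using hloc N
    obtain ⟨t, hts, htc, hcov⟩ := TopologicalSpace.countable_cover_nhdsWithin (f := O)
      fun w hw => mem_nhdsWithin_of_mem_nhds (hO w hw)
    have hsub : S N ⊆ ⋃ w ∈ t, φ w '' (O w ∩ C N) := by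
      rintro z ⟨w, hw, hz⟩
      obtain ⟨v, hv, hwv⟩ := mem_iUnion₂.1 (hcov ⟨hw, z, hz⟩)
      exact mem_iUnion₂.2 ⟨v, hv, w, ⟨hwv, hw⟩, (hends' v (hts hv) w hwv z hz).symm⟩
    refine (dimH_mono hsub).trans ?_
    rw [dimH_bUnion htc]
    exact iSup₂_le fun w hw => hφ w (hts hw)
  set ψ := extChartAt 𝓘(ℝ, E) x₀ with hψ
  -- After w₁, every point other than x₁ can be reached in one more unit of time. The point x₁ is
  -- set aside because `hreach` only joins distinct points; a singleton has dimension 0.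
  have hcov : ψ.target ⊆ (⋃ N, S N) ∪ {ψ x₁} := by
    intro z hz
    by_cases hzx : z = ψ x₁
    · exact Or.inr hzx
    left
    have hne : ψ.symm z ≠ x₁ := fun h => hzx (by rw [← h, ψ.right_inv hz])
    obtain ⟨w, ⟨ρ, hw⟩, γ, hγ, hγ0, hγ1⟩ := hreach x₁ _ hne
    obtain ⟨w', hw', hww, γ', m1, m2, m3⟩ := hγ₁g.exists_concat hγ hT₁.le one_pos
      (by rw [hγ0]) hw₁ hw
    obtain ⟨N, hN⟩ := exists_nat_ge (max ρ₁ ρ)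
    refine mem_iUnion.2 ⟨N, w', ⟨hw'.mono hN, hww⟩, γ', ?_, m2.trans hγ₁0, ?_, ?_⟩
    · exact (isSolution_cutoff_iff (ae_restrict_of_ae
        (hw'.mono (by linarith) : EssBoundedBy ((N : ℝ) + 2) w'))).2 m1
    · rw [m3, hγ1]
      exact ψ.map_target hz
    · rw [m3, hγ1]
      exact ψ.right_inv hz
  have hdim : dimH ψ.target = Module.finrank ℝ E :=
    Real.dimH_of_mem_nhds (extChartAt_target_mem_nhds (I := 𝓘(ℝ, E)) x₀)
  have hle : dimH ψ.target ≤ r := by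
    refine (dimH_mono hcov).trans ?_
    rw [dimH_union, dimH_singleton, dimH_iUnion]
    exact max_le (iSup_le hSdim) zero_le
  rw [hdim] at hle
  exact_mod_cast hle

end Endpoint

/-! ### Every point is a regular endpoint -/

section RegularEndpoint

variable {E : Type*} [NormedAddCommGroup E] [NormedSpace ℝ E] [FiniteDimensional ℝ E]
  {P : Type*} [NormedAddCommGroup P] [NormedSpace ℝ P] [FiniteDimensional ℝ P]
  {M : Type*} [TopologicalSpace M] [ChartedSpace E M] [IsManifold 𝓘(ℝ, E) ∞ M] [T2Space M]
  {g : (x : M) → P → TangentSpace 𝓘(ℝ, E) x}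

/-- If every point is reached from every other one with an essentially bounded control, then every
point is reached with an essentially bounded control at which the endpoint map is a submersion. -/
theorem exists_regular_endpoint (hg : IsSmoothControlled g)
    (hreach : ∀ x q : M, q ≠ x → ∃ w ∈ boundedControls P, ∃ γ,
      IsSolution g w 0 1 γ ∧ γ 0 = x ∧ γ 1 = q) (x₀ q : M) (K : ℝ) :
    ∃ (T ρ : ℝ) (w : ControlL2 P) (φ : ControlL2 P → E)
      (l : Fin (Module.finrank ℝ E) → ControlL2 P), 0 < T ∧ K ≤ ρ ∧ EssBoundedBy ρ w ∧
      IsEndpointChart (cutoff g (ρ + 1)) T x₀ q w φ ∧ φ w = extChartAt 𝓘(ℝ, E) q q ∧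
      (∀ j, l j ∈ boundedControls P) ∧ Function.Surjective (fderiv ℝ φ w ∘L superpose l) := by
  obtain ⟨T₁, R₁, ρ₁, w₁, p₁, φ₁, hT₁, hρ₁, hw₁, hφ₁, hr₁⟩ := attainsRank_finrank hg hreach x₀
  obtain ⟨l, hl, hinj⟩ : ∃ l : Fin (Module.finrank ℝ E) → ControlL2 P,
      (∀ j, l j ∈ boundedControls P) ∧ Function.Injective (fderiv ℝ φ₁ w₁ ∘L superpose l) := by
    rw [← hr₁]
    exact exists_bounded_linearIndependent (fderiv ℝ φ₁ w₁)
  obtain ⟨γ₁, hγ₁, hγ₁0, -, -⟩ := hφ₁.2.self_of_nhds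
  have hγ₁g : IsSolution g w₁ 0 T₁ γ₁ := (isSolution_cutoff_iff (ae_restrict_of_ae
    (hw₁.mono (by linarith) : EssBoundedBy R₁ w₁))).1 hγ₁
  -- Run the control of full rank first, then steer from its endpoint to q, unless it already ends
  -- at q.
  obtain ⟨T, ρ, w, γ, hT, hw, heq, hγ, hγ0, hγT⟩ : ∃ (T ρ : ℝ) (w : ControlL2 P) (γ : ℝ → M),
      T₁ ≤ T ∧ EssBoundedBy ρ w ∧ (∀ᵐ t, t ≤ T₁ → w t = w₁ t) ∧ IsSolution g w 0 T γ ∧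
        γ 0 = x₀ ∧ γ T = q := by
    by_cases hq : q = γ₁ T₁
    · exact ⟨T₁, ρ₁, w₁, γ₁, le_rfl, hw₁, Eventually.of_forall fun _ _ => rfl, hγ₁g, hγ₁0, hq.symm⟩
    · obtain ⟨w, ⟨ρ, hw⟩, γ, hγ, hγ0, hγ1⟩ := hreach _ _ hq
      obtain ⟨w', hw', hww, γ', m1, m2, m3⟩ := hγ₁g.exists_concat hγ hT₁.le one_pos
        (by rw [hγ0]) hw₁ hw
      exact ⟨T₁ + 1, _, w', γ', by linarith, hw', hww, m1, m2.trans hγ₁0, m3.trans hγ1⟩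
  have hw' : EssBoundedBy (max K ρ) w := hw.mono (le_max_right _ _)
  have hγc : IsSolution (cutoff g (max K ρ + 1)) w 0 T γ := (isSolution_cutoff_iff
    (ae_restrict_of_ae (hw'.mono (by linarith) : EssBoundedBy (max K ρ + 1) w))).2 hγ
  obtain ⟨φ, hφ⟩ := hγc.exists_isEndpointChart (hg.cutoff _) cutoff_of_ge (hT₁.le.trans hT)
    (p := q) (by rw [hγT]; exact mem_extChartAt_source q)
  rw [hγ0] at hφ
  have hφw := (hφ.eq (hg.cutoff _) cutoff_of_ge (hT₁.le.trans hT) hγc hγ0).2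
  have hinj' := injective_fderiv_superpose_restrictControl hg hT₁.le hT hw₁ hρ₁ hw' le_rfl heq
    hφ₁ hφ hl hinj
  refine ⟨T, max K ρ, w, φ, _, hT₁.trans_le hT, le_max_left _ _, hw', hφ, ?_, fun j => ?_,
    (LinearMap.injective_iff_surjective_of_finrank_eq_finrank
      (f := (fderiv ℝ φ w ∘L superpose _).toLinearMap) (by simp)).1 hinj'⟩
  · rw [← hφw, hγT]
  · obtain ⟨c, hc⟩ := hl j
    exact ⟨c, hc.restrictControl hc.nonneg _⟩

end RegularEndpoint

/-! ### Hitting a value exactly after perturbing the data -/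

section OpenMapping

variable {W E : Type*} [NormedAddCommGroup W] [NormedSpace ℝ W] [CompleteSpace W]
  [NormedAddCommGroup E] [NormedSpace ℝ E] [FiniteDimensional ℝ E] {ι : Type*} [Fintype ι]

/-- A value that a `C¹` map takes submersively along finitely many directions is also taken along
nearby directions from a nearby point. -/
theorem eventually_exists_apply_add_sum_smul_eq {φ : W → E} {w : W} {l : ι → W}
    (hφ : ContDiffAt ℝ 1 φ w) (hl : ∀ z, ∃ v : ι → ℝ, fderiv ℝ φ w (∑ j, v j • l j) = z)
    {U : Set ((W × (ι → W)) × (ι → ℝ))} (hU : U ∈ 𝓝 ((w, l), 0)) :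
    ∀ᶠ q : W × (ι → W) in 𝓝 (w, l), ∃ v, (q, v) ∈ U ∧ φ (q.1 + ∑ j, v j • q.2 j) = φ w := by
  have : CompleteSpace E := FiniteDimensional.complete ℝ E
  set s : (W × (ι → W)) × (ι → ℝ) → W := fun q => q.1.1 + ∑ j, q.2 j • q.1.2 j with hs
  have hs0 : s ((w, l), 0) = w := by simp [hs]
  -- Keeping the base point and the directions as output makes the open mapping theorem yield a
  -- solution v for every nearby choice of them.
  set Ψ : (W × (ι → W)) × (ι → ℝ) → (W × (ι → W)) × E := fun q => (q.1, φ (s q)) with hΨ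
  have hsC : ContDiff ℝ 1 s := by fun_prop
  have hφ' : ContDiffAt ℝ 1 φ (s ((w, l), 0)) := by rwa [hs0]
  have hΨC : ContDiffAt ℝ 1 Ψ ((w, l), 0) :=
    contDiffAt_fst.prodMk (hφ'.comp _ hsC.contDiffAt)
  set D := fderiv ℝ s ((w, l), 0) with hD
  have hsd : HasFDerivAt s D ((w, l), 0) := (hsC.differentiable one_ne_zero _).hasFDerivAt
  have hDv : ∀ v : ι → ℝ, D (0, v) = ∑ j, v j • l j := fun v => by
    have h1 : HasFDerivAt (fun v : ι → ℝ => s ((w, l), v))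
        (D ∘L (ContinuousLinearMap.inr ℝ (W × (ι → W)) (ι → ℝ))) 0 :=
      hsd.comp (0 : ι → ℝ) (hasFDerivAt_prodMk_right (w, l) 0)
    have h2 : HasFDerivAt (fun v : ι → ℝ => s ((w, l), v))
        (∑ j, (ContinuousLinearMap.proj j : (ι → ℝ) →L[ℝ] ℝ).smulRight (l j)) 0 := by
      have h3 := (∑ j, (ContinuousLinearMap.proj j : (ι → ℝ) →L[ℝ] ℝ).smulRight (l j)).hasFDerivAt
        (x := (0 : ι → ℝ)) |>.const_add w
      refine h3.congr_of_eventuallyEq (Eventually.of_forall fun v => ?_)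
      simp [hs]
    have h3 := DFunLike.congr_fun (h1.unique h2) v
    simpa using h3
  have hΨd : HasFDerivAt Ψ ((ContinuousLinearMap.fst ℝ (W × (ι → W)) (ι → ℝ)).prod
      (fderiv ℝ φ w ∘L D)) ((w, l), 0) := by
    have h1 := (hφ'.differentiableAt one_ne_zero).hasFDerivAt.comp ((w, l), (0 : ι → ℝ)) hsd
    rw [hs0] at h1
    exact hasFDerivAt_fst.prodMk h1
  have hst := hΨC.hasStrictFDerivAt' hΨd one_ne_zero
  have hmap := hst.map_nhds_eq_of_surj (by
    rw [LinearMap.range_eq_top]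
    rintro ⟨q, z⟩
    obtain ⟨v, hv⟩ := hl (z - fderiv ℝ φ w (D (q, 0)))
    refine ⟨(q, v), Prod.ext rfl ?_⟩
    have : ((q, v) : (W × (ι → W)) × (ι → ℝ)) = (q, 0) + (0, v) := by simp
    change fderiv ℝ φ w (D (q, v)) = z
    rw [this, map_add, map_add, hDv, hv]
    abel)
  have himg : Ψ '' U ∈ 𝓝 ((w, l), φ w) := by
    have h1 : Ψ ((w, l), 0) = ((w, l), φ w) := by simp [hΨ, hs0]
    rw [← h1, ← hmap]
    exact image_mem_map hU
  have hc : Tendsto (fun q : W × (ι → W) => (q, φ w)) (𝓝 (w, l)) (𝓝 ((w, l), φ w)) :=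
    (continuous_id.prodMk continuous_const).tendsto _
  filter_upwards [hc himg] with q hq
  obtain ⟨⟨q', v⟩, hqU, hqv⟩ := hq
  obtain rfl : q' = q := congrArg Prod.fst hqv
  exact ⟨v, hqU, congrArg Prod.snd hqv⟩

end OpenMapping

/-! ### Controls given by nodal values on a uniform grid -/

section Nodal

variable {Y : Type*} [NormedAddCommGroup Y] [NormedSpace ℝ Y]

/-- The control on `[0, T]` with values `a i` at the nodes `i * T / k`. The first component is
constant on each cell. The second one is affine on each cell if `κ = 1`, and constant if `κ = 0`. -/
def nodal (κ T : ℝ) (k : ℕ) (a : ℕ → ℝ × Y) (t : ℝ) : ℝ × Y :=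
  ((a ⌊t * k / T⌋₊).1, (a ⌊t * k / T⌋₊).2 + (κ * (t * k / T - ⌊t * k / T⌋₊)) •
    ((a (⌊t * k / T⌋₊ + 1)).2 - (a ⌊t * k / T⌋₊).2))

variable {κ T : ℝ} {k : ℕ}

/-- Linearity in the nodes: correcting a nodal control along nodal directions on the same grid
leaves it nodal. -/
theorem nodal_add_sum_smul {ι : Type*} [Fintype ι] (a : ℕ → ℝ × Y) (a' : ι → ℕ → ℝ × Y)
    (v : ι → ℝ) (t : ℝ) :
    nodal κ T k (fun i => a i + ∑ j, v j • a' j i) t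
      = nodal κ T k a t + ∑ j, v j • nodal κ T k (a' j) t := by
  refine Prod.ext ?_ ?_
  · simp [nodal, Prod.fst_sum]
  · simp only [nodal, Prod.snd_add, Prod.snd_sum, Prod.smul_snd, smul_add, Finset.sum_add_distrib]
    rw [add_sub_add_comm, smul_add, ← Finset.sum_sub_distrib, Finset.smul_sum]
    simp only [← smul_sub, smul_comm (v _) (κ * _)]
    abel

theorem measurable_nodal [MeasurableSpace Y] [BorelSpace Y] [SecondCountableTopology Y]
    (κ T : ℝ) (k : ℕ) (a : ℕ → ℝ × Y) : Measurable (nodal κ T k a) := by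
  have h1 : Measurable fun t : ℝ => ⌊t * k / T⌋₊ := Nat.measurable_floor.comp (by fun_prop)
  have h2 : ∀ b : ℕ → ℝ × Y, Measurable fun t : ℝ => b ⌊t * k / T⌋₊ := fun b =>
    (measurable_from_nat (f := b)).comp h1
  have h3 : Measurable fun t : ℝ => (⌊t * k / T⌋₊ : ℝ) :=
    (measurable_from_nat (f := fun i : ℕ => (i : ℝ))).comp h1
  refine (h2 a).fst.prodMk ((h2 a).snd.add ?_)
  refine Measurable.smul (by fun_prop) ?_
  exact (h2 fun i => a (i + 1)).snd.sub (h2 a).snd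

/-- Balls are convex, and the second component at time t is a convex combination of two adjacent
nodes. -/
theorem norm_nodal_sub_le (hκ : κ ∈ Icc (0 : ℝ) 1) (hT : 0 < T) {t : ℝ} (ht : 0 ≤ t)
    {a : ℕ → ℝ × Y} {ρ : ℝ} {c : ℝ × Y} (h1 : ‖a ⌊t * k / T⌋₊ - c‖ ≤ ρ)
    (h2 : ‖a (⌊t * k / T⌋₊ + 1) - c‖ ≤ ρ) : ‖nodal κ T k a t - c‖ ≤ ρ := by
  have hx : 0 ≤ t * k / T := by positivity
  have hs : κ * (t * k / T - ⌊t * k / T⌋₊) ∈ Icc (0 : ℝ) 1 := by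
    have l1 := Nat.floor_le hx
    have l2 := (Nat.lt_floor_add_one (t * k / T)).le
    exact ⟨mul_nonneg hκ.1 (by linarith), mul_le_one₀ hκ.2 (by linarith) (by linarith)⟩
  refine norm_prod_le_iff.2 ⟨(norm_fst_le (a ⌊t * k / T⌋₊ - c)).trans h1, ?_⟩
  have m1 : (a ⌊t * k / T⌋₊).2 - c.2 ∈ Metric.closedBall (0 : Y) ρ := by
    rw [mem_closedBall_zero_iff]
    exact (norm_snd_le (a ⌊t * k / T⌋₊ - c)).trans h1
  have m2 : (a (⌊t * k / T⌋₊ + 1)).2 - c.2 ∈ Metric.closedBall (0 : Y) ρ := by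
    rw [mem_closedBall_zero_iff]
    exact (norm_snd_le (a (⌊t * k / T⌋₊ + 1) - c)).trans h2
  have m3 := (convex_closedBall (0 : Y) ρ).add_smul_sub_mem m1 m2 hs
  rw [mem_closedBall_zero_iff, sub_sub_sub_cancel_right] at m3
  simpa [nodal, add_sub_right_comm] using m3

theorem norm_nodal_le (hκ : κ ∈ Icc (0 : ℝ) 1) (hT : 0 < T) {t : ℝ} (ht : 0 ≤ t)
    {a : ℕ → ℝ × Y} {ρ : ℝ} (h : ∀ i, ‖a i‖ ≤ ρ) : ‖nodal κ T k a t‖ ≤ ρ := by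
  have := norm_nodal_sub_le (k := k) hκ hT ht (c := 0) (ρ := ρ) (a := a) (by simpa using h _)
    (by simpa using h _)
  simpa using this

/-- The nodal values of `c`, with prescribed values at the two ends. -/
def sample {Z : Type*} (T : ℝ) (c : ℝ → Z) (z₀ z₁ : Z) (k i : ℕ) : Z :=
  if i = 0 then z₀ else if k ≤ i then z₁ else c (i * T / k)

theorem norm_sample_le {Z : Type*} [NormedAddCommGroup Z] {c : ℝ → Z} {z₀ z₁ : Z} {ρ : ℝ}
    (hc : ∀ t, ‖c t‖ ≤ ρ) (h₀ : ‖z₀‖ ≤ ρ) (h₁ : ‖z₁‖ ≤ ρ) (k i : ℕ) :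
    ‖sample T c z₀ z₁ k i‖ ≤ ρ := by
  unfold sample
  split_ifs
  exacts [h₀, h₁, hc _]

theorem tendsto_nodal_sample (hκ : κ ∈ Icc (0 : ℝ) 1) (hT : 0 < T) {c : ℝ → ℝ × Y}
    (hc : Continuous c) (z₀ z₁ : ℝ × Y) {t : ℝ} (ht : t ∈ Ioo 0 T) :
    Tendsto (fun k : ℕ => nodal κ T k (sample T c z₀ z₁ k) t) atTop (𝓝 (c t)) := by
  rw [Metric.tendsto_atTop]
  intro ε hε
  obtain ⟨δ, hδ, H⟩ := Metric.continuousAt_iff.1 hc.continuousAt (ε / 2) (half_pos hε)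
  -- Cells shorter than η keep both nodes around t within δ of t and away from the two ends, where
  -- the values are prescribed.
  set η := min δ (min t (T - t)) with hη
  have hηpos : 0 < η := lt_min hδ (lt_min ht.1 (sub_pos.2 ht.2))
  obtain ⟨K, hK⟩ := exists_nat_gt (T / η)
  refine ⟨K, fun k hk => ?_⟩
  have hk' : T / η < k := hK.trans_le (by exact_mod_cast hk)
  have hkpos : (0 : ℝ) < k := (by positivity : 0 < T / η).trans hk'
  have hcell : T / k < η := by
    rw [div_lt_iff₀ hkpos]
    rwa [div_lt_iff₀ hηpos, mul_comm] at hk'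
  have hx : 0 ≤ t * k / T := div_nonneg (mul_nonneg ht.1.le hkpos.le) hT.le
  set i := ⌊t * k / T⌋₊ with hi
  have e0 : t * k / T * (T / k) = t := by field_simp
  have l1 : i * (T / k) ≤ t := by
    rw [← e0]
    exact mul_le_mul_of_nonneg_right (Nat.floor_le hx) (by positivity)
  have l2 : t < (i + 1) * (T / k) := by
    conv_lhs => rw [← e0]
    exact mul_lt_mul_of_pos_right (Nat.lt_floor_add_one _) (by positivity)
  have hη1 : η ≤ δ := min_le_left _ _
  have hη2 : η ≤ t := (min_le_right _ _).trans (min_le_left _ _)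
  have hη3 : η ≤ T - t := (min_le_right _ _).trans (min_le_right _ _)
  have hi0 : i ≠ 0 := by
    intro h
    rw [h] at l2
    push_cast at l2
    linarith
  have hik : i + 1 < k := by
    have : ((i : ℝ) + 1) * (T / k) < k * (T / k) := by
      rw [mul_div_cancel₀ _ hkpos.ne']
      linarith
    exact_mod_cast lt_of_mul_lt_mul_right this (by positivity)
  have s1 : ∀ j : ℕ, j ≠ 0 → j < k → |(j : ℝ) * (T / k) - t| < η →
      ‖sample T c z₀ z₁ k j - c t‖ ≤ ε / 2 := by
    intro j h1 h2 h3
    rw [sample, if_neg h1, if_neg (not_le.2 h2), mul_div_assoc, ← dist_eq_norm]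
    exact (H (by rw [Real.dist_eq]; exact h3.trans_le hη1)).le
  rw [dist_eq_norm]
  refine lt_of_le_of_lt (norm_nodal_sub_le hκ hT ht.1.le (ρ := ε / 2) ?_ ?_) (half_lt_self hε)
  · refine s1 i hi0 (by omega) ?_
    rw [abs_lt]
    constructor <;> linarith
  · refine s1 (i + 1) (by omega) hik ?_
    push_cast
    rw [abs_lt]
    constructor <;> linarith

end Nodal

/-! ### L² approximation by nodal controls -/

section Approximation

theorem coeFn_sum_controlL2 {Z : Type*} [NormedAddCommGroup Z] {ι : Type*} (s : Finset ι)
    (l : ι → ControlL2 Z) : ∀ᵐ t, (∑ j ∈ s, l j : ControlL2 Z) t = ∑ j ∈ s, l j t := by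
  classical
  induction s using Finset.induction_on with
  | empty =>
    simp
  | insert i s hi ih =>
    simp only [Finset.sum_insert hi]
    filter_upwards [ih, Lp.coeFn_add (l i) (∑ j ∈ s, l j)] with t h1 h2
    rw [h2, Pi.add_apply, h1]

/-- An essentially bounded `L²` function is approximated by continuous functions with the same
bound. -/
theorem exists_continuous_near {Z : Type*} [NormedAddCommGroup Z] [NormedSpace ℝ Z]
    {h : ControlL2 Z} {ρ : ℝ} (hρ : 0 < ρ) (hh : EssBoundedBy ρ h) {ε : ℝ≥0∞} (hε : ε ≠ 0) :
    ∃ c : ℝ → Z, Continuous c ∧ (∀ t, ‖c t‖ ≤ ρ) ∧ eLpNorm (fun t => c t - h t) 2 volume ≤ ε := by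
  obtain ⟨c, -, hc, hcont, -⟩ := (Lp.memLp h).exists_hasCompactSupport_eLpNorm_sub_le (by simp)
    (ENNReal.div_ne_zero.2 ⟨hε, ENNReal.ofNat_ne_top⟩ : ε / 2 ≠ 0)
  have hpos : ∀ t, 0 < max ρ ‖c t‖ := fun t => hρ.trans_le (le_max_left _ _)
  -- Radial retraction onto the ball of radius ρ. As h lies in this ball almost everywhere, c is
  -- moved by at most ‖c - h‖; the error at most doubles, hence the ε / 2 above.
  refine ⟨fun t => (ρ / max ρ ‖c t‖) • c t, ?_, fun t => ?_, ?_⟩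
  · exact (continuous_const.div (continuous_const.max hcont.norm) fun t => (hpos t).ne').smul hcont
  · rw [norm_smul, Real.norm_of_nonneg (div_nonneg hρ.le (hpos t).le), div_mul_eq_mul_div,
      div_le_iff₀ (hpos t)]
    gcongr
    exact le_max_right _ _
  · have key : ∀ᵐ t, ‖(ρ / max ρ ‖c t‖) • c t - h t‖ ≤ 2 * ‖(⇑h - c) t‖ := by
      filter_upwards [hh] with t ht
      have h1 : ‖(ρ / max ρ ‖c t‖) • c t - c t‖ ≤ ‖(⇑h - c) t‖ := by
        have e : (ρ / max ρ ‖c t‖) • c t - c t = -((1 - ρ / max ρ ‖c t‖) • c t) := by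
          rw [sub_smul, one_smul]; abel
        have h2 : ρ / max ρ ‖c t‖ ≤ 1 := (div_le_one (hpos t)).2 (le_max_left _ _)
        rw [e, norm_neg, norm_smul, Real.norm_of_nonneg (by linarith), Pi.sub_apply, norm_sub_rev]
        have h3 : ‖c t‖ - ‖h t‖ ≤ ‖c t - h t‖ := norm_sub_norm_le _ _
        rcases le_total ‖c t‖ ρ with h4 | h4
        · rw [max_eq_left h4, div_self hρ.ne']
          simp
        · have h5 : 0 < ‖c t‖ := hρ.trans_le h4
          rw [max_eq_right h4, sub_mul, div_mul_cancel₀ _ h5.ne', one_mul]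
          linarith
      calc ‖(ρ / max ρ ‖c t‖) • c t - h t‖
          = ‖((ρ / max ρ ‖c t‖) • c t - c t) - (⇑h - c) t‖ := by
            rw [Pi.sub_apply]; congr 1; abel
        _ ≤ ‖(⇑h - c) t‖ + ‖(⇑h - c) t‖ := (norm_sub_le _ _).trans (by gcongr)
        _ = 2 * ‖(⇑h - c) t‖ := by ring
    refine (eLpNorm_le_mul_eLpNorm_of_ae_le_mul key 2).trans ?_
    calc ENNReal.ofReal 2 * eLpNorm (⇑h - c) 2 volume ≤ 2 * (ε / 2) := by
          gcongr
          simp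
      _ = ε := ENNReal.mul_div_cancel (by simp) (by simp)

variable {Y : Type*} [NormedAddCommGroup Y] [NormedSpace ℝ Y] [FiniteDimensional ℝ Y]
  {κ T : ℝ}

theorem aestronglyMeasurable_nodal (κ T : ℝ) (k : ℕ) (a : ℕ → ℝ × Y) (μ : Measure ℝ) :
    AEStronglyMeasurable (nodal κ T k a) μ := by
  let _ : MeasurableSpace Y := borel Y
  have : BorelSpace Y := ⟨rfl⟩
  have : ProperSpace Y := FiniteDimensional.proper_real Y
  exact (measurable_nodal κ T k a).aestronglyMeasurable

/-- Dominated convergence with bound 2ρ: prescribing the end nodes does not disturb pointwise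
convergence in the open interval. -/
theorem tendsto_eLpNorm_nodal_sample (hκ : κ ∈ Icc (0 : ℝ) 1) (hT : 0 < T) {c : ℝ → ℝ × Y}
    (hc : Continuous c) {ρ : ℝ} (hcρ : ∀ t, ‖c t‖ ≤ ρ) {z₀ z₁ : ℝ × Y} (h₀ : ‖z₀‖ ≤ ρ)
    (h₁ : ‖z₁‖ ≤ ρ) :
    Tendsto (fun k : ℕ => eLpNorm (fun t => nodal κ T k (sample T c z₀ z₁ k) t - c t) 2
      (volume.restrict (Ioo 0 T))) atTop (𝓝 0) := by
  have hρ : 0 ≤ ρ := (norm_nonneg _).trans h₀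
  have h := tendsto_lintegral_of_dominated_convergence' (μ := volume.restrict (Ioo 0 T))
    (F := fun (k : ℕ) t => ‖nodal κ T k (sample T c z₀ z₁ k) t - c t‖ₑ ^ (2 : ℝ))
    (f := fun _ => 0) (fun _ => ENNReal.ofReal (ρ + ρ) ^ (2 : ℝ))
    (fun k => (((aestronglyMeasurable_nodal κ T k _ _).sub
      hc.aestronglyMeasurable).enorm).pow_const _) ?_ ?_ ?_
  · have h2 : Tendsto (fun x : ℝ≥0∞ => x ^ (1 / (2 : ℝ))) (𝓝 0) (𝓝 0) := by
      have := (ENNReal.continuous_rpow_const (y := 1 / (2 : ℝ))).tendsto 0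
      rwa [ENNReal.zero_rpow_of_pos (by norm_num)] at this
    rw [lintegral_zero] at h
    refine (h2.comp h).congr fun k => ?_
    rw [eLpNorm_eq_lintegral_rpow_enorm_toReal (by simp) (by simp)]
    simp
  · refine fun k => (ae_restrict_iff' measurableSet_Ioo).2 (Eventually.of_forall fun t ht => ?_)
    simp only
    gcongr
    rw [← ofReal_norm]
    refine ENNReal.ofReal_le_ofReal ((norm_sub_le _ _).trans (add_le_add ?_ (hcρ t)))
    exact norm_nodal_le hκ hT ht.1.le (norm_sample_le hcρ h₀ h₁ k)
  · rw [lintegral_const]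
    refine ENNReal.mul_ne_top (ENNReal.rpow_ne_top_of_nonneg (by norm_num) ENNReal.ofReal_ne_top) ?_
    simp
  · refine (ae_restrict_iff' measurableSet_Ioo).2 (Eventually.of_forall fun t ht => ?_)
    have h1 := (tendsto_nodal_sample hκ hT hc z₀ z₁ ht).sub_const (c t)
    rw [sub_self] at h1
    have h2 := (ENNReal.continuous_rpow_const (y := (2 : ℝ))).tendsto ‖(0 : ℝ × Y)‖ₑ
    have h3 := h2.comp h1.enorm
    simpa [Function.comp_def] using h3

/-- Every essentially bounded control is approximated by nodal controls with prescribed end nodes. -/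
theorem eventually_exists_nodal_near (hκ : κ ∈ Icc (0 : ℝ) 1) (hT : 0 < T)
    {h : ControlL2 (ℝ × Y)} {ρ : ℝ} (hρ : 0 < ρ) (hh : EssBoundedBy ρ h) {z₀ z₁ : ℝ × Y}
    (h₀ : ‖z₀‖ ≤ ρ) (h₁ : ‖z₁‖ ≤ ρ) {ε : ℝ} (hε : 0 < ε) :
    ∀ᶠ k : ℕ in atTop, ∃ (a : ℕ → ℝ × Y) (b : ControlL2 (ℝ × Y)), a 0 = z₀ ∧ a k = z₁ ∧
      dist b h < ε ∧ EssBoundedBy ρ b ∧ ∀ᵐ t, t ∈ Ioo 0 T → b t = nodal κ T k a t := by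
  have hε' : ENNReal.ofReal (ε / 2) ≠ 0 := by
    rw [Ne, ENNReal.ofReal_eq_zero, not_le]
    exact half_pos hε
  obtain ⟨c, hc, hcρ, hch⟩ := exists_continuous_near hρ hh hε'
  have hlim := tendsto_eLpNorm_nodal_sample hκ hT hc hcρ h₀ h₁
  filter_upwards [hlim.eventually (gt_mem_nhds (pos_iff_ne_zero.2 hε')), eventually_ge_atTop 1]
    with k hk hk1
  set a := sample T c z₀ z₁ k with ha
  set d : ℝ → ℝ × Y := (Ioo 0 T).indicator fun t => nodal κ T k a t - h t with hd
  have hdm : AEStronglyMeasurable d volume :=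
    ((aestronglyMeasurable_nodal κ T k a _).sub (Lp.aestronglyMeasurable h)).indicator
      measurableSet_Ioo
  have hdn : eLpNorm d 2 volume < ENNReal.ofReal ε := by
    rw [hd, eLpNorm_indicator_eq_eLpNorm_restrict measurableSet_Ioo]
    have e : (fun t => nodal κ T k a t - h t)
        = (fun t => nodal κ T k a t - c t) + fun t => c t - h t := by
      ext1 t
      simp
    rw [e]
    refine (eLpNorm_add_le ((aestronglyMeasurable_nodal κ T k a _).sub hc.aestronglyMeasurable)
      (hc.aestronglyMeasurable.sub (Lp.aestronglyMeasurable h).restrict) (by norm_num)).trans_lt ?_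
    have h2 : eLpNorm (fun t => c t - h t) 2 (volume.restrict (Ioo 0 T)) ≤ ENNReal.ofReal (ε / 2) :=
      (eLpNorm_mono_measure _ Measure.restrict_le_self).trans hch
    refine (ENNReal.add_lt_add_of_lt_of_le (h2.trans_lt ENNReal.ofReal_lt_top).ne hk h2).trans_eq ?_
    rw [← ENNReal.ofReal_add (half_pos hε).le (half_pos hε).le, add_halves]
  have hdL : MemLp d 2 volume := ⟨hdm, hdn.trans ENNReal.ofReal_lt_top⟩
  have hb : ∀ᵐ t, (h + hdL.toLp : ControlL2 (ℝ × Y)) t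
      = if t ∈ Ioo 0 T then nodal κ T k a t else h t := by
    filter_upwards [Lp.coeFn_add h hdL.toLp, hdL.coeFn_toLp] with t h1 h2
    rw [h1, Pi.add_apply, h2, hd]
    by_cases ht : t ∈ Ioo 0 T
    · rw [indicator_of_mem ht, if_pos ht, add_sub_cancel]
    · rw [indicator_of_notMem ht, if_neg ht, add_zero]
  refine ⟨a, h + hdL.toLp, ?_, ?_, ?_, ?_, ?_⟩
  · simp [ha, sample]
  · have : k ≠ 0 := by omega
    simp [ha, sample, this]
  · rw [dist_self_add_left, Lp.norm_toLp]
    exact ENNReal.toReal_lt_of_lt_ofReal hdn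
  · filter_upwards [hb, hh] with t h1 h2
    rw [h1]
    split_ifs with ht
    · exact norm_nodal_le hκ hT ht.1.le (norm_sample_le hcρ h₀ h₁ k)
    · exact h2
  · filter_upwards [hb] with t h1 ht
    rw [h1, if_pos ht]

end Approximation

/-! ### Exact steering by nodal controls -/

section NodalSolution

variable {E : Type*} [NormedAddCommGroup E] [NormedSpace ℝ E] [FiniteDimensional ℝ E]
  {Y : Type*} [NormedAddCommGroup Y] [NormedSpace ℝ Y] [FiniteDimensional ℝ Y]
  {M : Type*} [TopologicalSpace M] [ChartedSpace E M] [IsManifold 𝓘(ℝ, E) ∞ M] [T2Space M]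
  {g : (x : M) → ℝ × Y → TangentSpace 𝓘(ℝ, E) x} {κ : ℝ}

/-- If every point is reached from every other one with an essentially bounded control, then every
point is reached from every point with a nodal control whose end nodes are prescribed. -/
theorem exists_nodal_solution (hg : IsSmoothControlled g)
    (hreach : ∀ x q : M, q ≠ x → ∃ w ∈ boundedControls (ℝ × Y), ∃ γ,
      IsSolution g w 0 1 γ ∧ γ 0 = x ∧ γ 1 = q) (hκ : κ ∈ Icc (0 : ℝ) 1) (x₀ q : M)
    (z₀ z₁ : ℝ × Y) :
    ∃ (T : ℝ) (k : ℕ) (a : ℕ → ℝ × Y) (γ : ℝ → M), 0 < T ∧ 0 < k ∧ a 0 = z₀ ∧ a k = z₁ ∧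
      IsSolution g (nodal κ T k a) 0 T γ ∧ γ 0 = x₀ ∧ γ T = q := by
  -- The lower bound on ρ makes room for the prescribed end nodes and keeps ρ positive.
  obtain ⟨T, ρ, w, φ, l, hT, hρ, hw, hφ, hφw, hl, hsurj⟩ :=
    exists_regular_endpoint hg hreach x₀ q (max ‖z₀‖ ‖z₁‖ + 1)
  have hρ₀ : ‖z₀‖ ≤ ρ := by linarith [le_max_left ‖z₀‖ ‖z₁‖]
  have hρ₁ : ‖z₁‖ ≤ ρ := by linarith [le_max_right ‖z₀‖ ‖z₁‖]
  have hρpos : 0 < ρ := by linarith [norm_nonneg z₀, le_max_left ‖z₀‖ ‖z₁‖]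
  choose c₀ hc₀ using hl
  set c := fun j => max (c₀ j) 1 with hcdef
  have hc : ∀ j, EssBoundedBy (c j) (l j) := fun j => (hc₀ j).mono (le_max_left _ _)
  have hcpos : ∀ j, 0 < c j := fun j => one_pos.trans_le (le_max_right _ _)
  set U : Set ((ControlL2 (ℝ × Y) × (Fin (Module.finrank ℝ E) → ControlL2 (ℝ × Y))) ×
    (Fin (Module.finrank ℝ E) → ℝ)) :=
    {q' | IsEndpointChart (cutoff g (ρ + 1)) T x₀ q (q'.1.1 + ∑ j, q'.2 j • q'.1.2 j) φ ∧
      ∑ j, |q'.2 j| * c j < 1} with hU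
  have hUn : U ∈ 𝓝 ((w, l), 0) := by
    refine inter_mem ?_ ?_
    · have h1 : Continuous fun q' : (ControlL2 (ℝ × Y) × (Fin (Module.finrank ℝ E) →
          ControlL2 (ℝ × Y))) × (Fin (Module.finrank ℝ E) → ℝ) =>
          q'.1.1 + ∑ j, q'.2 j • q'.1.2 j := by fun_prop
      have h2 := h1.tendsto ((w, l), 0)
      simp only [Pi.zero_apply, zero_smul, Finset.sum_const_zero, add_zero] at h2
      exact h2.eventually hφ.eventually
    · have h1 : Continuous fun q' : (ControlL2 (ℝ × Y) × (Fin (Module.finrank ℝ E) →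
          ControlL2 (ℝ × Y))) × (Fin (Module.finrank ℝ E) → ℝ) => ∑ j, |q'.2 j| * c j := by
        fun_prop
      exact h1.continuousAt.eventually (gt_mem_nhds (by simp))
  have hhit := eventually_exists_apply_add_sum_smul_eq hφ.1 (l := l) (fun z => by
    obtain ⟨v, hv⟩ := hsurj z
    refine ⟨v, ?_⟩
    rwa [ContinuousLinearMap.comp_apply, superpose_apply] at hv) hUn
  obtain ⟨ε, hε, hball⟩ := Metric.eventually_nhds_iff.1 hhit
  have e1 := eventually_exists_nodal_near hκ hT hρpos hw hρ₀ hρ₁ hε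
  -- The directions get zero end nodes, so that the correction does not alter z₀ and z₁.
  have e2 := eventually_all.2 fun j => eventually_exists_nodal_near hκ hT (hcpos j) (hc j)
    (z₀ := 0) (z₁ := 0) (by simpa using (hcpos j).le) (by simpa using (hcpos j).le) hε
  obtain ⟨k, ⟨⟨a, b, ha0, hak, hb, hbρ, hbn⟩, h2⟩, hk⟩ :=
    ((e1.and e2).and (eventually_gt_atTop 0)).exists
  choose a' b' ha0' hak' hb' hbρ' hbn' using h2
  obtain ⟨v, ⟨hch, hv⟩, hφv⟩ := hball (y := (b, b')) (by
    rw [Prod.dist_eq, max_lt_iff]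
    exact ⟨hb, (dist_pi_lt_iff hε).2 hb'⟩)
  simp only at hch hv hφv
  obtain ⟨γ, hγ, hγ0, hγq, hγφ⟩ := hch.2.self_of_nhds
  -- The correction is bounded by 1 through the second condition in `U`, so the cutoff at ρ + 1 is
  -- inactive and the curve solves the original system.
  have hbd : EssBoundedBy (ρ + 1) (b + ∑ j, v j • b' j) :=
    (hbρ.add (EssBoundedBy.sum _ fun j _ => (hbρ' j).smul (v j))).mono (by linarith)
  have hγg := (isSolution_cutoff_iff (ae_restrict_of_ae hbd)).1 hγ
  refine ⟨T, k, fun i => a i + ∑ j, v j • a' j i, γ, hT, hk, by simp [ha0, ha0'],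
    by simp [hak, hak'], hγg.congr_control ?_, hγ0, ?_⟩
  · have h0 : ∀ᵐ t : ℝ, t ≠ 0 := by simp [ae_iff, measure_singleton]
    have hT' : ∀ᵐ t : ℝ, t ≠ T := by simp [ae_iff, measure_singleton]
    have hsum : ∀ᵐ t, (∑ j, v j • b' j : ControlL2 (ℝ × Y)) t = ∑ j, v j • b' j t := by
      have h3 : ∀ᵐ t, ∀ j, (v j • b' j : ControlL2 (ℝ × Y)) t = v j • b' j t :=
        ae_all_iff.2 fun j => Lp.coeFn_smul _ _
      filter_upwards [coeFn_sum_controlL2 Finset.univ fun j => v j • b' j, h3] with t h4 h5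
      rw [h4]
      exact Finset.sum_congr rfl fun j _ => h5 j
    refine (ae_restrict_iff' measurableSet_Icc).2 ?_
    filter_upwards [h0, hT', hsum, Lp.coeFn_add b (∑ j, v j • b' j), hbn, ae_all_iff.2 hbn']
      with t k1 k2 k3 k4 k5 k6 ht
    have ht' : t ∈ Ioo 0 T := ⟨lt_of_le_of_ne ht.1 k1.symm, lt_of_le_of_ne ht.2 k2⟩
    rw [k4, Pi.add_apply, k3, k5 ht', nodal_add_sum_smul]
    simp only [k6 _ ht']
  · refine (extChartAt 𝓘(ℝ, E) q).injOn hγq (mem_extChartAt_source q) ?_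
    rw [hγφ, hφv, hφw]

end NodalSolution

/-! ### Concatenation of trajectories -/

section Reachability

variable {E : Type*} [NormedAddCommGroup E] [NormedSpace ℝ E]
  {H : Type*} [TopologicalSpace H] {I : ModelWithCorners ℝ E H}
  {N : Type*} [TopologicalSpace N] [ChartedSpace H N] {U : Type*}
  {F : (x : N) → U → TangentSpace I x}

theorem IsPiecewiseConstant.concat {T T' : ℝ} {u u' : ℝ → U} (h : IsPiecewiseConstant T u)
    (h' : IsPiecewiseConstant T' u') :
    IsPiecewiseConstant (T + T') (fun t => if t < T then u t else u' (t - T)) := by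
  obtain ⟨k, τ, h0, hk, hlt, hc⟩ := h
  obtain ⟨k', τ', h0', hk', hlt', hc'⟩ := h'
  have hmono : ∀ i ≤ k, τ i ≤ T := by
    intro i hi
    rw [← hk]
    induction hi using Nat.decreasingInduction with
    | of_succ i hi ih => exact (hlt i hi).le.trans ih
    | self => exact le_rfl
  have hnn : ∀ i ≤ k', 0 ≤ τ' i := by
    intro i
    induction i with
    | zero => intro _; exact h0'.ge
    | succ i ih => intro hi; exact (ih (by omega)).trans (hlt' i (by omega)).le
  -- The index k already belongs to the shifted second partition; both descriptions of its
  -- breakpoint agree because τ' 0 = 0 and τ k = T.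
  refine ⟨k + k', fun i => if i < k then τ i else T + τ' (i - k), ?_, ?_, fun i hi => ?_,
    fun i hi t ht => ?_⟩
  · by_cases hk0 : 0 < k
    · simp [hk0, h0]
    · obtain rfl : k = 0 := by omega
      simp [h0', ← hk, h0]
  · simp [hk']
  · by_cases h1 : i < k
    · by_cases h2 : i + 1 < k
      · simp only [h1, h2, if_true]
        exact hlt i h1
      · obtain rfl : k = i + 1 := by omega
        simp only [h1, lt_irrefl, if_true, if_false, Nat.sub_self, h0', add_zero]
        rw [← hk]
        exact hlt i h1
    · have h2 : ¬ i + 1 < k := by omega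
      have h3 : i + 1 - k = i - k + 1 := by omega
      simp only [h1, h2, if_false, h3]
      gcongr
      exact hlt' _ (by omega)
  · by_cases h1 : i < k
    · have e1 : (if i < k then τ i else T + τ' (i - k)) = τ i := if_pos h1
      have e2 : (if i + 1 < k then τ (i + 1) else T + τ' (i + 1 - k)) = τ (i + 1) := by
        by_cases h2 : i + 1 < k
        · exact if_pos h2
        · obtain rfl : k = i + 1 := by omega
          simp [h0', hk]
      simp only [e1, e2] at ht ⊢
      have h3 : t < T := ht.2.trans_le (hmono _ h1)
      rw [if_pos h3, if_pos (ht.1.trans_lt h3)]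
      exact hc i h1 t ht
    · have e1 : (if i < k then τ i else T + τ' (i - k)) = T + τ' (i - k) := if_neg h1
      have e2 : (if i + 1 < k then τ (i + 1) else T + τ' (i + 1 - k)) = T + τ' (i - k + 1) := by
        rw [if_neg (by omega), show i + 1 - k = i - k + 1 by omega]
      simp only [e1, e2] at ht ⊢
      have h3 := hnn (i - k) (by omega)
      rw [if_neg (by linarith [ht.1]), if_neg (by linarith), add_sub_cancel_left]
      exact hc' _ (by omega) _ ⟨by linarith [ht.1], by linarith [ht.2]⟩

theorem mem_reachableSet_trans {x₀ x₁ x₂ : N} (h : x₁ ∈ reachableSet I F x₀)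
    (h' : x₂ ∈ reachableSet I F x₁) : x₂ ∈ reachableSet I F x₀ := by
  obtain ⟨T, u, γ, hT, hu, hγ, hγ0, hγT⟩ := h
  obtain ⟨T', u', γ', hT', hu', hγ', hγ'0, hγ'T⟩ := h'
  have k1 := HasVelocityOn.comp_affine hγ' (α := 1) (β := -T) one_pos (a' := T) (b' := T + T')
    (by linarith) (by linarith)
  have k2 := HasVelocityOn.glue (isTrajectory_iff_hasVelocityOn.1 hγ) k1 hT (by linarith)
    (by rw [hγT, ← hγ'0]; congr 1; ring)
  refine ⟨T + T', _, _, by linarith, hu.concat hu', isTrajectory_iff_hasVelocityOn.2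
    (HasVelocityOn.congr_velocity k2 ?_), ?_, ?_⟩
  -- The glued curve switches after T and the control at T; the mismatch is confined to one instant.
  · have ha : ∀ᵐ t : ℝ, t ≠ T := by simp [ae_iff, measure_singleton]
    refine ae_restrict_of_ae ?_
    filter_upwards [ha] with t ht
    rcases lt_or_gt_of_ne ht with h | h
    · have e1 : (if t ≤ T then γ t else γ' (1 * t + -T)) = γ t := if_pos h.le
      have e2 : (if t < T then u t else u' (t - T)) = u t := if_pos h
      exact (if_pos (α := E) h.le).trans (congrArg₂ (fun y c => (F y c : E)) e1.symm e2.symm)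
    · have e1 : (if t ≤ T then γ t else γ' (1 * t + -T)) = γ' (1 * t + -T) := if_neg (not_le.2 h)
      have e2 : (if t < T then u t else u' (t - T)) = u' (1 * t + -T) := by
        rw [if_neg (not_lt.2 h.le), one_mul, ← sub_eq_add_neg]
      exact ((if_neg (α := E) (not_le.2 h)).trans (one_smul ℝ _)).trans
        (congrArg₂ (fun y c => (F y c : E)) e1.symm e2.symm)
  · simp [hT, hγ0]
  · rcases hT'.eq_or_lt with rfl | h
    · simp [hγT, ← hγ'T, hγ'0]
    · simp [h, hγ'T]

theorem mem_reachableSet_of_const {T : ℝ} (hT : 0 < T) {γ : ℝ → N} {c : U}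
    (h : HasVelocityOn I 0 T γ (fun t => F (γ t) c)) : γ T ∈ reachableSet I F (γ 0) :=
  ⟨T, fun _ => c, γ, hT.le, ⟨1, fun i => i * T, by simp, by simp, fun i hi => by
    push_cast; linarith, fun _ _ _ _ => rfl⟩, h, rfl, rfl⟩

/-- A chain of points, each reachable from the preceding one. -/
theorem mem_reachableSet_of_chain {k : ℕ} (hk : 0 < k) {z : ℕ → N}
    (h : ∀ i < k, z (i + 1) ∈ reachableSet I F (z i)) : z k ∈ reachableSet I F (z 0) := by
  obtain ⟨k, rfl⟩ := Nat.exists_eq_succ_of_ne_zero hk.ne'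
  have key : ∀ i ≤ k, z (i + 1) ∈ reachableSet I F (z 0) := by
    intro i
    induction i with
    | zero => intro _; exact h 0 hk
    | succ i ih => intro hi; exact mem_reachableSet_trans (ih (by omega)) (h _ (by omega))
  exact key k le_rfl

end Reachability

/-! ### Curves in the product with the control space -/

section ExtensionCurves

variable {E : Type*} [NormedAddCommGroup E] [NormedSpace ℝ E]
  {H : Type*} [TopologicalSpace H] {I : ModelWithCorners ℝ E H}
  {N : Type*} [TopologicalSpace N] [ChartedSpace H N] {m : ℕ}

theorem extChartAt_prod_source_eq (p : N) (y : ControlSpace m) :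
    (extChartAt (I.prod (𝓡 m)) (p, y)).source = (extChartAt I p).source ×ˢ univ := by
  rw [extChartAt_prod, PartialEquiv.prod_source, extChartAt_model_space_eq_id,
    PartialEquiv.refl_source]

theorem extChartAt_prod_apply (p : N) (y : ControlSpace m) (q : N × ControlSpace m) :
    extChartAt (I.prod (𝓡 m)) (p, y) q = (extChartAt I p q.1, q.2) := by
  rw [extChartAt_prod, PartialEquiv.prod_coe, extChartAt_model_space_eq_id,
    PartialEquiv.refl_coe]
  rfl

theorem HasVelocityOn.fst {a b : ℝ} {z : ℝ → N × ControlSpace m} {v : ℝ → E × ControlSpace m}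
    (h : HasVelocityOn (I.prod (𝓡 m)) a b z v) :
    HasVelocityOn I a b (fun t => (z t).1) (fun t => (v t).1 : ℝ → E) := by
  refine ⟨⟨h.1.1.fst, fun p c d h1 h2 h3 hm => ?_⟩, ?_⟩
  -- Every chart of the second factor is the identity, so the base point 0 is arbitrary.
  · have k1 := h.1.2 (p, 0) c d h1 h2 h3 fun t ht => by
      rw [extChartAt_prod_source_eq]
      exact ⟨hm ht, mem_univ _⟩
    have k2 := (LipschitzWith.prod_fst (α := E) (β := ControlSpace m)).lipschitzOnWith (s := univ)
      |>.comp_absolutelyContinuousOnInterval k1 (mapsTo_univ _ _)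
    refine k2.congr fun t _ => ?_
    simp only [extChartAt_prod_apply]
  · filter_upwards [h.2] with t ht
    have h1 : HasMFDerivAt (I.prod (𝓡 m)) I (Prod.fst : N × ControlSpace m → N) (z t)
        (ContinuousLinearMap.fst ℝ (TangentSpace I (z t).1) (TangentSpace (𝓡 m) (z t).2)) :=
      hasMFDerivAt_fst _
    refine (h1.comp t ht).congr_mfderiv ?_
    ext
    rfl

theorem HasVelocityOn.prodMk_affine {a b : ℝ} {γ : ℝ → N} {v : ℝ → E}
    (h : HasVelocityOn I a b γ v) (y₀ d : ControlSpace m) :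
    HasVelocityOn (I.prod (𝓡 m)) a b (fun t => (γ t, y₀ + t • d))
      (fun t => (v t, d) : ℝ → E × ControlSpace m) := by
  have hLip : LipschitzWith ‖d‖₊ fun t : ℝ => y₀ + t • d := by
    refine LipschitzWith.of_dist_le_mul fun s t => ?_
    rw [dist_add_left, dist_eq_norm, ← sub_smul, norm_smul, coe_nnnorm, mul_comm, Real.dist_eq,
      Real.norm_eq_abs]
  refine ⟨⟨h.1.1.prodMk hLip.continuous.continuousOn, fun p c e h1 h2 h3 hm => ?_⟩, ?_⟩
  · have k1 := h.1.2 p.1 c e h1 h2 h3 fun t ht => by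
      have := hm ht
      rw [← Prod.mk.eta (p := p), extChartAt_prod_source_eq] at this
      exact this.1
    have k2 : AbsolutelyContinuousOnInterval (fun t : ℝ => y₀ + t • d) c e :=
      hLip.lipschitzOnWith.absolutelyContinuousOnInterval
    refine (k1.prodMk k2).congr fun t _ => ?_
    rw [← Prod.mk.eta (p := p), extChartAt_prod_apply]
  · filter_upwards [h.2] with t ht
    have k1 : HasMFDerivAt 𝓘(ℝ, ℝ) (𝓡 m) (fun t : ℝ => y₀ + t • d) t
        ((1 : ℝ →L[ℝ] ℝ).smulRight d) := by
      have : HasDerivAt (fun t : ℝ => y₀ + t • d) d t :=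
        (((hasDerivAt_id t).smul_const d).const_add y₀).congr_deriv (one_smul ℝ d)
      exact (this.hasFDerivAt.congr_fderiv (by
        ext1
        exact (one_smul ℝ d).trans (one_smul ℝ d).symm)).hasMFDerivAt
    refine (ht.prodMk k1).congr_mfderiv ?_
    ext
    · rfl
    · rfl

end ExtensionCurves

/-! ### Speed as an additional control -/

section Timed

variable {E : Type*} [NormedAddCommGroup E] [NormedSpace ℝ E]
  {M : Type*} [TopologicalSpace M] [ChartedSpace E M] {m : ℕ}
  {f : (x : M) → ControlSpace m → TangentSpace 𝓘(ℝ, E) x}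

/-- The system `ẋ = exp σ • f(x, u)` with control `(σ, u)`: the speed at which the trajectories of
`f` are traversed becomes a control. -/
def timed (f : (x : M) → ControlSpace m → TangentSpace 𝓘(ℝ, E) x) (x : M)
    (w : ℝ × ControlSpace m) : TangentSpace 𝓘(ℝ, E) x :=
  (Real.exp w.1 • (f x w.2 : E) : E)

theorem IsSmoothControlled.timed [IsManifold 𝓘(ℝ, E) ∞ M] (hf : IsSmoothControlled f) :
    IsSmoothControlled (timed f) :=
  (hf.comp (P' := ℝ × ControlSpace m) contDiff_snd).smul (Real.contDiff_exp.comp contDiff_fst)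

/-- Rescaling time to `[0, 1]`. -/
theorem exists_isSolution_timed {T : ℝ} (hT : 0 < T) {γ : ℝ → M} {u : ℝ → ControlSpace m} {c : ℝ}
    (hu : AEStronglyMeasurable u (volume.restrict (Icc 0 T)))
    (hc : ∀ᵐ t ∂(volume.restrict (Icc 0 T)), ‖u t‖ ≤ c)
    (h : HasVelocityOn 𝓘(ℝ, E) 0 T γ (fun t => f (γ t) (u t))) :
    ∃ w ∈ boundedControls (ℝ × ControlSpace m), ∃ γ', IsSolution (timed f) w 0 1 γ' ∧
      γ' 0 = γ 0 ∧ γ' 1 = γ T := by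
  have hq : Measure.QuasiMeasurePreserving (fun t : ℝ => T * t) volume volume := by
    refine ⟨measurable_const_mul T, ?_⟩
    rw [Real.map_volume_mul_left hT.ne']
    exact Measure.smul_absolutelyContinuous
  set ũ := (Icc 0 T).indicator u with hũ
  have hũm : AEStronglyMeasurable ũ volume :=
    (aestronglyMeasurable_indicator_iff measurableSet_Icc).2 hu
  have hũc : ∀ᵐ t, ‖ũ t‖ ≤ max c 0 := by
    filter_upwards [(ae_restrict_iff' measurableSet_Icc).1 hc] with t ht
    by_cases h : t ∈ Icc 0 T
    · rw [hũ, indicator_of_mem h]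
      exact (ht h).trans (le_max_left _ _)
    · rw [hũ, indicator_of_notMem h, norm_zero]
      exact le_max_right _ _
  -- The constant speed control log T traverses [0, T] in unit time; vanishing outside [0, 1] puts
  -- the control in L².
  set w : ℝ → ℝ × ControlSpace m := (Icc (0 : ℝ) 1).indicator fun s => (Real.log T, ũ (T * s))
    with hw
  have hwc : ∀ᵐ s, ‖w s‖ ≤ max |Real.log T| (max c 0) := by
    filter_upwards [hq.ae hũc] with s hs
    by_cases h : s ∈ Icc (0 : ℝ) 1
    · rw [hw, indicator_of_mem h, Prod.norm_def]
      exact max_le_max le_rfl hs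
    · rw [hw, indicator_of_notMem h, norm_zero]
      exact (abs_nonneg _).trans (le_max_left _ _)
  have hwm : AEStronglyMeasurable (fun s => (Real.log T, ũ (T * s))) volume :=
    aestronglyMeasurable_const.prodMk (hũm.comp_quasiMeasurePreserving hq)
  have hwL : MemLp w 2 volume := by
    rw [hw, memLp_indicator_iff_restrict measurableSet_Icc]
    refine MemLp.of_bound hwm.restrict (max |Real.log T| (max c 0)) ?_
    refine (ae_restrict_iff' measurableSet_Icc).2 ?_
    filter_upwards [hwc] with s hs hs'
    rwa [hw, indicator_of_mem hs'] at hs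
  refine ⟨hwL.toLp, ⟨max |Real.log T| (max c 0), ?_⟩, fun s => γ (T * s + 0), ?_, by simp, by simp⟩
  · filter_upwards [hwL.coeFn_toLp, hwc] with s h1 h2
    rwa [h1]
  · have k1 := HasVelocityOn.comp_affine h hT (β := 0) (a' := 0) (b' := 1) (by simp) (by simp)
    refine HasVelocityOn.congr_velocity k1 ?_
    refine (ae_restrict_iff' measurableSet_Icc).2 ?_
    filter_upwards [hwL.coeFn_toLp] with s h1 hs
    have h2 : T * s ∈ Icc 0 T := ⟨mul_nonneg hT.le hs.1, mul_le_of_le_one_right hT.le hs.2⟩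
    rw [h1, hw, indicator_of_mem hs, timed, Real.exp_log hT, hũ, indicator_of_mem h2]
    simp only [add_zero]
    rfl

theorem IsPiecewiseConstant.aestronglyMeasurable_and_bounded {Z : Type*} [NormedAddCommGroup Z]
    {T : ℝ} {u : ℝ → Z} (h : IsPiecewiseConstant T u) :
    AEStronglyMeasurable u (volume.restrict (Icc 0 T)) ∧
      ∃ c, ∀ᵐ t ∂(volume.restrict (Icc 0 T)), ‖u t‖ ≤ c := by
  obtain ⟨k, τ, h0, rfl, hlt, hc⟩ := h
  have key : ∀ i ≤ k, 0 ≤ τ i ∧ AEStronglyMeasurable u (volume.restrict (Icc 0 (τ i))) ∧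
      ∃ c, ∀ᵐ t ∂(volume.restrict (Icc 0 (τ i))), ‖u t‖ ≤ c := by
    intro i
    induction i with
    | zero =>
      intro _
      have e : volume.restrict (Icc 0 (τ 0)) = (0 : Measure ℝ) := by
        rw [h0, Icc_self, Measure.restrict_eq_zero]
        simp
      rw [e]
      exact ⟨h0.ge, aestronglyMeasurable_zero_measure _, 0, by simp⟩
    | succ i ih =>
      intro hi
      obtain ⟨i0, im, c, ic⟩ := ih (by omega)
      have hl := hlt i (by omega)
      have hae : ∀ᵐ t ∂(volume.restrict (Icc (τ i) (τ (i + 1)))), u t = u (τ i) := by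
        have ha : ∀ᵐ t : ℝ, t ≠ τ (i + 1) := by simp [ae_iff, measure_singleton]
        refine (ae_restrict_iff' measurableSet_Icc).2 ?_
        filter_upwards [ha] with t h1 h2
        exact hc i (by omega) t ⟨h2.1, lt_of_le_of_ne h2.2 h1⟩
      rw [← Icc_union_Icc_eq_Icc i0 hl.le]
      refine ⟨i0.trans hl.le, aestronglyMeasurable_union_iff.2 ⟨im,
        aestronglyMeasurable_const.congr (EventuallyEq.symm hae)⟩, max c ‖u (τ i)‖, ?_⟩
      rw [ae_restrict_union_iff]
      constructor
      · filter_upwards [ic] with t ht using ht.trans (le_max_left _ _)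
      · filter_upwards [hae] with t ht
        rw [ht]
        exact le_max_right _ _
  exact (key k le_rfl).2

/-- The constant speed factor exp σ is removed by rescaling time: the cell becomes an arc of `f` of
duration exp σ · (b - a) with constant control y. -/
theorem mem_reachableSet_of_isSolution_timed {a b σ : ℝ} (hab : a < b) {y : ControlSpace m}
    {w : ℝ → ℝ × ControlSpace m} {γ : ℝ → M} (h : IsSolution (timed f) w a b γ)
    (hw : ∀ t ∈ Ico a b, w t = (σ, y)) : γ b ∈ reachableSet 𝓘(ℝ, E) f (γ a) := by
  have hexp := Real.exp_pos σ
  have e1 : Real.exp (-σ) * (Real.exp σ * (b - a)) + a = b := by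
    rw [← mul_assoc, ← Real.exp_add]
    simp
  have hb : ∀ᵐ t : ℝ, t ≠ b := by simp [ae_iff, measure_singleton]
  have k0 : HasVelocityOn 𝓘(ℝ, E) a b γ (fun t => (Real.exp σ • (f (γ t) y : E) : E)) := by
    refine HasVelocityOn.congr_velocity h ((ae_restrict_iff' measurableSet_Icc).2 ?_)
    filter_upwards [hb] with t h1 h2
    rw [hw t ⟨h2.1, lt_of_le_of_ne h2.2 h1⟩, timed]
  have k1 := HasVelocityOn.comp_affine k0 (α := Real.exp (-σ)) (β := a) (Real.exp_pos _)
    (a' := 0) (b' := Real.exp σ * (b - a)) (by simp) e1.le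
  have k2 := mem_reachableSet_of_const (F := f) (c := y) (by have := sub_pos.2 hab; positivity)
    (HasVelocityOn.congr_velocity k1 (Eventually.of_forall fun t => by
      refine (smul_smul _ _ (f _ y : E)).trans ?_
      rw [← Real.exp_add, neg_add_cancel, Real.exp_zero]
      exact one_smul ℝ (f _ y : E)))
  simpa only [e1, mul_zero, zero_add] using k2

/-- Rescaling time by a constant keeps the affine control affine, with slope exp(-σ) d; that slope
is the constant control of the integrator on this cell. -/
theorem mem_reachableSet_integratorExtension {a b σ : ℝ} (hab : a < b) {y d : ControlSpace m}
    {w : ℝ → ℝ × ControlSpace m} {γ : ℝ → M} (h : IsSolution (timed f) w a b γ)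
    (hw : ∀ t ∈ Ico a b, w t = (σ, y + (t - a) • d)) :
    (γ b, y + (b - a) • d) ∈
      reachableSet (𝓘(ℝ, E).prod (𝓡 m)) (integratorExtension 𝓘(ℝ, E) f) (γ a, y) := by
  have hexp := Real.exp_pos σ
  have e1 : Real.exp (-σ) * (Real.exp σ * (b - a)) + a = b := by
    rw [← mul_assoc, ← Real.exp_add]
    simp
  have e2 : (Real.exp σ * (b - a)) * Real.exp (-σ) = b - a := by linarith
  have hb : ∀ᵐ t : ℝ, t ≠ b := by simp [ae_iff, measure_singleton]
  have k0 : HasVelocityOn 𝓘(ℝ, E) a b γ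
      (fun t => (Real.exp σ • (f (γ t) (y + (t - a) • d) : E) : E)) := by
    refine HasVelocityOn.congr_velocity h ((ae_restrict_iff' measurableSet_Icc).2 ?_)
    filter_upwards [hb] with t h1 h2
    rw [hw t ⟨h2.1, lt_of_le_of_ne h2.2 h1⟩, timed]
  have k1 := HasVelocityOn.comp_affine k0 (α := Real.exp (-σ)) (β := a) (Real.exp_pos _)
    (a' := 0) (b' := Real.exp σ * (b - a)) (by simp) e1.le
  have k2 := k1.prodMk_affine y (Real.exp (-σ) • d)
  have k3 := mem_reachableSet_of_const (F := integratorExtension 𝓘(ℝ, E) f)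
    (c := Real.exp (-σ) • d) (by have := sub_pos.2 hab; positivity)
    (HasVelocityOn.congr_velocity k2 (Eventually.of_forall fun t => by
      refine Prod.ext ?_ rfl
      change (Real.exp (-σ) • Real.exp σ • (f _ (y + (Real.exp (-σ) * t + a - a) • d) : E) : E)
        = f _ (y + t • Real.exp (-σ) • d)
      refine (smul_smul _ _ (f _ _ : E)).trans ?_
      rw [← Real.exp_add, neg_add_cancel, Real.exp_zero, add_sub_cancel_right, smul_smul,
        mul_comm t]
      exact one_smul ℝ (f _ _ : E)))
  simpa only [e1, e2, mul_zero, zero_add, smul_smul, zero_smul, zero_mul, add_zero] using k3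

end Timed

/-! ### From nodal controls to piecewise constant ones -/

section NodalReachability

variable {E : Type*} [NormedAddCommGroup E] [NormedSpace ℝ E]
  {M : Type*} [TopologicalSpace M] [ChartedSpace E M] {m : ℕ}
  {f : (x : M) → ControlSpace m → TangentSpace 𝓘(ℝ, E) x}
  {κ T : ℝ} {k : ℕ} {a : ℕ → ℝ × ControlSpace m} {γ : ℝ → M}

theorem floor_mul_div_eq (hT : 0 < T) (hk : 0 < k) {i : ℕ} {t : ℝ}
    (ht : t ∈ Ico ((i : ℝ) * T / k) (((i + 1 : ℕ) : ℝ) * T / k)) : ⌊t * k / T⌋₊ = i := by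
  have hk' : (0 : ℝ) < k := by exact_mod_cast hk
  have h1 := ht.1
  have h2 := ht.2
  rw [div_le_iff₀ hk'] at h1
  rw [lt_div_iff₀ hk'] at h2
  have h0 : 0 ≤ t * k / T := div_nonneg (le_trans (by positivity) h1) hT.le
  rw [Nat.floor_eq_iff h0]
  exact ⟨(le_div_iff₀ hT).2 h1, (div_lt_iff₀ hT).2 (by exact_mod_cast h2)⟩

theorem nodeTime_lt (hT : 0 < T) (hk : 0 < k) (i : ℕ) :
    (i : ℝ) * T / k < ((i + 1 : ℕ) : ℝ) * T / k := by
  have hk' : (0 : ℝ) < k := by exact_mod_cast hk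
  gcongr
  exact Nat.lt_succ_self i

theorem nodeTime_le (hT : 0 < T) (hk : 0 < k) {i : ℕ} (hi : i ≤ k) : (i : ℝ) * T / k ≤ T := by
  have hk' : (0 : ℝ) < k := by exact_mod_cast hk
  rw [div_le_iff₀ hk', mul_comm]
  gcongr

theorem mem_reachableSet_of_nodal (hT : 0 < T) (hk : 0 < k)
    (h : IsSolution (timed f) (nodal 0 T k a) 0 T γ) : γ T ∈ reachableSet 𝓘(ℝ, E) f (γ 0) := by
  have hk' : (k : ℝ) ≠ 0 := by exact_mod_cast hk.ne'
  have key := mem_reachableSet_of_chain hk (F := f) (I := 𝓘(ℝ, E))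
    (z := fun i : ℕ => γ (i * T / k)) fun i hi =>
      mem_reachableSet_of_isSolution_timed (nodeTime_lt hT hk i) (σ := (a i).1) (y := (a i).2)
        (HasVelocityOn.mono h (by positivity) (nodeTime_le hT hk hi)) fun t ht => by
          simp [nodal, floor_mul_div_eq hT hk ht]
  simpa [mul_div_cancel_left₀ _ hk'] using key

theorem mem_reachableSet_integratorExtension_of_nodal (hT : 0 < T) (hk : 0 < k)
    (h : IsSolution (timed f) (nodal 1 T k a) 0 T γ) :
    (γ T, (a k).2) ∈
      reachableSet (𝓘(ℝ, E).prod (𝓡 m)) (integratorExtension 𝓘(ℝ, E) f) (γ 0, (a 0).2) := by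
  have hk' : (k : ℝ) ≠ 0 := by exact_mod_cast hk.ne'
  have key := mem_reachableSet_of_chain hk (F := integratorExtension 𝓘(ℝ, E) f)
    (I := 𝓘(ℝ, E).prod (𝓡 m)) (z := fun i : ℕ => (γ (i * T / k), (a i).2)) fun i hi => by
      have := mem_reachableSet_integratorExtension (nodeTime_lt hT hk i) (σ := (a i).1)
        -- With this slope a cell of length T / k leads from node i to node i + 1, so consecutive
        -- arcs match in the y-component, although the speed may jump.
        (y := (a i).2) (d := (k / T) • ((a (i + 1)).2 - (a i).2))
        (HasVelocityOn.mono h (by positivity) (nodeTime_le hT hk hi)) fun t ht => by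
          rw [nodal, floor_mul_div_eq hT hk ht, one_mul, smul_smul]
          congr 3
          field_simp
      rw [smul_smul] at this
      have e : (((i + 1 : ℕ) : ℝ) * T / k - i * T / k) * (k / T) = 1 := by
        push_cast
        field_simp
        ring
      rwa [e, one_smul, add_sub_cancel] at this
  simpa [mul_div_cancel_left₀ _ hk'] using key

end NodalReachability

/-! ### The two implications -/

section Main

variable {E : Type*} [NormedAddCommGroup E] [NormedSpace ℝ E] [FiniteDimensional ℝ E]
  {M : Type*} [TopologicalSpace M] [ChartedSpace E M] [IsManifold 𝓘(ℝ, E) ∞ M] [T2Space M] {m : ℕ}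
  {f : (x : M) → ControlSpace m → TangentSpace 𝓘(ℝ, E) x}

/-- Nodal controls with κ = 1 are affine in y on each cell and start and end at the required y₀ and
y₁; the end nodes of the speed component are irrelevant and set to 0. -/
theorem IsGloballyControllable.integratorExtension (hf : IsSmoothControlled f)
    (h : IsGloballyControllable 𝓘(ℝ, E) f) :
    IsGloballyControllable (𝓘(ℝ, E).prod (𝓡 m)) (integratorExtension 𝓘(ℝ, E) f) := by
  have hreach : ∀ x q : M, q ≠ x → ∃ w ∈ boundedControls (ℝ × ControlSpace m), ∃ γ,
      IsSolution (timed f) w 0 1 γ ∧ γ 0 = x ∧ γ 1 = q := by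
    intro x q hq
    obtain ⟨T, u, γ, hT, hu, hγ, rfl, rfl⟩ : q ∈ reachableSet 𝓘(ℝ, E) f x := by
      rw [h x]
      exact mem_univ q
    have hTpos : 0 < T := hT.lt_of_ne (by rintro rfl; exact hq rfl)
    obtain ⟨hum, c, huc⟩ := hu.aestronglyMeasurable_and_bounded
    exact exists_isSolution_timed hTpos hum huc hγ
  rintro ⟨x₀, y₀⟩
  refine eq_univ_of_forall ?_
  rintro ⟨q, y₁⟩
  obtain ⟨T, k, a, γ, hT, hk, ha0, hak, hγ, rfl, rfl⟩ := exists_nodal_solution hf.timed hreach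
    (κ := 1) (by simp) x₀ q ((0 : ℝ), y₀) ((0 : ℝ), y₁)
  have := mem_reachableSet_integratorExtension_of_nodal hT hk hγ
  rwa [ha0, hak] at this

/-- The y-component of a trajectory of the extension is a continuous, hence bounded, control
steering x. Nodal controls with κ = 0 then replace it by a piecewise constant one. -/
theorem IsGloballyControllable.of_integratorExtension (hf : IsSmoothControlled f)
    (h : IsGloballyControllable (𝓘(ℝ, E).prod (𝓡 m))
      (ControlSystem.integratorExtension 𝓘(ℝ, E) f)) :
    IsGloballyControllable 𝓘(ℝ, E) f := by
  have hreach : ∀ x q : M, q ≠ x → ∃ w ∈ boundedControls (ℝ × ControlSpace m), ∃ γ,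
      IsSolution (timed f) w 0 1 γ ∧ γ 0 = x ∧ γ 1 = q := by
    intro x q hq
    obtain ⟨T, v, z, hT, -, hz, hz0, hzT⟩ : (q, (0 : ControlSpace m)) ∈ reachableSet
        (𝓘(ℝ, E).prod (𝓡 m)) (ControlSystem.integratorExtension 𝓘(ℝ, E) f) (x, 0) := by
      rw [h]
      exact mem_univ _
    have hTpos : 0 < T := hT.lt_of_ne (by
      rintro rfl
      exact hq (congrArg Prod.fst (hzT.symm.trans hz0)))
    have hy : ContinuousOn (fun t => (z t).2) (Icc 0 T) := hz.1.1.snd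
    obtain ⟨c, hc⟩ := isCompact_Icc.exists_bound_of_continuousOn hy
    obtain ⟨w, hw, γ, hγ, hγ0, hγ1⟩ := exists_isSolution_timed hTpos
      (hy.aestronglyMeasurable measurableSet_Icc)
      ((ae_restrict_iff' measurableSet_Icc).2 (Eventually.of_forall hc)) (HasVelocityOn.fst hz)
    exact ⟨w, hw, γ, hγ, by rw [hγ0, hz0], by rw [hγ1, hzT]⟩
  intro x₀
  refine eq_univ_of_forall fun q => ?_
  obtain ⟨T, k, a, γ, hT, hk, -, -, hγ, rfl, rfl⟩ := exists_nodal_solution hf.timed hreach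
    (κ := 0) (by simp) x₀ q 0 0
  exact mem_reachableSet_of_nodal hT hk hγ

end Main

end ControlSystem

end

theorem theorem1 (n m : ℕ) {M : Type*} [TopologicalSpace M]
    [ChartedSpace (EuclideanSpace ℝ (Fin n)) M] [IsManifold (𝓡 n) ∞ M]
    [T2Space M] [SecondCountableTopology M] [ConnectedSpace M]
    (f : (x : M) → ControlSystem.ControlSpace m → TangentSpace (𝓡 n) x)
    (hf : ControlSystem.IsSmoothSystem (𝓡 n) f) :
    ControlSystem.IsGloballyControllable (𝓡 n) f ↔
      ControlSystem.IsGloballyControllable ((𝓡 n).prod (𝓡 m))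
        (ControlSystem.integratorExtension (𝓡 n) f) :=
  ⟨fun h => h.integratorExtension hf, fun h => h.of_integratorExtension hf⟩
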